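/- **Calculus.** We work in the polyadic internal $\pi$-calculus $\pi\mathrm I$ with two sorts of names: location names $p,q,r,\dots$, each carrying a pair (variable name, location name), and variable names $x,y,z,\dots$, each carrying one location name. Processes, taken up to $\alpha$-conversion, are $$P ::= 0 \mid a(\tilde b).P \mid \overline a(\tilde b).P \mid\ !a(\tilde b).P \mid (\nu a)P \mid P\,|\,P \mid K\langle\tilde a\rangle ,$$ where inputs and outputs both bind $\tilde b$, and each constant $K$ has one recursive definition $K\stackrel{\rm def}{=}(\tilde a)P$ with $\mathrm{fn}(P)\subseteq\tilde a$; besides the wires below, arbitrary further constants are allowed. Bound names are pairwise distinct, and so are the ends of a wire. Transitions $P\xrightarrow{\mu}P'$, with $\mu$ an input $a(\tilde b)$, a bound output $\overline a(\tilde b)$ or $\tau$, are the usual ones (with $P\,|\,Q\xrightarrow{\tau}(\nu\tilde b)(P'\,|\,Q')$ for a communication, and a constant having the transitions of its unfolding). A relation $\mathcal R$ is an *expansion* if $P\mathrel{\mathcal R}Q$ implies: (i) if $P\xrightarrow{\mu}P'$ then $Q\Rightarrow\xrightarrow{\mu}\Rightarrow Q'$ with $P'\mathrel{\mathcal R}Q'$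 for some $Q'$; (ii) if $Q\xrightarrow{\mu}Q'$ then $P'\mathrel{\mathcal R}Q'$ for some $P'$ such that $P\xrightarrow{\mu}P'$, or $\mu=\tau$ and $P'=P$. Here $\Rightarrow$ is the reflexive transitive closure of $\xrightarrow{\tau}$, and bound names of $\mu$ are fresh. We write $Q\succsim P$ if $(P,Q)$ belongs to some expansion. **Permeable prefixes.** Let $a\leftrightarrow b$ denote a wire (process) for names $a,b$ of the same sort. Permeable prefixes are the abbreviations $$\begin{aligned} p(x,q){:}P &:= (\nu x,q)\bigl(p(x',q').(x\leftrightarrow x'\mid q'\leftrightarrow q)\mid P\bigr), & \overline p(x,q){:}P &:= (\nu x,q)\bigl(\overline p(x',q').(x'\leftrightarrow x\mid q\leftrightarrow q')\mid P\bigr),\\ x(p){:}P &:= (\nu p)\bigl(x(p').\,p'\leftrightarrow p\mid P\bigr), & \overline x(p){:}P &:= (\nu p)\bigl(\overline x(p').\,p\leftrightarrow p'\mid P\bigr). \end{aligned}$$ **Concrete wires.** The I-O, O-I and P wires are defined by recursion as follows; in each class the permeable prefixes are those over the wires of that class. The variable wires are in all three classes $x\leftrightarrow y := {!x(p)}.\,\overline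 y(q){:}(p\leftrightarrow q)$, and the location wires are $$\begin{aligned} \text{I-O:}\quad p\leftrightarrow q &:= p(y,p_1).\ \overline q(x,q_1){:}\,(p_1\leftrightarrow q_1\mid x\leftrightarrow y),\\ \text{O-I:}\quad p\leftrightarrow q &:= \overline q(x,q_1).\ p(y,p_1){:}\,(p_1\leftrightarrow q_1\mid x\leftrightarrow y),\\ \text{P:}\quad p\leftrightarrow q &:= p(y,p_1){:}\ \overline q(x,q_1){:}\,(p_1\leftrightarrow q_1\mid x\leftrightarrow y). \end{aligned}$$ **Lemma.** Each of the three classes of wires satisfies the following laws, where $a,b,c$ are pairwise distinct names of the same sort, $p\ne q$, $x\neq y$, and $P$ is any process. 1. The free names of $a\leftrightarrow b$ are $a$ and $b$; moreover $a\leftrightarrow b$ uses $a$ only in input and $b$ only in output (also after unfolding constants). 2. If $a\leftrightarrow b\xrightarrow{\mu}P$ for some $P$, then $\mu\neq\tau$. 3. (Transitivity) $(\nu b)(a\leftrightarrow b\mid b\leftrightarrow c)\succsim a\leftrightarrow c$. 4. $(\nu q)(p\leftrightarrow q\mid q(x,r){:}P)\succsim p(x,r){:}P$, provided that $q\notin\mathrm{fn}(P)$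 and $(\nu x,r)(x\leftrightarrow x'\mid r'\leftrightarrow r\mid P)\succsim P\{x',r'/x,r\}$ with $x',r'$ fresh. 5. $(\nu p)(p\leftrightarrow q\mid \overline p(x,r){:}P)\succsim \overline q(x,r){:}P$, provided that $p\notin\mathrm{fn}(P)$ and $(\nu x,r)(x'\leftrightarrow x\mid r\leftrightarrow r'\mid P)\succsim P\{x',r'/x,r\}$ with $x',r'$ fresh. 6. $(\nu y)(x\leftrightarrow y\mid {!y(p)}.P)\succsim {!x(p)}.P$, provided that $y\notin\mathrm{fn}(P)$ and $(\nu p)(p'\leftrightarrow p\mid P)\succsim P\{p'/p\}$ with $p'$ fresh. 7. $(\nu x)(x\leftrightarrow y\mid \overline x(p){:}P)\succsim \overline y(p){:}P$, provided that $x\notin\mathrm{fn}(P)$ and $(\nu p)(p\leftrightarrow p'\mid P)\succsim P\{p'/p\}$ with $p'$ fresh. 8. $x\leftrightarrow y$ is a replicated input at $x$, i.e. $x\leftrightarrow y={!x(p)}.P$ for some $P$. (In 4 and 5 the bound name $r$ differs from $p$ and $q$.) Moreover transitivity extends to chains of arbitrary length: put $\mathrm{chain}^1(a,b):=a\leftrightarrow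 b$ and $\mathrm{chain}^{n+1}(a,b):=(\nu c)(\mathrm{chain}^n(a,c)\mid c\leftrightarrow b)$ with $c\notin\{a,b\}$; then $\mathrm{chain}^n(a,b)\succsim a\leftrightarrow b$ for every $n\ge1$ and all $a\neq b$ of the same sort, for each of the three classes. -/

import Mathlib

namespace PiI

/-! The polyadic internal pi-calculus, with two sorts of names: location names, which carry a
pair (variable name, location name), and variable names, which carry one location name.

Processes are taken up to alpha-conversion by means of a well-scoped nameless syntax:
`Proc S L V` is the type of processes whose free location names are in `L` and whose free variable
names are in `V`.  A binder for a location name passes from `L` to `Option L`, and a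
binder for a variable name passes from `V` to `Option V`; in both cases `none` is the name that has
just been bound and `some a` is the old name `a`.  Since all outputs are bound, substitutions
are renamings of names by names. -/

/-- The two polarities of a prefix. -/
inductive Pol where
  | inp : Pol
  | out : Pol

def Pol.dual : Pol → Pol
  | .inp => .out
  | .out => .inp

/-- The three classes of wires: `io` is input before output, `oi` is output before input and
`par` is input and output in parallel. -/
inductive WireKind where
  | io : WireKind
  | oi : WireKind
  | par : WireKind

/-- The process constants other than the wires, each with its numbers of
location parameters and of variable parameters. -/
structure Sig where
  Const : Type
  locArity : Const → ℕ
  varArity : Const → ℕ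

inductive Proc (S : Sig) : Type → Type → Type 1 where
  /-- The inactive process. -/
  | nil {L V : Type} : Proc S L V
  /-- The prefix `p(x,q).P` (input) or its bound output analogue, at a location name `p`. -/
  | locPre {L V : Type} (d : Pol) (p : L) (P : Proc S (Option L) (Option V)) : Proc S L V
  /-- The prefix `x(p).P` (input) or its bound output analogue, at a variable name `x`. -/
  | varPre {L V : Type} (d : Pol) (x : V) (P : Proc S (Option L) V) : Proc S L V
  /-- The replicated input `!p(x,q).P`. -/
  | locRep {L V : Type} (p : L) (P : Proc S (Option L) (Option V)) : Proc S L V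
  /-- The replicated input `!x(p).P`. -/
  | varRep {L V : Type} (x : V) (P : Proc S (Option L) V) : Proc S L V
  /-- Parallel composition. -/
  | par {L V : Type} (P Q : Proc S L V) : Proc S L V
  /-- Restriction of a location name. -/
  | resL {L V : Type} (P : Proc S (Option L) V) : Proc S L V
  /-- Restriction of a variable name. -/
  | resV {L V : Type} (P : Proc S L (Option V)) : Proc S L V
  /-- One of the three location wire constants, applied to two location names. -/
  | wire {L V : Type} (k : WireKind) (p q : L) : Proc S L V
  /-- Any other constant, applied to a tuple of names. -/
  | call {L V : Type} (c : S.Const) (a : Fin (S.locArity c) → L) (b : Fin (S.varArity c) → V) :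
      Proc S L V

/-- The recursive definitions of the constants of the signature: one body for each constant, whose
free names are among its parameters.  Bodies may use all constants, wires included. -/
def Defs (S : Sig) : Type 1 :=
  ∀ c : S.Const, Proc S (Fin (S.locArity c)) (Fin (S.varArity c))

variable {S : Sig}

namespace Proc

/-- Renaming of the free names (capture-avoiding by construction). -/
def map {L V L' V' : Type} (f : L → L') (g : V → V') : Proc S L V → Proc S L' V'
  | nil => nil
  | locPre d p P => locPre d (f p) (P.map (Option.map f) (Option.map g))
  | varPre d x P => varPre d (g x) (P.map (Option.map f) g)
  | locRep p P => locRep (f p) (P.map (Option.map f) (Option.map g))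
  | varRep x P => varRep (g x) (P.map (Option.map f) g)
  | par P Q => par (P.map f g) (Q.map f g)
  | resL P => resL (P.map (Option.map f) g)
  | resV P => resV (P.map f (Option.map g))
  | wire k p q => wire k (f p) (f q)
  | call c a b => call c (f ∘ a) (g ∘ b)

/-- The free location names. -/
def locFn {L V : Type} : Proc S L V → Set L
  | nil => ∅
  | locPre _ p P => {p} ∪ {a | some a ∈ P.locFn}
  | varPre _ _ P => {a | some a ∈ P.locFn}
  | locRep p P => {p} ∪ {a | some a ∈ P.locFn}
  | varRep _ P => {a | some a ∈ P.locFn}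
  | par P Q => P.locFn ∪ Q.locFn
  | resL P => {a | some a ∈ P.locFn}
  | resV P => P.locFn
  | wire _ p q => {p, q}
  | call _ a _ => Set.range a

/-- The free variable names. -/
def varFn {L V : Type} : Proc S L V → Set V
  | nil => ∅
  | locPre _ _ P => {x | some x ∈ P.varFn}
  | varPre _ x P => {x} ∪ P.varFn
  | locRep _ P => {x | some x ∈ P.varFn}
  | varRep x P => {x} ∪ P.varFn
  | par P Q => P.varFn ∪ Q.varFn
  | resL P => P.varFn
  | resV P => {x | some x ∈ P.varFn}
  | wire _ _ _ => ∅
  | call _ _ b => Set.range b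

end Proc

open Proc

/-- The exchange of the two most recently bound names. -/
def swap {A : Type} : Option (Option A) → Option (Option A)
  | none => some none
  | some none => none
  | some (some a) => some (some a)

/-! ### Wires as parameters, and permeable prefixes -/

/-- A choice of location wires and variable wires.  The first argument of `loc` and of `var` is the
name meant to be used in input, the second one is the name meant to be used in output. -/
structure Wires (S : Sig) where
  loc : {L V : Type} → L → L → Proc S L V
  var : {L V : Type} → V → V → Proc S L V

/-- The permeable prefixes at a location name `p`, over given families of wires, with bound
names `x, q`.  For an input this is
`(ν x, q)(p(x',q').(var x x' | loc q' q) | P)`, and for an output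
it is `(ν x, q)(p̄(x',q').(var x' x | loc q q') | P)`.
Below the inner prefix, `none` is the primed name and `some none` the unprimed one. -/
def permLoc (loc : {L V : Type} → L → L → Proc S L V) (var : {L V : Type} → V → V → Proc S L V)
    {L V : Type} (d : Pol) (p : L) (P : Proc S (Option L) (Option V)) : Proc S L V :=
  match d with
  | .inp => resV (resL (par
      (locPre .inp (some p) (par (var (some none) none) (loc none (some none)))) P))
  | .out => resV (resL (par
      (locPre .out (some p) (par (var none (some none)) (loc (some none) none))) P))

/-- The permeable prefixes at a variable name `x`, over a given family of location wires, with
bound name `p`.  For an input this is `(ν p)(x(p').loc p' p | P)`, and for an output it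
is `(ν p)(x̄(p').loc p p' | P)`. -/
def permVar (loc : {L V : Type} → L → L → Proc S L V)
    {L V : Type} (d : Pol) (x : V) (P : Proc S (Option L) V) : Proc S L V :=
  match d with
  | .inp => resL (par (varPre .inp x (loc none (some none))) P)
  | .out => resL (par (varPre .out x (loc (some none) none)) P)

/-! ### The concrete wires -/

/-- The variable wire between `x` and `y`: `!x(p). ȳ(q): loc p q`, with a permeable output at `y`.
It is the same for the three classes, up to the location wires used.
All recursion goes through the location wires. -/
def varWire (k : WireKind) {L V : Type} (x y : V) : Proc S L V :=
  varRep x (permVar (fun p q => wire k p q) .out y (wire k (some none) none))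

/-- The right-hand sides of the recursive definitions of the location wires, where a colon marks
a permeable prefix:
* `io`: `p(y,p₁). q̄(x,q₁): (loc p₁ q₁ | var x y)`
* `oi`: `q̄(x,q₁). p(y,p₁): (loc p₁ q₁ | var x y)`
* `par`: `p(y,p₁): q̄(x,q₁): (loc p₁ q₁ | var x y)`
-/
def wireBody (k : WireKind) {L V : Type} (p q : L) : Proc S L V :=
  match k with
  | .io => locPre .inp p
      (permLoc (fun a b => wire .io a b) (fun a b => varWire .io a b) .out (some q)
        (par (wire .io (some none) none) (varWire .io none (some none))))
  | .oi => locPre .out q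
      (permLoc (fun a b => wire .oi a b) (fun a b => varWire .oi a b) .inp (some p)
        (par (wire .oi none (some none)) (varWire .oi (some none) none)))
  | .par => permLoc (fun a b => wire .par a b) (fun a b => varWire .par a b) .inp p
      (permLoc (fun a b => wire .par a b) (fun a b => varWire .par a b) .out (some q)
        (par (wire .par (some none) none) (varWire .par none (some none))))

/-- The concrete wires of each class. -/
def concreteWires (S : Sig) (k : WireKind) : Wires S where
  loc := fun p q => wire k p q
  var := fun x y => varWire k x y

/-! ### Operational semantics

All visible actions carry bound names only, so the derivative of an action lives in the context
that is extended with the names carried by the action. -/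

/-- Transitions with an input or a bound output at a location name. -/
inductive LocStep (D : Defs S) :
    {L V : Type} → Pol → L → Proc S L V → Proc S (Option L) (Option V) → Prop where
  | pre {L V : Type} {d : Pol} {p : L} {P : Proc S (Option L) (Option V)} :
      LocStep D d p (locPre d p P) P
  | rep {L V : Type} {p : L} {P : Proc S (Option L) (Option V)} :
      LocStep D .inp p (locRep p P) (par P ((locRep p P).map some some))
  | parL {L V : Type} {d : Pol} {p : L} {P Q : Proc S L V} {P' : Proc S (Option L) (Option V)} :
      LocStep D d p P P' → LocStep D d p (par P Q) (par P' (Q.map some some))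
  | parR {L V : Type} {d : Pol} {p : L} {P Q : Proc S L V} {Q' : Proc S (Option L) (Option V)} :
      LocStep D d p Q Q' → LocStep D d p (par P Q) (par (P.map some some) Q')
  | resL {L V : Type} {d : Pol} {p : L} {P : Proc S (Option L) V}
      {P' : Proc S (Option (Option L)) (Option V)} :
      LocStep D d (some p) P P' → LocStep D d p (resL P) (resL (P'.map swap id))
  | resV {L V : Type} {d : Pol} {p : L} {P : Proc S L (Option V)}
      {P' : Proc S (Option L) (Option (Option V))} :
      LocStep D d p P P' → LocStep D d p (resV P) (resV (P'.map id swap))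
  | wire {L V : Type} {d : Pol} {p : L} {k : WireKind} {a b : L}
      {P' : Proc S (Option L) (Option V)} :
      LocStep D d p (wireBody k a b) P' → LocStep D d p (wire k a b) P'
  | call {L V : Type} {d : Pol} {p : L} {c : S.Const} {a : Fin (S.locArity c) → L}
      {b : Fin (S.varArity c) → V} {P' : Proc S (Option L) (Option V)} :
      LocStep D d p ((D c).map a b) P' → LocStep D d p (call c a b) P'

/-- Transitions with an input or a bound output at a variable name. -/
inductive VarStep (D : Defs S) :
    {L V : Type} → Pol → V → Proc S L V → Proc S (Option L) V → Prop where
  | pre {L V : Type} {d : Pol} {x : V} {P : Proc S (Option L) V} :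
      VarStep D d x (varPre d x P) P
  | rep {L V : Type} {x : V} {P : Proc S (Option L) V} :
      VarStep D .inp x (varRep x P) (par P ((varRep x P).map some id))
  | parL {L V : Type} {d : Pol} {x : V} {P Q : Proc S L V} {P' : Proc S (Option L) V} :
      VarStep D d x P P' → VarStep D d x (par P Q) (par P' (Q.map some id))
  | parR {L V : Type} {d : Pol} {x : V} {P Q : Proc S L V} {Q' : Proc S (Option L) V} :
      VarStep D d x Q Q' → VarStep D d x (par P Q) (par (P.map some id) Q')
  | resL {L V : Type} {d : Pol} {x : V} {P : Proc S (Option L) V}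
      {P' : Proc S (Option (Option L)) V} :
      VarStep D d x P P' → VarStep D d x (resL P) (resL (P'.map swap id))
  | resV {L V : Type} {d : Pol} {x : V} {P : Proc S L (Option V)}
      {P' : Proc S (Option L) (Option V)} :
      VarStep D d (some x) P P' → VarStep D d x (resV P) (resV P')
  | wire {L V : Type} {d : Pol} {x : V} {k : WireKind} {a b : L} {P' : Proc S (Option L) V} :
      VarStep D d x (wireBody k a b) P' → VarStep D d x (wire k a b) P'
  | call {L V : Type} {d : Pol} {x : V} {c : S.Const} {a : Fin (S.locArity c) → L}
      {b : Fin (S.varArity c) → V} {P' : Proc S (Option L) V} :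
      VarStep D d x ((D c).map a b) P' → VarStep D d x (call c a b) P'

/-- Internal transitions. -/
inductive TauStep (D : Defs S) : {L V : Type} → Proc S L V → Proc S L V → Prop where
  | comLoc {L V : Type} {d : Pol} {p : L} {P Q : Proc S L V}
      {P' Q' : Proc S (Option L) (Option V)} :
      LocStep D d p P P' → LocStep D d.dual p Q Q' →
        TauStep D (par P Q) (resV (resL (par P' Q')))
  | comVar {L V : Type} {d : Pol} {x : V} {P Q : Proc S L V} {P' Q' : Proc S (Option L) V} :
      VarStep D d x P P' → VarStep D d.dual x Q Q' →
        TauStep D (par P Q) (resL (par P' Q'))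
  | parL {L V : Type} {P Q P' : Proc S L V} :
      TauStep D P P' → TauStep D (par P Q) (par P' Q)
  | parR {L V : Type} {P Q Q' : Proc S L V} :
      TauStep D Q Q' → TauStep D (par P Q) (par P Q')
  | resL {L V : Type} {P P' : Proc S (Option L) V} :
      TauStep D P P' → TauStep D (resL P) (resL P')
  | resV {L V : Type} {P P' : Proc S L (Option V)} :
      TauStep D P P' → TauStep D (resV P) (resV P')
  | wire {L V : Type} {k : WireKind} {a b : L} {P' : Proc S L V} :
      TauStep D (wireBody k a b) P' → TauStep D (wire k a b) P'
  | call {L V : Type} {c : S.Const} {a : Fin (S.locArity c) → L}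
      {b : Fin (S.varArity c) → V} {P' : Proc S L V} :
      TauStep D ((D c).map a b) P' → TauStep D (call c a b) P'

/-! ### Expansion -/

/-- The reflexive and transitive closure of the internal transitions. -/
def TauSteps (D : Defs S) {L V : Type} : Proc S L V → Proc S L V → Prop :=
  Relation.ReflTransGen (TauStep D)

/-- `R` is an expansion: if `R P Q`, every transition of `P` is matched by `Q` with a weak
transition (at least one internal step for an internal step), and every transition of `Q` is
matched by `P` with a single transition, or possibly with no move for an internal step. -/
structure IsExpansion (D : Defs S) (R : {L V : Type} → Proc S L V → Proc S L V → Prop) :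
    Prop where
  tau_left : ∀ {L V : Type} {P Q P' : Proc S L V}, R P Q → TauStep D P P' →
    ∃ Q', Relation.TransGen (TauStep D) Q Q' ∧ R P' Q'
  loc_left : ∀ {L V : Type} {P Q : Proc S L V} {d : Pol} {p : L}
    {P' : Proc S (Option L) (Option V)}, R P Q → LocStep D d p P P' →
    ∃ Q₁ Q₂ Q', TauSteps D Q Q₁ ∧ LocStep D d p Q₁ Q₂ ∧ TauSteps D Q₂ Q' ∧ R P' Q'
  var_left : ∀ {L V : Type} {P Q : Proc S L V} {d : Pol} {x : V}
    {P' : Proc S (Option L) V}, R P Q → VarStep D d x P P' →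
    ∃ Q₁ Q₂ Q', TauSteps D Q Q₁ ∧ VarStep D d x Q₁ Q₂ ∧ TauSteps D Q₂ Q' ∧ R P' Q'
  tau_right : ∀ {L V : Type} {P Q Q' : Proc S L V}, R P Q → TauStep D Q Q' →
    R P Q' ∨ ∃ P', TauStep D P P' ∧ R P' Q'
  loc_right : ∀ {L V : Type} {P Q : Proc S L V} {d : Pol} {p : L}
    {Q' : Proc S (Option L) (Option V)}, R P Q → LocStep D d p Q Q' →
    ∃ P', LocStep D d p P P' ∧ R P' Q'
  var_right : ∀ {L V : Type} {P Q : Proc S L V} {d : Pol} {x : V}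
    {Q' : Proc S (Option L) V}, R P Q → VarStep D d x Q Q' →
    ∃ P', VarStep D d x P P' ∧ R P' Q'

/-- `Expands D Q P` is `Q ≽ P`: the pair `(P, Q)` belongs to some expansion. -/
def Expands (D : Defs S) {L V : Type} (Q P : Proc S L V) : Prop :=
  ∃ R : {L V : Type} → Proc S L V → Proc S L V → Prop, IsExpansion D R ∧ R P Q

/-! ### Use of names -/

/-- `UsesLoc D d a P`: the free location name `a` occurs in `P` as the subject of a prefix with
polarity `d`, possibly after unfolding some constants. -/
inductive UsesLoc (D : Defs S) : {L V : Type} → Pol → L → Proc S L V → Prop where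
  | pre {L V : Type} {d : Pol} {p : L} {P : Proc S (Option L) (Option V)} :
      UsesLoc D d p (locPre d p P)
  | rep {L V : Type} {p : L} {P : Proc S (Option L) (Option V)} :
      UsesLoc D .inp p (locRep p P)
  | locPre {L V : Type} {d e : Pol} {a p : L} {P : Proc S (Option L) (Option V)} :
      UsesLoc D d (some a) P → UsesLoc D d a (locPre e p P)
  | varPre {L V : Type} {d e : Pol} {a : L} {x : V} {P : Proc S (Option L) V} :
      UsesLoc D d (some a) P → UsesLoc D d a (varPre e x P)
  | locRep {L V : Type} {d : Pol} {a p : L} {P : Proc S (Option L) (Option V)} :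
      UsesLoc D d (some a) P → UsesLoc D d a (locRep p P)
  | varRep {L V : Type} {d : Pol} {a : L} {x : V} {P : Proc S (Option L) V} :
      UsesLoc D d (some a) P → UsesLoc D d a (varRep x P)
  | parL {L V : Type} {d : Pol} {a : L} {P Q : Proc S L V} :
      UsesLoc D d a P → UsesLoc D d a (par P Q)
  | parR {L V : Type} {d : Pol} {a : L} {P Q : Proc S L V} :
      UsesLoc D d a Q → UsesLoc D d a (par P Q)
  | resL {L V : Type} {d : Pol} {a : L} {P : Proc S (Option L) V} :
      UsesLoc D d (some a) P → UsesLoc D d a (resL P)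
  | resV {L V : Type} {d : Pol} {a : L} {P : Proc S L (Option V)} :
      UsesLoc D d a P → UsesLoc D d a (resV P)
  | wire {L V : Type} {d : Pol} {a : L} {k : WireKind} {p q : L} :
      UsesLoc D d a (wireBody k p q : Proc S L V) → UsesLoc D d a (wire k p q : Proc S L V)
  | call {L V : Type} {d : Pol} {a : L} {c : S.Const} {u : Fin (S.locArity c) → L}
      {v : Fin (S.varArity c) → V} :
      UsesLoc D d a ((D c).map u v) → UsesLoc D d a (call c u v)

/-- `UsesVar D d x P`: the same for a free variable name `x`. -/
inductive UsesVar (D : Defs S) : {L V : Type} → Pol → V → Proc S L V → Prop where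
  | pre {L V : Type} {d : Pol} {x : V} {P : Proc S (Option L) V} :
      UsesVar D d x (varPre d x P)
  | rep {L V : Type} {x : V} {P : Proc S (Option L) V} :
      UsesVar D .inp x (varRep x P)
  | locPre {L V : Type} {d e : Pol} {x : V} {p : L} {P : Proc S (Option L) (Option V)} :
      UsesVar D d (some x) P → UsesVar D d x (locPre e p P)
  | varPre {L V : Type} {d e : Pol} {x y : V} {P : Proc S (Option L) V} :
      UsesVar D d x P → UsesVar D d x (varPre e y P)
  | locRep {L V : Type} {d : Pol} {x : V} {p : L} {P : Proc S (Option L) (Option V)} :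
      UsesVar D d (some x) P → UsesVar D d x (locRep p P)
  | varRep {L V : Type} {d : Pol} {x y : V} {P : Proc S (Option L) V} :
      UsesVar D d x P → UsesVar D d x (varRep y P)
  | parL {L V : Type} {d : Pol} {x : V} {P Q : Proc S L V} :
      UsesVar D d x P → UsesVar D d x (par P Q)
  | parR {L V : Type} {d : Pol} {x : V} {P Q : Proc S L V} :
      UsesVar D d x Q → UsesVar D d x (par P Q)
  | resL {L V : Type} {d : Pol} {x : V} {P : Proc S (Option L) V} :
      UsesVar D d x P → UsesVar D d x (resL P)
  | resV {L V : Type} {d : Pol} {x : V} {P : Proc S L (Option V)} :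
      UsesVar D d (some x) P → UsesVar D d x (resV P)
  | wire {L V : Type} {d : Pol} {x : V} {k : WireKind} {p q : L} :
      UsesVar D d x (wireBody k p q : Proc S L V) → UsesVar D d x (wire k p q : Proc S L V)
  | call {L V : Type} {d : Pol} {x : V} {c : S.Const} {u : Fin (S.locArity c) → L}
      {v : Fin (S.varArity c) → V} :
      UsesVar D d x ((D c).map u v) → UsesVar D d x (call c u v)

/-! ### Restricted compositions of a wire with a process

In each of the four definitions below the process `P` has the names to be bound as its most recent
names, the restricted composition lives in the context extended with the fresh names, and
it is compared with `P` in which the bound names are replaced by the fresh ones; in the nameless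
syntax the latter is `P` itself. -/

/-- `(ν x, r)(var x x' | loc r' r | P) ≽ P{x',r'/x,r}`, with `x', r'` fresh. -/
def RespectfulIn (D : Defs S) (W : Wires S) {L V : Type}
    (P : Proc S (Option L) (Option V)) : Prop :=
  Expands D
    (resV (resL (par (par (W.var none (some none)) (W.loc (some none) none))
      (P.map (Option.map some) (Option.map some)))))
    P

/-- `(ν x, r)(var x' x | loc r r' | P) ≽ P{x',r'/x,r}`, with `x', r'` fresh. -/
def RespectfulOut (D : Defs S) (W : Wires S) {L V : Type}
    (P : Proc S (Option L) (Option V)) : Prop :=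
  Expands D
    (resV (resL (par (par (W.var (some none) none) (W.loc none (some none)))
      (P.map (Option.map some) (Option.map some)))))
    P

/-- `(ν p)(loc p' p | P) ≽ P{p'/p}`, with `p'` fresh. -/
def LocRespectfulIn (D : Defs S) (W : Wires S) {L V : Type} (P : Proc S (Option L) V) : Prop :=
  Expands D (resL (par (W.loc (some none) none) (P.map (Option.map some) id))) P

/-- `(ν p)(loc p p' | P) ≽ P{p'/p}`, with `p'` fresh. -/
def LocRespectfulOut (D : Defs S) (W : Wires S) {L V : Type} (P : Proc S (Option L) V) : Prop :=
  Expands D (resL (par (W.loc none (some none)) (P.map (Option.map some) id))) P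

/-! ### The laws of wires -/

/-- The laws that wires must satisfy.  Tuples of names have pairwise distinct
components, hence the two ends of a wire are distinct names. -/
structure SatisfiesWireLaws (D : Defs S) (W : Wires S) : Prop where
  /-- The free names of a location wire are its two ends. -/
  loc_fn : ∀ {L V : Type} (a b : L), a ≠ b →
    (W.loc a b : Proc S L V).locFn = {a, b} ∧ (W.loc a b : Proc S L V).varFn = ∅
  /-- The free names of a variable wire are its two ends. -/
  var_fn : ∀ {L V : Type} (x y : V), x ≠ y →
    (W.var x y : Proc S L V).varFn = {x, y} ∧ (W.var x y : Proc S L V).locFn = ∅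
  /-- A location wire uses its first end only in input and its second end only in output. -/
  loc_use : ∀ {L V : Type} (a b : L), a ≠ b →
    ¬ UsesLoc D .out a (W.loc a b : Proc S L V) ∧ ¬ UsesLoc D .inp b (W.loc a b : Proc S L V)
  /-- A variable wire uses its first end only in input and its second end only in output. -/
  var_use : ∀ {L V : Type} (x y : V), x ≠ y →
    ¬ UsesVar D .out x (W.var x y : Proc S L V) ∧ ¬ UsesVar D .inp y (W.var x y : Proc S L V)
  /-- A location wire has no internal transition. -/
  loc_no_tau : ∀ {L V : Type} (a b : L) (P : Proc S L V), a ≠ b → ¬ TauStep D (W.loc a b) P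
  /-- A variable wire has no internal transition. -/
  var_no_tau : ∀ {L V : Type} (x y : V) (P : Proc S L V), x ≠ y → ¬ TauStep D (W.var x y) P
  /-- Transitivity of location wires: `(ν b)(loc a b | loc b c) ≽ loc a c`. -/
  loc_trans : ∀ {L V : Type} (a c : L), a ≠ c →
    Expands D (resL (par (W.loc (some a) none) (W.loc none (some c))) : Proc S L V) (W.loc a c)
  /-- Transitivity of variable wires: `(ν y)(var x y | var y z) ≽ var x z`. -/
  var_trans : ∀ {L V : Type} (x z : V), x ≠ z →
    Expands D (resV (par (W.var (some x) none) (W.var none (some z))) : Proc S L V) (W.var x z)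
  /-- `(ν q)(loc p q | q(x,r): P) ≽ p(x,r): P`, where `q` is not free in `P`. -/
  perm_inp : ∀ {L V : Type} (p : L) (P : Proc S (Option L) (Option V)),
    RespectfulIn D W P →
    Expands D
      (resL (par (W.loc (some p) none)
        (permLoc W.loc W.var .inp none (P.map (Option.map some) id))))
      (permLoc W.loc W.var .inp p P)
  /-- `(ν p)(loc p q | p̄(x,r): P) ≽ q̄(x,r): P`, where `p` is not free in `P`. -/
  perm_out : ∀ {L V : Type} (q : L) (P : Proc S (Option L) (Option V)),
    RespectfulOut D W P →
    Expands D
      (resL (par (W.loc none (some q))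
        (permLoc W.loc W.var .out none (P.map (Option.map some) id))))
      (permLoc W.loc W.var .out q P)
  /-- `(ν y)(var x y | !y(p).P) ≽ !x(p).P`, where `y` is not free in `P`. -/
  rep_inp : ∀ {L V : Type} (x : V) (P : Proc S (Option L) V),
    LocRespectfulIn D W P →
    Expands D
      (resV (par (W.var (some x) none) (varRep none (P.map id some))))
      (varRep x P)
  /-- `(ν x)(var x y | x̄(p): P) ≽ ȳ(p): P`, where `x` is not free in `P`. -/
  perm_out_var : ∀ {L V : Type} (y : V) (P : Proc S (Option L) V),
    LocRespectfulOut D W P →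
    Expands D
      (resV (par (W.var none (some y)) (permVar W.loc .out none (P.map id some))))
      (permVar W.loc .out y P)
  /-- A variable wire is a replicated input at its first end. -/
  var_rep : ∀ {L V : Type} (x y : V), x ≠ y →
    ∃ P : Proc S (Option L) V, W.var x y = varRep x P

/-! ### Chains of wires -/

/-- The chain of `n + 1` location wires from `a` to `b`, with its intermediate names restricted. -/
def locChain (W : Wires S) : ℕ → {L V : Type} → L → L → Proc S L V
  | 0, _, _, a, b => W.loc a b
  | n + 1, _, _, a, b => resL (par (locChain W n (some a) none) (W.loc none (some b)))

/-- The chain of `n + 1` variable wires from `x` to `y`, with its intermediate names restricted. -/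
def varChain (W : Wires S) : ℕ → {L V : Type} → V → V → Proc S L V
  | 0, _, _, x, y => W.var x y
  | n + 1, _, _, x, y => resV (par (varChain W n (some x) none) (W.var none (some y)))

end PiI

namespace PiI

variable {S : Sig}
open Proc
variable {D : Defs S}

namespace Proc

theorem map_map {L V L' V' L'' V'' : Type} (f : L → L') (g : V → V') (f' : L' → L'')
    (g' : V' → V'') (P : Proc S L V) : (P.map f g).map f' g' = P.map (f' ∘ f) (g' ∘ g) := by
  induction P generalizing L' V' L'' V'' <;>
    simp_all [map, Option.map_comp_map, Function.comp_assoc]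

end Proc

/-! ### Exchange of bound names, and renaming of wires and permeable prefixes. -/

theorem swap_swap {A : Type} : (swap : Option (Option A) → _) ∘ swap = id := by
  funext a
  rcases a with _ | _ | a <;> rfl

theorem swap_injective {A : Type} : Function.Injective (swap : Option (Option A) → _) :=
  Function.LeftInverse.injective (g := swap) (congrFun swap_swap)

theorem swap_comp_map {A B : Type} (f : A → B) :
    swap ∘ Option.map (Option.map f) = Option.map (Option.map f) ∘ swap := by
  funext a
  rcases a with _ | _ | a <;> rfl

theorem swap_comp_some_some {A : Type} : (swap : Option (Option A) →
    _) ∘ some ∘ some = some ∘ some := rfl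

theorem swap_comp_map_some {A : Type} :
    (swap : Option (Option A) → _) ∘ Option.map some = some := by
  funext a
  rcases a with _ | a <;> rfl

theorem swap_comp_some {A : Type} :
    (swap : Option (Option A) → _) ∘ some = Option.map some := by
  funext a
  rcases a with _ | a <;> rfl

theorem map_comp_some {A B : Type} (f : A → B) : Option.map f ∘ some = some ∘ f := rfl

theorem map_varWire (k : WireKind) {L V L' V' : Type} (f : L → L') (g : V → V') (x y : V) :
    (varWire k x y : Proc S L V).map f g = varWire k (g x) (g y) := by
  simp [varWire, permVar, map]

theorem map_permVar (k : WireKind) {L V L' V' : Type} (f : L → L') (g : V → V') (d : Pol) (x : V)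
    (P : Proc S (Option L) V) :
    (permVar (fun a b => wire k a b) d x P).map f g =
      permVar (fun a b => wire k a b) d (g x) (P.map (Option.map f) g) := by
  cases d <;> simp [permVar, map]

theorem map_permLoc (k : WireKind) {L V L' V' : Type} (f : L → L') (g : V → V') (d : Pol) (p : L)
    (P : Proc S (Option L) (Option V)) :
    (permLoc (fun a b => wire k a b) (fun a b => varWire k a b) d p P).map f g =
      permLoc (fun a b => wire k a b) (fun a b => varWire k a b) d (f p)
        (P.map (Option.map f) (Option.map g)) := by
  cases d <;> simp [permLoc, map, map_varWire]

theorem map_wireBody (k : WireKind) {L V L' V' : Type} (f : L → L') (g : V → V') (p q : L) :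
    (wireBody k p q : Proc S L V).map f g = wireBody k (f p) (f q) := by
  cases k <;> simp [wireBody, map, map_permLoc, map_varWire]

/-! ### Inversion of transitions -/

section Inversion
variable {L V : Type}

theorem LocStep.nil_inv {d p} {R} (h : LocStep D d p (nil : Proc S L V) R) : False := by cases h

theorem LocStep.pre_inv {d e p q} {P R} (h : LocStep D d p (locPre e q P : Proc S L V) R) :
    d = e ∧ p = q ∧ R = P := by cases h; exact ⟨rfl, rfl, rfl⟩

theorem LocStep.varPre_inv {d e p x} {P R} (h : LocStep D d p (varPre e x P : Proc S L V) R) :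
    False := by cases h

theorem LocStep.varRep_inv {d p x} {P R} (h : LocStep D d p (varRep x P : Proc S L V) R) :
    False := by cases h

theorem LocStep.par_inv {d p} {P Q : Proc S L V} {R} (h : LocStep D d p (par P Q) R) :
    (∃ P', LocStep D d p P P' ∧ R = par P' (Q.map some some)) ∨
    (∃ Q', LocStep D d p Q Q' ∧ R = par (P.map some some) Q') := by
  cases h with
  | parL h => exact .inl ⟨_, h, rfl⟩
  | parR h => exact .inr ⟨_, h, rfl⟩

theorem LocStep.resL_inv {d p} {P : Proc S (Option L) V} {R} (h : LocStep D d p (Proc.resL P) R) :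
    ∃ P', LocStep D d (some p) P P' ∧ R = Proc.resL (P'.map swap id) := by
  cases h with
  | resL h => exact ⟨_, h, rfl⟩

theorem LocStep.resV_inv {d p} {P : Proc S L (Option V)} {R} (h : LocStep D d p (Proc.resV P) R) :
    ∃ P', LocStep D d p P P' ∧ R = Proc.resV (P'.map id swap) := by
  cases h with
  | resV h => exact ⟨_, h, rfl⟩

theorem LocStep.wire_inv {d p k} {a b : L} {R} (h : LocStep D d p (Proc.wire k a b : Proc S L V)
    R) :
    LocStep D d p (wireBody k a b) R := by
  cases h with
  | wire h => exact h

theorem VarStep.nil_inv {d x} {R} (h : VarStep D d x (nil : Proc S L V) R) : False := by cases h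

theorem VarStep.pre_inv {d e x y} {P R} (h : VarStep D d x (varPre e y P : Proc S L V) R) :
    d = e ∧ x = y ∧ R = P := by cases h; exact ⟨rfl, rfl, rfl⟩

theorem VarStep.locPre_inv {d e p x} {P R} (h : VarStep D d x (locPre e p P : Proc S L V) R) :
    False := by cases h

theorem VarStep.rep_inv {d x y} {P R} (h : VarStep D d x (varRep y P : Proc S L V) R) :
    d = .inp ∧ x = y ∧ R = par P ((varRep y P).map some id) := by cases h; exact ⟨rfl, rfl, rfl⟩

theorem VarStep.par_inv {d x} {P Q : Proc S L V} {R} (h : VarStep D d x (par P Q) R) :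
    (∃ P', VarStep D d x P P' ∧ R = par P' (Q.map some id)) ∨
    (∃ Q', VarStep D d x Q Q' ∧ R = par (P.map some id) Q') := by
  cases h with
  | parL h => exact .inl ⟨_, h, rfl⟩
  | parR h => exact .inr ⟨_, h, rfl⟩

theorem VarStep.resL_inv {d x} {P : Proc S (Option L) V} {R} (h : VarStep D d x (Proc.resL P) R) :
    ∃ P', VarStep D d x P P' ∧ R = Proc.resL (P'.map swap id) := by
  cases h with
  | resL h => exact ⟨_, h, rfl⟩

theorem VarStep.resV_inv {d x} {P : Proc S L (Option V)} {R} (h : VarStep D d x (Proc.resV P) R) :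
    ∃ P', VarStep D d (some x) P P' ∧ R = Proc.resV P' := by
  cases h with
  | resV h => exact ⟨_, h, rfl⟩

theorem VarStep.wire_inv {d x k} {a b : L} {R} (h : VarStep D d x (Proc.wire k a b : Proc S L V)
    R) :
    VarStep D d x (wireBody k a b) R := by
  cases h with
  | wire h => exact h

theorem TauStep.nil_inv {R} (h : TauStep D (nil : Proc S L V) R) : False := by cases h

theorem TauStep.locPre_inv {d p} {P R} (h : TauStep D (locPre d p P : Proc S L V) R) : False := by
  cases h

theorem TauStep.varPre_inv {d p} {P R} (h : TauStep D (varPre d p P : Proc S L V) R) : False := by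
  cases h

theorem TauStep.varRep_inv {p} {P R} (h : TauStep D (varRep p P : Proc S L V) R) : False := by
  cases h

theorem TauStep.par_inv {P Q R : Proc S L V} (h : TauStep D (par P Q) R) :
    (∃ P', TauStep D P P' ∧ R = par P' Q) ∨ (∃ Q', TauStep D Q Q' ∧ R = par P Q') ∨
    (∃ d p P' Q', LocStep D d p P P' ∧ LocStep D d.dual p Q Q' ∧
      R = Proc.resV (Proc.resL (par P' Q'))) ∨
    (∃ d x P' Q', VarStep D d x P P' ∧ VarStep D d.dual x Q Q' ∧ R = Proc.resL (par P' Q')) := by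
  cases h with
  | parL h => exact .inl ⟨_, h, rfl⟩
  | parR h => exact .inr (.inl ⟨_, h, rfl⟩)
  | comLoc h h' => exact .inr (.inr (.inl ⟨_, _, _, _, h, h', rfl⟩))
  | comVar h h' => exact .inr (.inr (.inr ⟨_, _, _, _, h, h', rfl⟩))

theorem TauStep.resL_inv {P : Proc S (Option L) V} {R} (h : TauStep D (Proc.resL P) R) :
    ∃ P', TauStep D P P' ∧ R = Proc.resL P' := by
  cases h with
  | resL h => exact ⟨_, h, rfl⟩

theorem TauStep.resV_inv {P : Proc S L (Option V)} {R} (h : TauStep D (Proc.resV P) R) :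
    ∃ P', TauStep D P P' ∧ R = Proc.resV P' := by
  cases h with
  | resV h => exact ⟨_, h, rfl⟩

theorem TauStep.wire_inv {k} {a b : L} {R} (h : TauStep D (Proc.wire k a b : Proc S L V) R) :
    TauStep D (wireBody k a b) R := by
  cases h with
  | wire h => exact h

end Inversion

theorem Pol.dual_dual (d : Pol) : d.dual.dual = d := by cases d <;> rfl

/-! ### Transitions and renaming -/

theorem LocStep.map {L V L' V' : Type} {d : Pol} {p : L} {P : Proc S L V} {P'}
    (h : LocStep D d p P P') (f : L → L') (g : V → V') :
    LocStep D d (f p) (P.map f g) (P'.map (Option.map f) (Option.map g)) := by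
  induction h generalizing L' V' with
  | pre => exact .pre
  | @rep _ _ p P =>
    have := LocStep.rep (D := D) (p := f p) (P := Proc.map (Option.map f) (Option.map g) P)
    simpa [Proc.map, Proc.map_map, map_comp_some, Option.map_comp_map] using this
  | @parL _ _ _ _ _ Q _ _ ih =>
    have := LocStep.parL (Q := Proc.map f g Q) (ih f g)
    simpa [Proc.map, Proc.map_map, map_comp_some] using this
  | @parR _ _ _ _ P _ _ _ ih =>
    have := LocStep.parR (P := Proc.map f g P) (ih f g)
    simpa [Proc.map, Proc.map_map, map_comp_some] using this
  | resL _ ih =>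
    have := LocStep.resL (ih (Option.map f) g)
    simpa [Proc.map, Proc.map_map, swap_comp_map] using this
  | resV _ ih =>
    have := LocStep.resV (ih f (Option.map g))
    simpa [Proc.map, Proc.map_map, swap_comp_map] using this
  | wire _ ih =>
    refine LocStep.wire ?_
    simpa [map_wireBody] using ih f g
  | call _ ih =>
    refine LocStep.call ?_
    simpa [Proc.map_map] using ih f g

theorem VarStep.map {L V L' V' : Type} {d : Pol} {p : V} {P : Proc S L V} {P'}
    (h : VarStep D d p P P') (f : L → L') (g : V → V') :
    VarStep D d (g p) (P.map f g) (P'.map (Option.map f) g) := by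
  induction h generalizing L' V' with
  | pre => exact .pre
  | @rep _ _ x P =>
    have := VarStep.rep (D := D) (x := g x) (P := Proc.map (Option.map f) g P)
    simpa [Proc.map, Proc.map_map, map_comp_some, Option.map_comp_map] using this
  | @parL _ _ _ _ _ Q _ _ ih =>
    have := VarStep.parL (Q := Proc.map f g Q) (ih f g)
    simpa [Proc.map, Proc.map_map, map_comp_some] using this
  | @parR _ _ _ _ P _ _ _ ih =>
    have := VarStep.parR (P := Proc.map f g P) (ih f g)
    simpa [Proc.map, Proc.map_map, map_comp_some] using this
  | resL _ ih =>
    have := VarStep.resL (ih (Option.map f) g)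
    simpa [Proc.map, Proc.map_map, swap_comp_map] using this
  | resV _ ih => exact VarStep.resV (ih f (Option.map g))
  | wire _ ih =>
    refine VarStep.wire ?_
    simpa [map_wireBody] using ih f g
  | call _ ih =>
    refine VarStep.call ?_
    simpa [Proc.map_map] using ih f g

theorem TauStep.map {L V L' V' : Type} {P P' : Proc S L V}
    (h : TauStep D P P') (f : L → L') (g : V → V') :
    TauStep D (P.map f g) (P'.map f g) := by
  induction h generalizing L' V' with
  | comLoc h h' => exact .comLoc (h.map f g) (h'.map f g)
  | comVar h h' => exact .comVar (h.map f g) (h'.map f g)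
  | parL _ ih => exact .parL (ih f g)
  | parR _ ih => exact .parR (ih f g)
  | resL _ ih => exact .resL (ih (Option.map f) g)
  | resV _ ih => exact .resV (ih f (Option.map g))
  | wire _ ih =>
    refine TauStep.wire ?_
    simpa [map_wireBody] using ih f g
  | call _ ih =>
    refine TauStep.call ?_
    simpa [Proc.map_map] using ih f g

/-- The renamed process is generalised to a variable `Q` with an equation, so that the induction can
run over the derivation of its transition. -/
theorem LocStep.map_inv_aux {L' V' : Type} {d : Pol} {p' : L'} {Q : Proc S L' V'} {Q'}
    (h : LocStep D d p' Q Q') : ∀ {L V : Type} (f : L → L') (g : V → V') (P : Proc S L V),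
    P.map f g = Q → ∃ p P', f p = p' ∧ LocStep D d p P P' ∧
      Q' = P'.map (Option.map f) (Option.map g) := by
  induction h with
  | pre =>
    intro L V f g P e
    cases P <;> simp [Proc.map] at e
    obtain ⟨rfl, rfl, rfl⟩ := e
    exact ⟨_, _, rfl, .pre, rfl⟩
  | rep =>
    intro L V f g P e
    cases P <;> simp [Proc.map] at e
    obtain ⟨rfl, rfl⟩ := e
    refine ⟨_, _, rfl, .rep, ?_⟩
    simp [Proc.map, Proc.map_map, Option.map_comp_map]
  | parL _ ih =>
    intro L V f g P e
    cases P <;> simp [Proc.map] at e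
    obtain ⟨e, rfl⟩ := e
    obtain ⟨p, P', rfl, h, rfl⟩ := ih f g _ e
    refine ⟨_, _, rfl, .parL h, ?_⟩
    simp [Proc.map, Proc.map_map]
  | parR _ ih =>
    intro L V f g P e
    cases P <;> simp [Proc.map] at e
    obtain ⟨rfl, e⟩ := e
    obtain ⟨p, P', rfl, h, rfl⟩ := ih f g _ e
    refine ⟨_, _, rfl, .parR h, ?_⟩
    simp [Proc.map, Proc.map_map]
  | resL _ ih =>
    intro L V f g P e
    cases P <;> simp [Proc.map] at e
    obtain ⟨p, P', e', h, rfl⟩ := ih (Option.map f) g _ e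
    cases p with
    | none => simp at e'
    | some p =>
      refine ⟨p, _, by simpa using e', .resL h, ?_⟩
      simp [Proc.map, Proc.map_map, swap_comp_map]
  | resV _ ih =>
    intro L V f g P e
    cases P <;> simp [Proc.map] at e
    obtain ⟨p, P', e', h, rfl⟩ := ih f (Option.map g) _ e
    refine ⟨p, _, e', .resV h, ?_⟩
    simp [Proc.map, Proc.map_map, swap_comp_map]
  | wire _ ih =>
    intro L V f g P e
    cases P <;> simp [Proc.map] at e
    obtain ⟨rfl, rfl, rfl⟩ := e
    obtain ⟨p, P', e', h, rfl⟩ := ih f g _ (map_wireBody _ f g _ _)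
    exact ⟨p, _, e', .wire h, rfl⟩
  | call _ ih =>
    intro L V f g P e
    cases P <;> simp [Proc.map] at e
    obtain ⟨rfl, e⟩ := e
    simp at e
    obtain ⟨rfl, rfl⟩ := e
    obtain ⟨p, P', e', h, rfl⟩ := ih f g _ (Proc.map_map _ _ f g _)
    exact ⟨p, _, e', .call h, rfl⟩

theorem LocStep.map_inv {L V L' V' : Type} {d : Pol} {p' : L'} {f : L → L'} {g : V → V'}
    {P : Proc S L V} {Q'} (h : LocStep D d p' (P.map f g) Q') :
    ∃ p P', f p = p' ∧ LocStep D d p P P' ∧ Q' = P'.map (Option.map f) (Option.map g) :=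
  h.map_inv_aux f g P rfl

theorem VarStep.map_inv_aux {L' V' : Type} {d : Pol} {p' : V'} {Q : Proc S L' V'} {Q'}
    (h : VarStep D d p' Q Q') : ∀ {L V : Type} (f : L → L') (g : V → V') (P : Proc S L V),
    P.map f g = Q → ∃ p P', g p = p' ∧ VarStep D d p P P' ∧ Q' = P'.map (Option.map f) g := by
  induction h with
  | pre =>
    intro L V f g P e
    cases P <;> simp [Proc.map] at e
    obtain ⟨rfl, rfl, rfl⟩ := e
    exact ⟨_, _, rfl, .pre, rfl⟩
  | rep =>
    intro L V f g P e
    cases P <;> simp [Proc.map] at e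
    obtain ⟨rfl, rfl⟩ := e
    refine ⟨_, _, rfl, .rep, ?_⟩
    simp [Proc.map, Proc.map_map, Option.map_comp_map]
  | parL _ ih =>
    intro L V f g P e
    cases P <;> simp [Proc.map] at e
    obtain ⟨e, rfl⟩ := e
    obtain ⟨p, P', rfl, h, rfl⟩ := ih f g _ e
    refine ⟨_, _, rfl, .parL h, ?_⟩
    simp [Proc.map, Proc.map_map]
  | parR _ ih =>
    intro L V f g P e
    cases P <;> simp [Proc.map] at e
    obtain ⟨rfl, e⟩ := e
    obtain ⟨p, P', rfl, h, rfl⟩ := ih f g _ e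
    refine ⟨_, _, rfl, .parR h, ?_⟩
    simp [Proc.map, Proc.map_map]
  | resV _ ih =>
    intro L V f g P e
    cases P <;> simp [Proc.map] at e
    obtain ⟨p, P', e', h, rfl⟩ := ih f (Option.map g) _ e
    cases p with
    | none => simp at e'
    | some p =>
      exact ⟨p, _, by simpa using e', .resV h, rfl⟩
  | resL _ ih =>
    intro L V f g P e
    cases P <;> simp [Proc.map] at e
    obtain ⟨p, P', e', h, rfl⟩ := ih (Option.map f) g _ e
    refine ⟨p, _, e', .resL h, ?_⟩
    simp [Proc.map, Proc.map_map, swap_comp_map]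
  | wire _ ih =>
    intro L V f g P e
    cases P <;> simp [Proc.map] at e
    obtain ⟨rfl, rfl, rfl⟩ := e
    obtain ⟨p, P', e', h, rfl⟩ := ih f g _ (map_wireBody _ f g _ _)
    exact ⟨p, _, e', .wire h, rfl⟩
  | call _ ih =>
    intro L V f g P e
    cases P <;> simp [Proc.map] at e
    obtain ⟨rfl, e⟩ := e
    simp at e
    obtain ⟨rfl, rfl⟩ := e
    obtain ⟨p, P', e', h, rfl⟩ := ih f g _ (Proc.map_map _ _ f g _)
    exact ⟨p, _, e', .call h, rfl⟩

theorem VarStep.map_inv {L V L' V' : Type} {d : Pol} {p' : V'} {f : L → L'} {g : V → V'}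
    {P : Proc S L V} {Q'} (h : VarStep D d p' (P.map f g) Q') :
    ∃ p P', g p = p' ∧ VarStep D d p P P' ∧ Q' = P'.map (Option.map f) g :=
  h.map_inv_aux f g P rfl

theorem TauStep.map_inv_aux {L' V' : Type} {Q Q' : Proc S L' V'}
    (h : TauStep D Q Q') : ∀ {L V : Type} (f : L → L') (g : V → V') (P : Proc S L V),
    Function.Injective f → Function.Injective g →
    P.map f g = Q → ∃ P', TauStep D P P' ∧ Q' = P'.map f g := by
  induction h with
  | comLoc h h' =>
    intro L V f g P hf hg e
    cases P <;> simp [Proc.map] at e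
    obtain ⟨rfl, rfl⟩ := e
    obtain ⟨p, P', rfl, h₁, rfl⟩ := h.map_inv
    obtain ⟨q, Q', e, h₂, rfl⟩ := h'.map_inv
    obtain rfl := hf e
    exact ⟨.resV (.resL (.par P' Q')), .comLoc h₁ h₂, rfl⟩
  | comVar h h' =>
    intro L V f g P hf hg e
    cases P <;> simp [Proc.map] at e
    obtain ⟨rfl, rfl⟩ := e
    obtain ⟨p, P', rfl, h₁, rfl⟩ := h.map_inv
    obtain ⟨q, Q', e, h₂, rfl⟩ := h'.map_inv
    obtain rfl := hg e
    exact ⟨.resL (.par P' Q'), .comVar h₁ h₂, rfl⟩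
  | parL _ ih =>
    intro L V f g P hf hg e
    cases P <;> simp [Proc.map] at e
    obtain ⟨e, rfl⟩ := e
    obtain ⟨P', h, rfl⟩ := ih f g _ hf hg e
    exact ⟨_, .parL h, rfl⟩
  | parR _ ih =>
    intro L V f g P hf hg e
    cases P <;> simp [Proc.map] at e
    obtain ⟨rfl, e⟩ := e
    obtain ⟨P', h, rfl⟩ := ih f g _ hf hg e
    exact ⟨_, .parR h, rfl⟩
  | resL _ ih =>
    intro L V f g P hf hg e
    cases P <;> simp [Proc.map] at e
    obtain ⟨P', h, rfl⟩ := ih (Option.map f) g _ (Option.map_injective hf) hg e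
    exact ⟨_, .resL h, rfl⟩
  | resV _ ih =>
    intro L V f g P hf hg e
    cases P <;> simp [Proc.map] at e
    obtain ⟨P', h, rfl⟩ := ih f (Option.map g) _ hf (Option.map_injective hg) e
    exact ⟨_, .resV h, rfl⟩
  | wire _ ih =>
    intro L V f g P hf hg e
    cases P <;> simp [Proc.map] at e
    obtain ⟨rfl, rfl, rfl⟩ := e
    obtain ⟨P', h, rfl⟩ := ih f g _ hf hg (map_wireBody _ f g _ _)
    exact ⟨_, .wire h, rfl⟩
  | call _ ih =>
    intro L V f g P hf hg e
    cases P <;> simp [Proc.map] at e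
    obtain ⟨rfl, e⟩ := e
    simp at e
    obtain ⟨rfl, rfl⟩ := e
    obtain ⟨P', h, rfl⟩ := ih f g _ hf hg (Proc.map_map _ _ f g _)
    exact ⟨_, .call h, rfl⟩

/-- Injectivity is what excludes new communications: identifying two names may let two prefixes
meet. A visible transition involves a single prefix and is therefore reflected by every renaming. -/
theorem TauStep.map_inv {L V L' V' : Type} {f : L → L'} {g : V → V'}
    (hf : Function.Injective f) (hg : Function.Injective g)
    {P : Proc S L V} {Q'} (h : TauStep D (P.map f g) Q') :
    ∃ P', TauStep D P P' ∧ Q' = P'.map f g :=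
  h.map_inv_aux f g P hf hg rfl

/-! ### Weak transitions -/

/-- A weak transition with an action at a location name. -/
def WeakLoc (D : Defs S) {L V : Type} (d : Pol) (p : L) (Q : Proc S L V)
    (Q' : Proc S (Option L) (Option V)) : Prop :=
  ∃ Q₁ Q₂, TauSteps D Q Q₁ ∧ LocStep D d p Q₁ Q₂ ∧ TauSteps D Q₂ Q'

/-- A weak transition with an action at a variable name. -/
def WeakVar (D : Defs S) {L V : Type} (d : Pol) (x : V) (Q : Proc S L V)
    (Q' : Proc S (Option L) V) : Prop :=
  ∃ Q₁ Q₂, TauSteps D Q Q₁ ∧ VarStep D d x Q₁ Q₂ ∧ TauSteps D Q₂ Q'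

/-- A weak internal transition, with at least one step. -/
def WeakTau (D : Defs S) {L V : Type} (Q Q' : Proc S L V) : Prop :=
  Relation.TransGen (TauStep D) Q Q'

section Weak
variable {L V : Type}

theorem LocStep.weak {d p} {P : Proc S L V} {P'} (h : LocStep D d p P P') : WeakLoc D d p P P' :=
  ⟨_, _, .refl, h, .refl⟩

theorem VarStep.weak {d x} {P : Proc S L V} {P'} (h : VarStep D d x P P') : WeakVar D d x P P' :=
  ⟨_, _, .refl, h, .refl⟩

theorem TauStep.weak {P P' : Proc S L V} (h : TauStep D P P') : WeakTau D P P' := .single h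

theorem TauSteps.parL {P P' : Proc S L V} (h : TauSteps D P P') (Q) :
    TauSteps D (par P Q) (par P' Q) := h.lift (par · Q) fun _ _ h => .parL h

theorem TauSteps.parR {Q Q' : Proc S L V} (h : TauSteps D Q Q') (P) :
    TauSteps D (par P Q) (par P Q') := h.lift (par P ·) fun _ _ h => .parR h

theorem TauSteps.resL {P P' : Proc S (Option L) V} (h : TauSteps D P P') :
    TauSteps D (Proc.resL P) (Proc.resL P') := h.lift Proc.resL fun _ _ h => .resL h

theorem TauSteps.resV {P P' : Proc S L (Option V)} (h : TauSteps D P P') :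
    TauSteps D (Proc.resV P) (Proc.resV P') := h.lift Proc.resV fun _ _ h => .resV h

theorem TauSteps.map {L' V' : Type} {P P' : Proc S L V} (h : TauSteps D P P') (f : L → L')
    (g : V → V') : TauSteps D (P.map f g) (P'.map f g) :=
  h.lift (Proc.map f g) fun _ _ h => h.map f g

theorem WeakTau.parL {P P' : Proc S L V} (h : WeakTau D P P') (Q) :
    WeakTau D (par P Q) (par P' Q) := h.lift (par · Q) fun _ _ h => .parL h

theorem WeakTau.parR {Q Q' : Proc S L V} (h : WeakTau D Q Q') (P) :
    WeakTau D (par P Q) (par P Q') := h.lift (par P ·) fun _ _ h => .parR h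

theorem WeakTau.resL {P P' : Proc S (Option L) V} (h : WeakTau D P P') :
    WeakTau D (Proc.resL P) (Proc.resL P') := h.lift Proc.resL fun _ _ h => .resL h

theorem WeakTau.resV {P P' : Proc S L (Option V)} (h : WeakTau D P P') :
    WeakTau D (Proc.resV P) (Proc.resV P') := h.lift Proc.resV fun _ _ h => .resV h

theorem WeakTau.map {L' V' : Type} {P P' : Proc S L V} (h : WeakTau D P P') (f : L → L')
    (g : V → V') : WeakTau D (P.map f g) (P'.map f g) :=
  h.lift (Proc.map f g) fun _ _ h => h.map f g

theorem WeakLoc.parL {d p} {P : Proc S L V} {P'} (h : WeakLoc D d p P P') (Q) :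
    WeakLoc D d p (par P Q) (par P' (Q.map some some)) := by
  obtain ⟨_, _, h₁, h₂, h₃⟩ := h
  exact ⟨_, _, h₁.parL _, .parL h₂, h₃.parL _⟩

theorem WeakLoc.parR {d p} {Q : Proc S L V} {Q'} (h : WeakLoc D d p Q Q') (P) :
    WeakLoc D d p (par P Q) (par (P.map some some) Q') := by
  obtain ⟨_, _, h₁, h₂, h₃⟩ := h
  exact ⟨_, _, h₁.parR _, .parR h₂, h₃.parR _⟩

theorem WeakLoc.resL {d p} {P : Proc S (Option L) V} {P'} (h : WeakLoc D d (some p) P P') :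
    WeakLoc D d p (Proc.resL P) (Proc.resL (P'.map swap id)) := by
  obtain ⟨_, _, h₁, h₂, h₃⟩ := h
  exact ⟨_, _, h₁.resL, .resL h₂, (h₃.map _ _).resL⟩

theorem WeakLoc.resV {d p} {P : Proc S L (Option V)} {P'} (h : WeakLoc D d p P P') :
    WeakLoc D d p (Proc.resV P) (Proc.resV (P'.map id swap)) := by
  obtain ⟨_, _, h₁, h₂, h₃⟩ := h
  exact ⟨_, _, h₁.resV, .resV h₂, (h₃.map _ _).resV⟩

theorem WeakLoc.map {L' V' : Type} {d p} {P : Proc S L V} {P'} (h : WeakLoc D d p P P')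
    (f : L → L') (g : V → V') :
    WeakLoc D d (f p) (P.map f g) (P'.map (Option.map f) (Option.map g)) := by
  obtain ⟨_, _, h₁, h₂, h₃⟩ := h
  exact ⟨_, _, h₁.map _ _, h₂.map _ _, h₃.map _ _⟩

theorem WeakVar.parL {d x} {P : Proc S L V} {P'} (h : WeakVar D d x P P') (Q) :
    WeakVar D d x (par P Q) (par P' (Q.map some id)) := by
  obtain ⟨_, _, h₁, h₂, h₃⟩ := h
  exact ⟨_, _, h₁.parL _, .parL h₂, h₃.parL _⟩

theorem WeakVar.parR {d x} {Q : Proc S L V} {Q'} (h : WeakVar D d x Q Q') (P) :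
    WeakVar D d x (par P Q) (par (P.map some id) Q') := by
  obtain ⟨_, _, h₁, h₂, h₃⟩ := h
  exact ⟨_, _, h₁.parR _, .parR h₂, h₃.parR _⟩

theorem WeakVar.resL {d x} {P : Proc S (Option L) V} {P'} (h : WeakVar D d x P P') :
    WeakVar D d x (Proc.resL P) (Proc.resL (P'.map swap id)) := by
  obtain ⟨_, _, h₁, h₂, h₃⟩ := h
  exact ⟨_, _, h₁.resL, .resL h₂, (h₃.map _ _).resL⟩

theorem WeakVar.resV {d x} {P : Proc S L (Option V)} {P'} (h : WeakVar D d (some x) P P') :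
    WeakVar D d x (Proc.resV P) (Proc.resV P') := by
  obtain ⟨_, _, h₁, h₂, h₃⟩ := h
  exact ⟨_, _, h₁.resV, .resV h₂, h₃.resV⟩

theorem WeakVar.map {L' V' : Type} {d x} {P : Proc S L V} {P'} (h : WeakVar D d x P P')
    (f : L → L') (g : V → V') :
    WeakVar D d (g x) (P.map f g) (P'.map (Option.map f) g) := by
  obtain ⟨_, _, h₁, h₂, h₃⟩ := h
  exact ⟨_, _, h₁.map _ _, h₂.map _ _, h₃.map _ _⟩

/-- The internal steps before the two actions are performed side by side, then the actions
synchronise, and the remaining internal steps take place below the new restrictions. -/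
theorem WeakLoc.com {d p} {P Q : Proc S L V} {P' Q'} (h : WeakLoc D d p P P')
    (h' : WeakLoc D d.dual p Q Q') : WeakTau D (par P Q) (Proc.resV (Proc.resL (par P' Q'))) := by
  obtain ⟨P₁, P₂, h₁, h₂, h₃⟩ := h
  obtain ⟨Q₁, Q₂, h₄, h₅, h₆⟩ := h'
  have a := (h₁.parL Q).trans (h₄.parR P₁)
  have b := (TauSteps.resL ((h₃.parL Q₂).trans (h₆.parR P'))).resV
  exact (Relation.TransGen.tail' a (.comLoc h₂ h₅)).trans_left b

theorem WeakVar.com {d x} {P Q : Proc S L V} {P' Q'} (h : WeakVar D d x P P')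
    (h' : WeakVar D d.dual x Q Q') : WeakTau D (par P Q) (Proc.resL (par P' Q')) := by
  obtain ⟨P₁, P₂, h₁, h₂, h₃⟩ := h
  obtain ⟨Q₁, Q₂, h₄, h₅, h₆⟩ := h'
  have a := (h₁.parL Q).trans (h₄.parR P₁)
  have b := TauSteps.resL ((h₃.parL Q₂).trans (h₆.parR P'))
  exact (Relation.TransGen.tail' a (.comVar h₂ h₅)).trans_left b

end Weak

/-! ### Strong bisimilarity -/

/-- Relations between processes in the same context. -/
abbrev Rel (S : Sig) : Type 1 := ∀ L V : Type, Proc S L V → Proc S L V → Prop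

/-- Each transition of `P` is matched by `Q` with a single transition, up to `T`. -/
structure Simulates (D : Defs S) (T : Rel S) {L V : Type} (P Q : Proc S L V) : Prop where
  tau : ∀ P', TauStep D P P' → ∃ Q', TauStep D Q Q' ∧ T _ _ P' Q'
  loc : ∀ d p P', LocStep D d p P P' → ∃ Q', LocStep D d p Q Q' ∧ T _ _ P' Q'
  var : ∀ d x P', VarStep D d x P P' → ∃ Q', VarStep D d x Q Q' ∧ T _ _ P' Q'

theorem Simulates.mono {T T' : Rel S} {L V : Type} {P Q : Proc S L V} (h : Simulates D T P Q)
    (hT : ∀ L V P Q, T L V P Q → T' L V P Q) : Simulates D T' P Q where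
  tau _ s := let ⟨Q', a, b⟩ := h.tau _ s; ⟨Q', a, hT _ _ _ _ b⟩
  loc _ _ _ s := let ⟨Q', a, b⟩ := h.loc _ _ _ s; ⟨Q', a, hT _ _ _ _ b⟩
  var _ _ _ s := let ⟨Q', a, b⟩ := h.var _ _ _ s; ⟨Q', a, hT _ _ _ _ b⟩

/-- Strong bisimilarity. -/
def Bisim (D : Defs S) {L V : Type} (P Q : Proc S L V) : Prop :=
  ∃ R : Rel S, (∀ L V P Q, R L V P Q → Simulates D R P Q) ∧
    (∀ L V P Q, R L V P Q → R L V Q P) ∧ R L V P Q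

theorem Bisim.sim {L V : Type} {P Q : Proc S L V} (h : Bisim D P Q) :
    Simulates D (fun _ _ => Bisim D) P Q := by
  obtain ⟨R, h₁, h₂, h⟩ := h
  exact (h₁ _ _ _ _ h).mono fun _ _ _ _ h => ⟨R, h₁, h₂, h⟩

theorem Bisim.symm {L V : Type} {P Q : Proc S L V} (h : Bisim D P Q) : Bisim D Q P := by
  obtain ⟨R, h₁, h₂, h⟩ := h
  exact ⟨R, h₁, h₂, h₂ _ _ _ _ h⟩

/-- A process and its derivatives are bisimilar if they have the same transitions. -/
theorem bisim_of_steps {L V : Type} {P Q : Proc S L V}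
    (tau : ∀ R, TauStep D P R ↔ TauStep D Q R)
    (loc : ∀ d p R, LocStep D d p P R ↔ LocStep D d p Q R)
    (var : ∀ d p R, VarStep D d p P R ↔ VarStep D d p Q R) : Bisim D P Q := by
  refine ⟨fun _ _ A B => A = B ∨
    ((∀ R, TauStep D A R ↔ TauStep D B R) ∧ (∀ d p R, LocStep D d p A R ↔ LocStep D d p B R) ∧
      (∀ d p R, VarStep D d p A R ↔ VarStep D d p B R)), ?_, ?_, .inr ⟨tau, loc, var⟩⟩
  · rintro L V A B (rfl | ⟨h₁, h₂, h₃⟩)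
    · exact ⟨fun _ h => ⟨_, h, .inl rfl⟩, fun _ _ _ h => ⟨_, h, .inl rfl⟩,
        fun _ _ _ h => ⟨_, h, .inl rfl⟩⟩
    · exact ⟨fun _ h => ⟨_, (h₁ _).1 h, .inl rfl⟩, fun _ _ _ h => ⟨_, (h₂ _ _ _).1 h, .inl rfl⟩,
        fun _ _ _ h => ⟨_, (h₃ _ _ _).1 h, .inl rfl⟩⟩
  · rintro L V A B (rfl | ⟨h₁, h₂, h₃⟩)
    · exact .inl rfl
    · exact .inr ⟨fun _ => (h₁ _).symm, fun _ _ _ => (h₂ _ _ _).symm,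
        fun _ _ _ => (h₃ _ _ _).symm⟩

/-! ### Expansions, and expansions up to expansion and context -/

/-- The clauses of expansion for the pair `(P, Q)`, with derivatives in `T`. -/
structure Progress (D : Defs S) (T : Rel S) {L V : Type} (P Q : Proc S L V) : Prop where
  tau_left : ∀ P', TauStep D P P' → ∃ Q', WeakTau D Q Q' ∧ T _ _ P' Q'
  loc_left : ∀ d p P', LocStep D d p P P' → ∃ Q', WeakLoc D d p Q Q' ∧ T _ _ P' Q'
  var_left : ∀ d x P', VarStep D d x P P' → ∃ Q', WeakVar D d x Q Q' ∧ T _ _ P' Q'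
  tau_right : ∀ Q', TauStep D Q Q' → T _ _ P Q' ∨ ∃ P', TauStep D P P' ∧ T _ _ P' Q'
  loc_right : ∀ d p Q', LocStep D d p Q Q' → ∃ P', LocStep D d p P P' ∧ T _ _ P' Q'
  var_right : ∀ d x Q', VarStep D d x Q Q' → ∃ P', VarStep D d x P P' ∧ T _ _ P' Q'

theorem Progress.mono {T T' : Rel S} {L V : Type} {P Q : Proc S L V} (h : Progress D T P Q)
    (hT : ∀ L V P Q, T L V P Q → T' L V P Q) : Progress D T' P Q where
  tau_left _ s := let ⟨Q', a, b⟩ := h.tau_left _ s; ⟨Q', a, hT _ _ _ _ b⟩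
  loc_left _ _ _ s := let ⟨Q', a, b⟩ := h.loc_left _ _ _ s; ⟨Q', a, hT _ _ _ _ b⟩
  var_left _ _ _ s := let ⟨Q', a, b⟩ := h.var_left _ _ _ s; ⟨Q', a, hT _ _ _ _ b⟩
  tau_right _ s := (h.tau_right _ s).imp (hT _ _ _ _) fun ⟨P', a, b⟩ => ⟨P', a, hT _ _ _ _ b⟩
  loc_right _ _ _ s := let ⟨Q', a, b⟩ := h.loc_right _ _ _ s; ⟨Q', a, hT _ _ _ _ b⟩
  var_right _ _ _ s := let ⟨Q', a, b⟩ := h.var_right _ _ _ s; ⟨Q', a, hT _ _ _ _ b⟩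

theorem expands_of_progress (R : Rel S) (hR : ∀ L V P Q, R L V P Q → Progress D R P Q)
    {L V : Type} {P Q : Proc S L V} (h : R L V P Q) : Expands D Q P := by
  refine ⟨fun {L V} => R L V, ⟨?_, ?_, ?_, ?_, ?_, ?_⟩, h⟩
  · exact fun h s => (hR _ _ _ _ h).tau_left _ s
  · intro L V P Q d p P' h s
    obtain ⟨Q', ⟨Q₁, Q₂, a, b, c⟩, e⟩ := (hR _ _ _ _ h).loc_left _ _ _ s
    exact ⟨Q₁, Q₂, Q', a, b, c, e⟩
  · intro L V P Q d p P' h s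
    obtain ⟨Q', ⟨Q₁, Q₂, a, b, c⟩, e⟩ := (hR _ _ _ _ h).var_left _ _ _ s
    exact ⟨Q₁, Q₂, Q', a, b, c, e⟩
  · exact fun h s => (hR _ _ _ _ h).tau_right _ s
  · exact fun h s => (hR _ _ _ _ h).loc_right _ _ _ s
  · exact fun h s => (hR _ _ _ _ h).var_right _ _ _ s

theorem Expands.progress {L V : Type} {P Q : Proc S L V} (h : Expands D Q P) :
    Progress D (fun _ _ P Q => Expands D Q P) P Q := by
  obtain ⟨R, hR, h⟩ := h
  refine Progress.mono (T := fun L V => @R L V) ⟨?_, ?_, ?_, ?_, ?_, ?_⟩ fun _ _ _ _ h => ⟨R, hR, h⟩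
  · exact fun _ s => hR.tau_left h s
  · intro _ _ _ s
    obtain ⟨Q₁, Q₂, Q', a, b, c, e⟩ := hR.loc_left h s
    exact ⟨Q', ⟨Q₁, Q₂, a, b, c⟩, e⟩
  · intro _ _ _ s
    obtain ⟨Q₁, Q₂, Q', a, b, c, e⟩ := hR.var_left h s
    exact ⟨Q', ⟨Q₁, Q₂, a, b, c⟩, e⟩
  · exact fun _ s => hR.tau_right h s
  · exact fun _ _ _ s => hR.loc_right h s
  · exact fun _ _ _ s => hR.var_right h s

theorem Bisim.expands {L V : Type} {P Q : Proc S L V} (h : Bisim D Q P) : Expands D Q P := by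
  refine expands_of_progress (fun _ _ => Bisim D) (fun L V P Q h => ?_) h.symm
  refine ⟨?_, ?_, ?_, ?_, ?_, ?_⟩
  · exact fun _ s => let ⟨Q', a, b⟩ := h.sim.tau _ s; ⟨Q', a.weak, b⟩
  · exact fun _ _ _ s => let ⟨Q', a, b⟩ := h.sim.loc _ _ _ s; ⟨Q', a.weak, b⟩
  · exact fun _ _ _ s => let ⟨Q', a, b⟩ := h.sim.var _ _ _ s; ⟨Q', a.weak, b⟩
  · exact fun _ s => let ⟨Q', a, b⟩ := h.symm.sim.tau _ s; .inr ⟨Q', a, b.symm⟩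
  · exact fun _ _ _ s => let ⟨Q', a, b⟩ := h.symm.sim.loc _ _ _ s; ⟨Q', a, b.symm⟩
  · exact fun _ _ _ s => let ⟨Q', a, b⟩ := h.symm.sim.var _ _ _ s; ⟨Q', a, b.symm⟩

/-- The closure of a relation under static contexts, injective renaming, expansion on the right and
strong bisimilarity on the left. -/
inductive UpTo (D : Defs S) (R : Rel S) : ∀ {L V : Type}, Proc S L V → Proc S L V → Prop where
  | base {L V : Type} {P Q : Proc S L V} : R L V P Q → UpTo D R P Q
  | refl {L V : Type} (P : Proc S L V) : UpTo D R P P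
  | par {L V : Type} {P P' Q Q' : Proc S L V} : UpTo D R P Q → UpTo D R P' Q' →
      UpTo D R (par P P') (par Q Q')
  | resL {L V : Type} {P Q : Proc S (Option L) V} : UpTo D R P Q → UpTo D R (resL P) (resL Q)
  | resV {L V : Type} {P Q : Proc S L (Option V)} : UpTo D R P Q → UpTo D R (resV P) (resV Q)
  | map {L V L' V' : Type} {P Q : Proc S L V} {f : L → L'} {g : V → V'} :
      Function.Injective f → Function.Injective g → UpTo D R P Q →
      UpTo D R (P.map f g) (Q.map f g)
  | expands {L V : Type} {P Q Q' : Proc S L V} : UpTo D R P Q → Expands D Q' Q → UpTo D R P Q'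
  | bisim {L V : Type} {P P' Q : Proc S L V} : Bisim D P P' → UpTo D R P' Q → UpTo D R P Q

section Weak
variable {L V : Type}

/-- Weak moves can be followed step by step because the derivatives are again related by a genuine
expansion. For a relation known only to progress up to a closure, this is not available. -/
theorem Expands.tauSteps {P Q P' : Proc S L V} (h : Expands D Q P) (s : TauSteps D P P') :
    ∃ Q', TauSteps D Q Q' ∧ Expands D Q' P' := by
  induction s with
  | refl => exact ⟨Q, .refl, h⟩
  | tail _ s ih =>
    obtain ⟨Q', a, b⟩ := ih
    obtain ⟨Q'', c, e⟩ := b.progress.tau_left _ s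
    exact ⟨Q'', a.trans c.to_reflTransGen, e⟩

theorem Expands.weakTau {P Q P' : Proc S L V} (h : Expands D Q P) (s : WeakTau D P P') :
    ∃ Q', WeakTau D Q Q' ∧ Expands D Q' P' := by
  induction s with
  | single s => exact h.progress.tau_left _ s
  | tail _ s ih =>
    obtain ⟨Q', a, b⟩ := ih
    obtain ⟨Q'', c, e⟩ := b.progress.tau_left _ s
    exact ⟨Q'', a.trans c, e⟩

theorem Expands.weakLoc {d p} {P Q : Proc S L V} {P'} (h : Expands D Q P)
    (s : WeakLoc D d p P P') : ∃ Q', WeakLoc D d p Q Q' ∧ Expands D Q' P' := by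
  obtain ⟨P₁, P₂, s₁, s₂, s₃⟩ := s
  obtain ⟨Q₁, a, h⟩ := h.tauSteps s₁
  obtain ⟨Q₂, ⟨Q₃, Q₄, b, c, e⟩, h⟩ := h.progress.loc_left _ _ _ s₂
  obtain ⟨Q', a', h⟩ := h.tauSteps s₃
  exact ⟨Q', ⟨_, _, a.trans b, c, e.trans a'⟩, h⟩

theorem Expands.weakVar {d p} {P Q : Proc S L V} {P'} (h : Expands D Q P)
    (s : WeakVar D d p P P') : ∃ Q', WeakVar D d p Q Q' ∧ Expands D Q' P' := by
  obtain ⟨P₁, P₂, s₁, s₂, s₃⟩ := s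
  obtain ⟨Q₁, a, h⟩ := h.tauSteps s₁
  obtain ⟨Q₂, ⟨Q₃, Q₄, b, c, e⟩, h⟩ := h.progress.var_left _ _ _ s₂
  obtain ⟨Q', a', h⟩ := h.tauSteps s₃
  exact ⟨Q', ⟨_, _, a.trans b, c, e.trans a'⟩, h⟩

end Weak

/-- Soundness of the up-to technique: the whole closure progresses to itself. Each closure rule only
ever asks for the answer to one transition of its premises, so an induction on the closure suffices.
-/
theorem UpTo.progress {R : Rel S} (hR : ∀ L V P Q, R L V P Q → Progress D (fun _ _ => UpTo D R) P Q)
    {L V : Type} {P Q : Proc S L V} (h : UpTo D R P Q) :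
    Progress D (fun _ _ => UpTo D R) P Q := by
  -- These renamings occur in derivatives: weakening of an idle component, and exchange of binders
  -- when an action crosses a restriction.
  have is {A : Type} : Function.Injective (some : A → _) := Option.some_injective _
  have ii {A : Type} : Function.Injective (id : A → A) := Function.injective_id
  have iw {A : Type} : Function.Injective (swap : Option (Option A) → _) := swap_injective
  induction h with
  | base h => exact hR _ _ _ _ h
  | refl P =>
    exact ⟨fun _ s => ⟨_, s.weak, .refl _⟩, fun _ _ _ s => ⟨_, s.weak, .refl _⟩,
      fun _ _ _ s => ⟨_, s.weak, .refl _⟩, fun _ s => .inr ⟨_, s, .refl _⟩,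
      fun _ _ _ s => ⟨_, s, .refl _⟩, fun _ _ _ s => ⟨_, s, .refl _⟩⟩
  | @par L V P P' Q Q' h h' ih ih' =>
    refine ⟨?_, ?_, ?_, ?_, ?_, ?_⟩
    · intro _ s₀
      obtain ⟨_, s, rfl⟩ | ⟨_, s, rfl⟩ | ⟨_, _, _, _, s, s', rfl⟩ | ⟨_, _, _, _, s, s', rfl⟩ :=
        s₀.par_inv
      · obtain ⟨_, w, t⟩ := ih.tau_left _ s
        exact ⟨_, w.parL _, t.par h'⟩
      · obtain ⟨_, w, t⟩ := ih'.tau_left _ s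
        exact ⟨_, w.parR _, h.par t⟩
      · obtain ⟨_, w, t⟩ := ih.loc_left _ _ _ s
        obtain ⟨_, w', t'⟩ := ih'.loc_left _ _ _ s'
        exact ⟨_, w.com w', (t.par t').resL.resV⟩
      · obtain ⟨_, w, t⟩ := ih.var_left _ _ _ s
        obtain ⟨_, w', t'⟩ := ih'.var_left _ _ _ s'
        exact ⟨_, w.com w', (t.par t').resL⟩
    · intro _ _ _ s₀
      obtain ⟨_, s, rfl⟩ | ⟨_, s, rfl⟩ := s₀.par_inv
      · obtain ⟨_, w, t⟩ := ih.loc_left _ _ _ s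
        exact ⟨_, w.parL _, t.par (h'.map is is)⟩
      · obtain ⟨_, w, t⟩ := ih'.loc_left _ _ _ s
        exact ⟨_, w.parR _, (h.map is is).par t⟩
    · intro _ _ _ s₀
      obtain ⟨_, s, rfl⟩ | ⟨_, s, rfl⟩ := s₀.par_inv
      · obtain ⟨_, w, t⟩ := ih.var_left _ _ _ s
        exact ⟨_, w.parL _, t.par (h'.map is ii)⟩
      · obtain ⟨_, w, t⟩ := ih'.var_left _ _ _ s
        exact ⟨_, w.parR _, (h.map is ii).par t⟩
    · intro _ s₀
      obtain ⟨_, s, rfl⟩ | ⟨_, s, rfl⟩ | ⟨_, _, _, _, s, s', rfl⟩ | ⟨_, _, _, _, s, s', rfl⟩ :=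
        s₀.par_inv
      · obtain t | ⟨_, w, t⟩ := ih.tau_right _ s
        · exact .inl (t.par h')
        · exact .inr ⟨_, w.parL, t.par h'⟩
      · obtain t | ⟨_, w, t⟩ := ih'.tau_right _ s
        · exact .inl (h.par t)
        · exact .inr ⟨_, w.parR, h.par t⟩
      · obtain ⟨_, w, t⟩ := ih.loc_right _ _ _ s
        obtain ⟨_, w', t'⟩ := ih'.loc_right _ _ _ s'
        exact .inr ⟨_, .comLoc w w', (t.par t').resL.resV⟩
      · obtain ⟨_, w, t⟩ := ih.var_right _ _ _ s
        obtain ⟨_, w', t'⟩ := ih'.var_right _ _ _ s'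
        exact .inr ⟨_, .comVar w w', (t.par t').resL⟩
    · intro _ _ _ s₀
      obtain ⟨_, s, rfl⟩ | ⟨_, s, rfl⟩ := s₀.par_inv
      · obtain ⟨_, w, t⟩ := ih.loc_right _ _ _ s
        exact ⟨_, w.parL, t.par (h'.map is is)⟩
      · obtain ⟨_, w, t⟩ := ih'.loc_right _ _ _ s
        exact ⟨_, w.parR, (h.map is is).par t⟩
    · intro _ _ _ s₀
      obtain ⟨_, s, rfl⟩ | ⟨_, s, rfl⟩ := s₀.par_inv
      · obtain ⟨_, w, t⟩ := ih.var_right _ _ _ s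
        exact ⟨_, w.parL, t.par (h'.map is ii)⟩
      · obtain ⟨_, w, t⟩ := ih'.var_right _ _ _ s
        exact ⟨_, w.parR, (h.map is ii).par t⟩
  | resL h ih =>
    refine ⟨?_, ?_, ?_, ?_, ?_, ?_⟩
    · intro _ s₀
      obtain ⟨_, s, rfl⟩ := s₀.resL_inv
      obtain ⟨_, w, t⟩ := ih.tau_left _ s
      exact ⟨_, w.resL, t.resL⟩
    · intro _ _ _ s₀
      obtain ⟨_, s, rfl⟩ := s₀.resL_inv
      obtain ⟨_, w, t⟩ := ih.loc_left _ _ _ s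
      exact ⟨_, w.resL, (t.map iw ii).resL⟩
    · intro _ _ _ s₀
      obtain ⟨_, s, rfl⟩ := s₀.resL_inv
      obtain ⟨_, w, t⟩ := ih.var_left _ _ _ s
      exact ⟨_, w.resL, (t.map iw ii).resL⟩
    · intro _ s₀
      obtain ⟨_, s, rfl⟩ := s₀.resL_inv
      obtain t | ⟨_, w, t⟩ := ih.tau_right _ s
      · exact .inl t.resL
      · exact .inr ⟨_, w.resL, t.resL⟩
    · intro _ _ _ s₀
      obtain ⟨_, s, rfl⟩ := s₀.resL_inv
      obtain ⟨_, w, t⟩ := ih.loc_right _ _ _ s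
      exact ⟨_, w.resL, (t.map iw ii).resL⟩
    · intro _ _ _ s₀
      obtain ⟨_, s, rfl⟩ := s₀.resL_inv
      obtain ⟨_, w, t⟩ := ih.var_right _ _ _ s
      exact ⟨_, w.resL, (t.map iw ii).resL⟩
  | resV h ih =>
    refine ⟨?_, ?_, ?_, ?_, ?_, ?_⟩
    · intro _ s₀
      obtain ⟨_, s, rfl⟩ := s₀.resV_inv
      obtain ⟨_, w, t⟩ := ih.tau_left _ s
      exact ⟨_, w.resV, t.resV⟩
    · intro _ _ _ s₀
      obtain ⟨_, s, rfl⟩ := s₀.resV_inv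
      obtain ⟨_, w, t⟩ := ih.loc_left _ _ _ s
      exact ⟨_, w.resV, (t.map ii iw).resV⟩
    · intro _ _ _ s₀
      obtain ⟨_, s, rfl⟩ := s₀.resV_inv
      obtain ⟨_, w, t⟩ := ih.var_left _ _ _ s
      exact ⟨_, w.resV, t.resV⟩
    · intro _ s₀
      obtain ⟨_, s, rfl⟩ := s₀.resV_inv
      obtain t | ⟨_, w, t⟩ := ih.tau_right _ s
      · exact .inl t.resV
      · exact .inr ⟨_, w.resV, t.resV⟩
    · intro _ _ _ s₀
      obtain ⟨_, s, rfl⟩ := s₀.resV_inv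
      obtain ⟨_, w, t⟩ := ih.loc_right _ _ _ s
      exact ⟨_, w.resV, (t.map ii iw).resV⟩
    · intro _ _ _ s₀
      obtain ⟨_, s, rfl⟩ := s₀.resV_inv
      obtain ⟨_, w, t⟩ := ih.var_right _ _ _ s
      exact ⟨_, w.resV, t.resV⟩
  | map hf hg h ih =>
    have of := Option.map_injective hf
    have og := Option.map_injective hg
    refine ⟨?_, ?_, ?_, ?_, ?_, ?_⟩
    · intro _ s₀
      obtain ⟨_, s, rfl⟩ := s₀.map_inv hf hg
      obtain ⟨_, w, t⟩ := ih.tau_left _ s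
      exact ⟨_, w.map _ _, t.map hf hg⟩
    · intro _ _ _ s₀
      obtain ⟨_, _, rfl, s, rfl⟩ := s₀.map_inv
      obtain ⟨_, w, t⟩ := ih.loc_left _ _ _ s
      exact ⟨_, w.map _ _, t.map of og⟩
    · intro _ _ _ s₀
      obtain ⟨_, _, rfl, s, rfl⟩ := s₀.map_inv
      obtain ⟨_, w, t⟩ := ih.var_left _ _ _ s
      exact ⟨_, w.map _ _, t.map of hg⟩
    · intro _ s₀
      obtain ⟨_, s, rfl⟩ := s₀.map_inv hf hg
      obtain t | ⟨_, w, t⟩ := ih.tau_right _ s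
      · exact .inl (t.map hf hg)
      · exact .inr ⟨_, w.map _ _, t.map hf hg⟩
    · intro _ _ _ s₀
      obtain ⟨_, _, rfl, s, rfl⟩ := s₀.map_inv
      obtain ⟨_, w, t⟩ := ih.loc_right _ _ _ s
      exact ⟨_, w.map _ _, t.map of og⟩
    · intro _ _ _ s₀
      obtain ⟨_, _, rfl, s, rfl⟩ := s₀.map_inv
      obtain ⟨_, w, t⟩ := ih.var_right _ _ _ s
      exact ⟨_, w.map _ _, t.map of hg⟩
  -- The middle process answers with a possibly weak move, which is followed along `e`. This is
  -- legitimate because `e` is a genuine expansion.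
  | expands h e ih =>
    refine ⟨?_, ?_, ?_, ?_, ?_, ?_⟩
    · intro _ s
      obtain ⟨_, w, t⟩ := ih.tau_left _ s
      obtain ⟨_, w, e⟩ := e.weakTau w
      exact ⟨_, w, t.expands e⟩
    · intro _ _ _ s
      obtain ⟨_, w, t⟩ := ih.loc_left _ _ _ s
      obtain ⟨_, w, e⟩ := e.weakLoc w
      exact ⟨_, w, t.expands e⟩
    · intro _ _ _ s
      obtain ⟨_, w, t⟩ := ih.var_left _ _ _ s
      obtain ⟨_, w, e⟩ := e.weakVar w
      exact ⟨_, w, t.expands e⟩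
    · intro _ s
      obtain e | ⟨_, s, e⟩ := e.progress.tau_right _ s
      · exact .inl (h.expands e)
      · obtain t | ⟨_, w, t⟩ := ih.tau_right _ s
        · exact .inl (t.expands e)
        · exact .inr ⟨_, w, t.expands e⟩
    · intro _ _ _ s
      obtain ⟨_, s, e⟩ := e.progress.loc_right _ _ _ s
      obtain ⟨_, w, t⟩ := ih.loc_right _ _ _ s
      exact ⟨_, w, t.expands e⟩
    · intro _ _ _ s
      obtain ⟨_, s, e⟩ := e.progress.var_right _ _ _ s
      obtain ⟨_, w, t⟩ := ih.var_right _ _ _ s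
      exact ⟨_, w, t.expands e⟩
  -- Bisimilarity turns one transition into one transition, so the induction hypothesis is only
  -- applied to single steps.
  | bisim b h ih =>
    refine ⟨?_, ?_, ?_, ?_, ?_, ?_⟩
    · intro _ s
      obtain ⟨_, s, b⟩ := b.sim.tau _ s
      obtain ⟨_, w, t⟩ := ih.tau_left _ s
      exact ⟨_, w, t.bisim b⟩
    · intro _ _ _ s
      obtain ⟨_, s, b⟩ := b.sim.loc _ _ _ s
      obtain ⟨_, w, t⟩ := ih.loc_left _ _ _ s
      exact ⟨_, w, t.bisim b⟩
    · intro _ _ _ s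
      obtain ⟨_, s, b⟩ := b.sim.var _ _ _ s
      obtain ⟨_, w, t⟩ := ih.var_left _ _ _ s
      exact ⟨_, w, t.bisim b⟩
    · intro _ s
      obtain t | ⟨_, w, t⟩ := ih.tau_right _ s
      · exact .inl (t.bisim b)
      · obtain ⟨_, w, b⟩ := b.symm.sim.tau _ w
        exact .inr ⟨_, w, t.bisim b.symm⟩
    · intro _ _ _ s
      obtain ⟨_, w, t⟩ := ih.loc_right _ _ _ s
      obtain ⟨_, w, b⟩ := b.symm.sim.loc _ _ _ w
      exact ⟨_, w, t.bisim b.symm⟩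
    · intro _ _ _ s
      obtain ⟨_, w, t⟩ := ih.var_right _ _ _ s
      obtain ⟨_, w, b⟩ := b.symm.sim.var _ _ _ w
      exact ⟨_, w, t.bisim b.symm⟩

/-! ### Expansion as a precongruence. -/

theorem expands_of_upTo (R : Rel S)
    (hR : ∀ L V P Q, R L V P Q → Progress D (fun _ _ => UpTo D R) P Q)
    {L V : Type} {P Q : Proc S L V} (h : UpTo D R P Q) : Expands D Q P :=
  expands_of_progress (fun _ _ => UpTo D R) (fun _ _ _ _ h => h.progress hR) h

/-- Expansion is a precongruence for static contexts, and contains bisimilarity. -/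
theorem expands_of_upTo_empty {L V : Type} {P Q : Proc S L V}
    (h : UpTo D (fun _ _ _ _ => False) P Q) : Expands D Q P :=
  expands_of_upTo _ (fun _ _ _ _ h => h.elim) h

namespace Expands
variable {L V : Type}

theorem refl (P : Proc S L V) : Expands D P P := expands_of_upTo_empty (.refl P)

theorem trans {P Q R : Proc S L V} (h : Expands D P Q) (h' : Expands D Q R) : Expands D P R :=
  expands_of_upTo_empty (((UpTo.refl R).expands h').expands h)

theorem par {P P' Q Q' : Proc S L V} (h : Expands D P Q) (h' : Expands D P' Q') :
    Expands D (par P P') (par Q Q') :=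
  expands_of_upTo_empty (((UpTo.refl _).expands h).par ((UpTo.refl _).expands h'))

theorem resL {P Q : Proc S (Option L) V} (h : Expands D P Q) : Expands D (resL P) (resL Q) :=
  expands_of_upTo_empty ((UpTo.refl _).expands h).resL

theorem resV {P Q : Proc S L (Option V)} (h : Expands D P Q) : Expands D (resV P) (resV Q) :=
  expands_of_upTo_empty ((UpTo.refl _).expands h).resV

theorem map {L' V' : Type} {P Q : Proc S L V} (h : Expands D P Q) {f : L → L'} {g : V → V'}
    (hf : Function.Injective f) (hg : Function.Injective g) :
    Expands D (P.map f g) (Q.map f g) :=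
  expands_of_upTo_empty (((UpTo.refl _).expands h).map hf hg)

theorem locPre {P Q : Proc S (Option L) (Option V)} (h : Expands D P Q) (d : Pol) (p : L) :
    Expands D (locPre d p P) (locPre d p Q) := by
  refine expands_of_upTo (fun L V A B => ∃ d p P Q, Expands D P Q ∧ A = .locPre d p Q ∧
    B = .locPre d p P) ?_ (.base ⟨d, p, P, Q, h, rfl, rfl⟩)
  rintro L V _ _ ⟨d, p, P, Q, h, rfl, rfl⟩
  refine ⟨?_, ?_, ?_, ?_, ?_, ?_⟩
  · exact fun _ s => s.locPre_inv.elim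
  · intro _ _ _ s
    obtain ⟨rfl, rfl, rfl⟩ := s.pre_inv
    exact ⟨_, LocStep.pre.weak, (UpTo.refl _).expands h⟩
  · exact fun _ _ _ s => s.locPre_inv.elim
  · exact fun _ s => s.locPre_inv.elim
  · intro _ _ _ s
    obtain ⟨rfl, rfl, rfl⟩ := s.pre_inv
    exact ⟨_, LocStep.pre, (UpTo.refl _).expands h⟩
  · exact fun _ _ _ s => s.locPre_inv.elim

theorem varRep {P Q : Proc S (Option L) V} (h : Expands D P Q) (x : V) :
    Expands D (varRep x P) (varRep x Q) := by
  refine expands_of_upTo (fun L V A B => ∃ x P Q, Expands D P Q ∧ A = .varRep x Q ∧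
    B = .varRep x P) ?_ (.base ⟨x, P, Q, h, rfl, rfl⟩)
  rintro L V _ _ ⟨x, P, Q, h, rfl, rfl⟩
  -- The replications persist after the input, in the extended context; closure under renaming
  -- brings this back to the original pair.
  have key : UpTo D (fun L V A B => ∃ x P Q, Expands D P Q ∧ A = .varRep x Q ∧ B = .varRep x P)
      (.par Q ((Proc.varRep x Q).map some id)) (.par P ((Proc.varRep x P).map some id)) :=
    ((UpTo.refl _).expands h).par (.map (Option.some_injective _) Function.injective_id
      (.base ⟨x, P, Q, h, rfl, rfl⟩))
  refine ⟨?_, ?_, ?_, ?_, ?_, ?_⟩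
  · exact fun _ s => s.varRep_inv.elim
  · exact fun _ _ _ s => s.varRep_inv.elim
  · intro _ _ _ s
    obtain ⟨rfl, rfl, rfl⟩ := s.rep_inv
    exact ⟨_, VarStep.rep.weak, key⟩
  · exact fun _ s => s.varRep_inv.elim
  · exact fun _ _ _ s => s.varRep_inv.elim
  · intro _ _ _ s
    obtain ⟨rfl, rfl, rfl⟩ := s.rep_inv
    exact ⟨_, VarStep.rep, key⟩

end Expands

/-! ### Structural congruence by flattening -/

/-- The extension of a valuation of names to a newly bound name. -/
def ext {A B : Type} (f : A → B) (b : B) (a : Option A) : B := a.elim b f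

section ext
variable {A B C : Type} (f : A → B) (b c : B)

theorem ext_none : ext f b none = b := rfl

theorem ext_some (a : A) : ext f b (some a) = f a := rfl

theorem ext_comp_some : ext f b ∘ some = f := rfl

theorem ext_comp_map (g : C → A) : ext f b ∘ Option.map g = ext (f ∘ g) b := by
  funext a; cases a <;> rfl

theorem ext_comp_map_some : ext (ext f b) c ∘ Option.map some = ext f c := ext_comp_map ..

theorem ext_comp_swap : ext (ext f b) c ∘ swap = ext (ext f c) b := by
  funext a
  rcases a with _ | _ | a <;> rfl

theorem comp_ext (g : B → C) : g ∘ ext f b = ext (g ∘ f) (g b) := by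
  funext a; cases a <;> rfl

theorem map_ext_eq : Option.map (ext f b) = ext (ext (some ∘ f) (some b)) none := by
  funext a
  rcases a with _ | _ | a <;> rfl

theorem map_eq_ext : Option.map f = ext (some ∘ f) none := by
  funext a; cases a <;> rfl

theorem ext_injective {f : A → B} {b : B} (hf : Function.Injective f) (hb : b ∉ Set.range f) :
    Function.Injective (ext f b) := by
  rintro (_ | x) (_ | y) h
  · rfl
  · exact (hb ⟨y, h.symm⟩).elim
  · exact (hb ⟨x, h⟩).elim
  · exact congrArg some (hf h)

end ext

/-- `Flat f g P m hL hV`: when its free names are valued by `f` and `g`, the process `P` is the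
parallel composition of the processes in `m`, under the restriction of names
which are valued by the elements of `hL` and of `hV`. -/
inductive Flat : ∀ {L V HL HV : Type}, (L → HL) → (V → HV) → Proc S L V →
    Multiset (Proc S HL HV) → Multiset HL → Multiset HV → Prop where
  | leaf {L V HL HV : Type} {f : L → HL} {g : V → HV} {P : Proc S L V} :
      Flat f g P {P.map f g} 0 0
  | nil {L V HL HV : Type} {f : L → HL} {g : V → HV} : Flat f g (nil : Proc S L V) 0 0 0
  | par {L V HL HV : Type} {f : L → HL} {g : V → HV} {P Q : Proc S L V} {m m' hL hL' hV hV'} :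
      Flat f g P m hL hV → Flat f g Q m' hL' hV' →
      Flat f g (par P Q) (m + m') (hL + hL') (hV + hV')
  | resL {L V HL HV : Type} {f : L → HL} {g : V → HV} {P : Proc S (Option L) V} {m hL hV}
      (h : HL) : Flat (ext f h) g P m hL hV → Flat f g (resL P) m (h ::ₘ hL) hV
  | resV {L V HL HV : Type} {f : L → HL} {g : V → HV} {P : Proc S L (Option V)} {m hL hV}
      (h : HV) : Flat f (ext g h) P m hL hV → Flat f g (resV P) m hL (h ::ₘ hV)

namespace Flat

theorem map_source_aux {L V HL HV : Type} {f' : L → HL} {g' : V → HV}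
    {P : Proc S L V} {m hL hV} (h : Flat f' g' P m hL hV) :
    ∀ {L' V' : Type} (f : L' → HL) (g : V' → HV) (a : L → L') (b : V → V'),
    f' = f ∘ a → g' = g ∘ b → Flat f g (P.map a b) m hL hV := by
  induction h with
  | leaf =>
    rintro L' V' f g a b rfl rfl
    rw [← Proc.map_map]; exact .leaf
  | nil => intro L' V' f g a b _ _; exact .nil
  | par _ _ ih ih' =>
    rintro L' V' f g a b rfl rfl
    exact .par (ih f g a b rfl rfl) (ih' f g a b rfl rfl)
  | resL h _ ih =>
    rintro L' V' f g a b rfl rfl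
    exact .resL h (ih _ _ _ _ (ext_comp_map ..).symm rfl)
  | resV h _ ih =>
    rintro L' V' f g a b rfl rfl
    exact .resV h (ih _ _ _ _ rfl (ext_comp_map ..).symm)

theorem map_source {L V L' V' HL HV : Type} {f : L' → HL} {g : V' → HV} {a : L → L'} {b : V → V'}
    {P : Proc S L V} {m hL hV} (h : Flat (f ∘ a) (g ∘ b) P m hL hV) :
    Flat f g (P.map a b) m hL hV :=
  h.map_source_aux f g a b rfl rfl

theorem map_target {L V HL HV : Type} {f : L → HL} {g : V → HV}
    {P : Proc S L V} {m hL hV} (h : Flat f g P m hL hV) :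
    ∀ {HL' HV' : Type} (a : HL → HL') (b : HV → HV'),
    Flat (a ∘ f) (b ∘ g) P (m.map (Proc.map a b)) (hL.map a) (hV.map b) := by
  induction h with
  | leaf =>
    intro HL' HV' a b
    rw [Multiset.map_singleton, Proc.map_map]; exact .leaf
  | nil => intro HL' HV' a b; exact .nil
  | par _ _ ih ih' =>
    intro HL' HV' a b
    rw [Multiset.map_add, Multiset.map_add, Multiset.map_add]
    exact .par (ih a b) (ih' a b)
  | resL h _ ih =>
    intro HL' HV' a b
    rw [Multiset.map_cons]
    refine .resL _ ?_
    rw [← comp_ext]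
    exact ih a b
  | resV h _ ih =>
    intro HL' HV' a b
    rw [Multiset.map_cons]
    refine .resV _ ?_
    rw [← comp_ext]
    exact ih a b

theorem weaken {L V HL HV : Type} {f : L → HL} {g : V → HV}
    {P : Proc S L V} {m hL hV} (h : Flat f g P m hL hV) :
    Flat (Option.map f) (Option.map g) (P.map some some) (m.map (Proc.map some some))
      (hL.map some) (hV.map some) :=
  map_source (h.map_target some some)

theorem weakenL {L V HL HV : Type} {f : L → HL} {g : V → HV}
    {P : Proc S L V} {m hL hV} (h : Flat f g P m hL hV) :
    Flat (Option.map f) g (P.map some id) (m.map (Proc.map some id)) (hL.map some) hV := by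
  have := h.map_target some id
  rw [Multiset.map_id] at this
  exact map_source this

/-! ### Transitions of a flattened process come from its components. -/

/-- A visible transition is made by a single component, and valuing names is a renaming, which
preserves transitions. Freshness of the values only matters for the converse. -/
theorem locStep {L V HL HV : Type} {f : L → HL} {g : V → HV}
    {P : Proc S L V} {m hL hV} (h : Flat f g P m hL hV) : ∀ {d p P'}, LocStep D d p P P' →
    ∃ A A' m', m = A ::ₘ m' ∧ LocStep D d (f p) A A' ∧
      Flat (Option.map f) (Option.map g) P' (A' ::ₘ m'.map (Proc.map some some))
        (hL.map some) (hV.map some) := by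
  induction h with
  | leaf => intro d p P' s; exact ⟨_, _, 0, rfl, s.map _ _, .leaf⟩
  | nil => intro d p P' s; exact s.nil_inv.elim
  | par h h' ih ih' =>
    intro d p P' s₀
    obtain ⟨P', s, rfl⟩ | ⟨P', s, rfl⟩ := s₀.par_inv
    · obtain ⟨A, A', m', rfl, sA, hf⟩ := ih s
      refine ⟨A, A', _, by rw [Multiset.cons_add], sA, ?_⟩
      have := hf.par h'.weaken
      simpa using this
    · obtain ⟨A, A', m', rfl, sA, hf⟩ := ih' s
      refine ⟨A, A', _, by rw [Multiset.add_cons], sA, ?_⟩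
      have := h.weaken.par hf
      simpa using this
  | resL h _ ih =>
    intro d p P' s₀
    obtain ⟨P', s, rfl⟩ := s₀.resL_inv
    obtain ⟨A, A', m', rfl, sA, hf⟩ := ih s
    refine ⟨A, A', m', rfl, sA, ?_⟩
    rw [Multiset.map_cons]
    refine .resL _ (map_source ?_)
    -- The exchange of the two binders in the derivative is compensated by extending the valuation
    -- with the two values in the other order.
    rw [map_eq_ext, ext_comp_swap, ← map_ext_eq]
    exact hf
  | resV h _ ih =>
    intro d p P' s₀
    obtain ⟨P', s, rfl⟩ := s₀.resV_inv
    obtain ⟨A, A', m', rfl, sA, hf⟩ := ih s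
    refine ⟨A, A', m', rfl, sA, ?_⟩
    rw [Multiset.map_cons (f := some) h]
    refine .resV _ (map_source ?_)
    rw [map_eq_ext (f := _), map_eq_ext, ext_comp_swap, ← map_ext_eq, ← map_eq_ext]
    exact hf

theorem varStep {L V HL HV : Type} {f : L → HL} {g : V → HV}
    {P : Proc S L V} {m hL hV} (h : Flat f g P m hL hV) : ∀ {d p P'}, VarStep D d p P P' →
    ∃ A A' m', m = A ::ₘ m' ∧ VarStep D d (g p) A A' ∧
      Flat (Option.map f) g P' (A' ::ₘ m'.map (Proc.map some id)) (hL.map some) hV := by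
  induction h with
  | leaf => intro d p P' s; exact ⟨_, _, 0, rfl, s.map _ _, .leaf⟩
  | nil => intro d p P' s; exact s.nil_inv.elim
  | par h h' ih ih' =>
    intro d p P' s₀
    obtain ⟨P', s, rfl⟩ | ⟨P', s, rfl⟩ := s₀.par_inv
    · obtain ⟨A, A', m', rfl, sA, hf⟩ := ih s
      refine ⟨A, A', _, by rw [Multiset.cons_add], sA, ?_⟩
      have := hf.par h'.weakenL
      simpa using this
    · obtain ⟨A, A', m', rfl, sA, hf⟩ := ih' s
      refine ⟨A, A', _, by rw [Multiset.add_cons], sA, ?_⟩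
      have := h.weakenL.par hf
      simpa using this
  | resL h _ ih =>
    intro d p P' s₀
    obtain ⟨P', s, rfl⟩ := s₀.resL_inv
    obtain ⟨A, A', m', rfl, sA, hf⟩ := ih s
    refine ⟨A, A', m', rfl, sA, ?_⟩
    rw [Multiset.map_cons]
    refine .resL _ (map_source ?_)
    rw [map_eq_ext, ext_comp_swap, ← map_ext_eq]
    exact hf
  | resV h _ ih =>
    intro d p P' s₀
    obtain ⟨P', s, rfl⟩ := s₀.resV_inv
    obtain ⟨A, A', m', rfl, sA, hf⟩ := ih s
    exact ⟨A, A', m', rfl, sA, .resV _ hf⟩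

/-- The internal transitions of a flattened process. -/
theorem tauStep {L V HL HV : Type} {f : L → HL} {g : V → HV}
    {P : Proc S L V} {m hL hV} (h : Flat f g P m hL hV) : ∀ {P'}, TauStep D P P' →
    (∃ A A' m', m = A ::ₘ m' ∧ TauStep D A A' ∧ Flat f g P' (A' ::ₘ m') hL hV) ∨
    (∃ A B m' d p A' B', m = A ::ₘ B ::ₘ m' ∧ LocStep D d p A A' ∧ LocStep D d.dual p B B' ∧
      Flat (some ∘ f) (some ∘ g) P' (A' ::ₘ B' ::ₘ m'.map (Proc.map some some))
        (none ::ₘ hL.map some) (none ::ₘ hV.map some)) ∨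
    (∃ A B m' d p A' B', m = A ::ₘ B ::ₘ m' ∧ VarStep D d p A A' ∧ VarStep D d.dual p B B' ∧
      Flat (some ∘ f) g P' (A' ::ₘ B' ::ₘ m'.map (Proc.map some id))
        (none ::ₘ hL.map some) hV) := by
  induction h with
  | leaf => intro P' s; exact .inl ⟨_, _, 0, rfl, s.map _ _, .leaf⟩
  | nil => intro P' s; exact s.nil_inv.elim
  | par h h' ih ih' =>
    intro P' s₀
    obtain ⟨P', s, rfl⟩ | ⟨P', s, rfl⟩ | ⟨_, _, P', Q', s, s', rfl⟩ | ⟨_, _, P', Q', s, s', rfl⟩ :=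
      s₀.par_inv
    · obtain ⟨A, A', m', rfl, sA, hf⟩ | ⟨A, B, m', d, p, A', B', rfl, sA, sB, hf⟩ |
        ⟨A, B, m', d, p, A', B', rfl, sA, sB, hf⟩ := ih s
      · refine .inl ⟨A, A', _, Multiset.cons_add .., sA, ?_⟩
        have := hf.par h'
        simpa using this
      · refine .inr (.inl ⟨A, B, _, d, p, A', B', by simp only [Multiset.cons_add]; rfl, sA, sB,
          ?_⟩)
        have := hf.par (h'.map_target some some)
        simpa using this
      · refine .inr (.inr ⟨A, B, _, d, p, A', B', by simp only [Multiset.cons_add]; rfl, sA, sB,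
          ?_⟩)
        have := hf.par (h'.map_target some id)
        simpa using this
    · obtain ⟨A, A', m', rfl, sA, hf⟩ | ⟨A, B, m', d, p, A', B', rfl, sA, sB, hf⟩ |
        ⟨A, B, m', d, p, A', B', rfl, sA, sB, hf⟩ := ih' s
      · refine .inl ⟨A, A', _, Multiset.add_cons .., sA, ?_⟩
        have := h.par hf
        simpa using this
      · refine .inr (.inl ⟨A, B, _, d, p, A', B', by simp only [Multiset.add_cons]; rfl, sA, sB,
          ?_⟩)
        have := (h.map_target some some).par hf
        simpa using this
      · refine .inr (.inr ⟨A, B, _, d, p, A', B', by simp only [Multiset.add_cons]; rfl, sA, sB,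
          ?_⟩)
        have := (h.map_target some id).par hf
        simpa using this
    · obtain ⟨A, A', m₁, rfl, sA, hA⟩ := h.locStep s
      obtain ⟨B, B', m₂, rfl, sB, hB⟩ := h'.locStep s'
      refine .inr (.inl ⟨A, B, m₁ + m₂, _, _, A', B', ?_, sA, sB, ?_⟩)
      · simp only [Multiset.add_cons, Multiset.cons_add, Multiset.cons_swap A B]
      · have := hA.par hB
        rw [map_eq_ext, map_eq_ext] at this
        have := this.resL.resV
        simp only [Multiset.add_cons, Multiset.cons_add, Multiset.map_add] at this ⊢
        rw [Multiset.cons_swap A' B']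
        exact this
    · obtain ⟨A, A', m₁, rfl, sA, hA⟩ := h.varStep s
      obtain ⟨B, B', m₂, rfl, sB, hB⟩ := h'.varStep s'
      refine .inr (.inr ⟨A, B, m₁ + m₂, _, _, A', B', ?_, sA, sB, ?_⟩)
      · simp only [Multiset.add_cons, Multiset.cons_add, Multiset.cons_swap A B]
      · have := hA.par hB
        rw [map_eq_ext] at this
        have := this.resL
        simp only [Multiset.add_cons, Multiset.cons_add, Multiset.map_add] at this ⊢
        rw [Multiset.cons_swap A' B']
        exact this
  | resL h _ ih =>
    intro P' s₀
    obtain ⟨P', s, rfl⟩ := s₀.resL_inv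
    obtain ⟨A, A', m', rfl, sA, hf⟩ | ⟨A, B, m', d, p, A', B', rfl, sA, sB, hf⟩ |
      ⟨A, B, m', d, p, A', B', rfl, sA, sB, hf⟩ := ih s
    · exact .inl ⟨A, A', m', rfl, sA, .resL _ hf⟩
    · rw [comp_ext] at hf
      refine .inr (.inl ⟨A, B, m', d, p, A', B', rfl, sA, sB, ?_⟩)
      rw [Multiset.map_cons, Multiset.cons_swap none (some h)]
      exact hf.resL
    · rw [comp_ext] at hf
      refine .inr (.inr ⟨A, B, m', d, p, A', B', rfl, sA, sB, ?_⟩)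
      rw [Multiset.map_cons, Multiset.cons_swap none (some h)]
      exact hf.resL
  | resV h _ ih =>
    intro P' s₀
    obtain ⟨P', s, rfl⟩ := s₀.resV_inv
    obtain ⟨A, A', m', rfl, sA, hf⟩ | ⟨A, B, m', d, p, A', B', rfl, sA, sB, hf⟩ |
      ⟨A, B, m', d, p, A', B', rfl, sA, sB, hf⟩ := ih s
    · exact .inl ⟨A, A', m', rfl, sA, .resV _ hf⟩
    · rw [comp_ext] at hf
      refine .inr (.inl ⟨A, B, m', d, p, A', B', rfl, sA, sB, ?_⟩)
      rw [Multiset.map_cons (f := some) h, Multiset.cons_swap none (some h)]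
      exact hf.resV
    · exact .inr (.inr ⟨A, B, m', d, p, A', B', rfl, sA, sB, hf.resV⟩)

/-- The restricted names are pairwise distinct, and distinct from the valuations of the free
names, which are injective. -/
structure Fresh {A B : Type} (f : A → B) (h : Multiset B) : Prop where
  inj : Function.Injective f
  nodup : h.Nodup
  disjoint : ∀ a, f a ∉ h

namespace Fresh
variable {A B : Type} {f : A → B} {b : B} {h h' : Multiset B}

theorem ext (H : Fresh f (b ::ₘ h)) : Fresh (ext f b) h := by
  obtain ⟨h₁, h₂⟩ := Multiset.nodup_cons.1 H.nodup
  refine ⟨ext_injective H.inj ?_, h₂, ?_⟩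
  · rintro ⟨a, rfl⟩
    exact H.disjoint a (Multiset.mem_cons_self _ _)
  · rintro (_ | a)
    · exact h₁
    · exact fun h => H.disjoint a (Multiset.mem_cons_of_mem h)

theorem left (H : Fresh f (h + h')) : Fresh f h :=
  ⟨H.inj, (Multiset.nodup_add.1 H.nodup).1, fun a m => H.disjoint a (Multiset.mem_add.2 (.inl m))⟩

theorem right (H : Fresh f (h + h')) : Fresh f h' :=
  ⟨H.inj, (Multiset.nodup_add.1 H.nodup).2.1,
    fun a m => H.disjoint a (Multiset.mem_add.2 (.inr m))⟩

theorem map (H : Fresh f h) : Fresh (Option.map f) (h.map some) := by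
  refine ⟨Option.map_injective H.inj, H.nodup.map (Option.some_injective _), ?_⟩
  rintro (_ | a) m
  · simp at m
  · exact H.disjoint a (by simpa using m)

theorem some (H : Fresh f h) : Fresh (some ∘ f) (none ::ₘ h.map some) := by
  refine ⟨(Option.some_injective _).comp H.inj, ?_, fun a m => H.disjoint a (by simpa using m)⟩
  exact Multiset.nodup_cons.2 ⟨by simp, H.nodup.map (Option.some_injective _)⟩

end Fresh

theorem add_eq_cons {A : Type*} {m m' n : Multiset A} {a : A} (h : m + m' = a ::ₘ n) :
    (∃ k, m = a ::ₘ k ∧ n = k + m') ∨ ∃ k, m' = a ::ₘ k ∧ n = m + k := by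
  have : a ∈ m + m' := h ▸ Multiset.mem_cons_self _ _
  obtain h' | h' := Multiset.mem_add.1 this
  · obtain ⟨k, rfl⟩ := Multiset.exists_cons_of_mem h'
    rw [Multiset.cons_add, Multiset.cons_inj_right] at h
    exact .inl ⟨k, rfl, h.symm⟩
  · obtain ⟨k, rfl⟩ := Multiset.exists_cons_of_mem h'
    rw [Multiset.add_cons, Multiset.cons_inj_right] at h
    exact .inr ⟨k, rfl, h.symm⟩

/-- A component is a renamed subprocess, so its subjects are values of free names or of binders
above it. This locates the subject of a communication between components on opposite sides of a
parallel composition. -/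
theorem loc_mem {L V HL HV : Type} {f : L → HL} {g : V → HV}
    {P : Proc S L V} {m hL hV} (h : Flat f g P m hL hV) : ∀ {A d q A'}, A ∈ m →
    LocStep D d q A A' → q ∈ Set.range f ∨ q ∈ hL := by
  induction h with
  | leaf =>
    intro A d q A' hA s
    obtain rfl := Multiset.mem_singleton.1 hA
    obtain ⟨p, _, rfl, _⟩ := s.map_inv
    exact .inl ⟨p, rfl⟩
  | nil => intro A d q A' hA; simp at hA
  | par _ _ ih ih' =>
    intro A d q A' hA s
    obtain hA | hA := Multiset.mem_add.1 hA
    · exact (ih hA s).imp_right fun h => Multiset.mem_add.2 (.inl h)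
    · exact (ih' hA s).imp_right fun h => Multiset.mem_add.2 (.inr h)
  | resL h _ ih =>
    intro A d q A' hA s
    obtain ⟨_ | p, rfl⟩ | h := ih hA s
    · exact .inr (Multiset.mem_cons_self _ _)
    · exact .inl ⟨p, rfl⟩
    · exact .inr (Multiset.mem_cons_of_mem h)
  | resV h _ ih => exact fun hA s => ih hA s

theorem var_mem {L V HL HV : Type} {f : L → HL} {g : V → HV}
    {P : Proc S L V} {m hL hV} (h : Flat f g P m hL hV) : ∀ {A d q A'}, A ∈ m →
    VarStep D d q A A' → q ∈ Set.range g ∨ q ∈ hV := by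
  induction h with
  | leaf =>
    intro A d q A' hA s
    obtain rfl := Multiset.mem_singleton.1 hA
    obtain ⟨p, _, rfl, _⟩ := s.map_inv
    exact .inl ⟨p, rfl⟩
  | nil => intro A d q A' hA; simp at hA
  | par _ _ ih ih' =>
    intro A d q A' hA s
    obtain hA | hA := Multiset.mem_add.1 hA
    · exact (ih hA s).imp_right fun h => Multiset.mem_add.2 (.inl h)
    · exact (ih' hA s).imp_right fun h => Multiset.mem_add.2 (.inr h)
  | resL h _ ih => exact fun hA s => ih hA s
  | resV h _ ih =>
    intro A d q A' hA s
    obtain ⟨_ | p, rfl⟩ | h := ih hA s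
    · exact .inr (Multiset.mem_cons_self _ _)
    · exact .inl ⟨p, rfl⟩
    · exact .inr (Multiset.mem_cons_of_mem h)

/-! ### Transitions of components lift to the flattened process, when values are fresh. -/

theorem locStep_of {L V HL HV : Type} {f : L → HL} {g : V → HV}
    {P : Proc S L V} {m hL hV} (h : Flat f g P m hL hV) : Fresh f hL → Fresh g hV →
    ∀ {d p A A' m'}, m = A ::ₘ m' → LocStep D d (f p) A A' → ∃ P', LocStep D d p P P' ∧
      Flat (Option.map f) (Option.map g) P' (A' ::ₘ m'.map (Proc.map some some))
        (hL.map some) (hV.map some) := by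
  induction h with
  | leaf =>
    intro hf hg d p A A' m' e s
    obtain ⟨rfl, rfl⟩ := Multiset.singleton_eq_cons_iff _ |>.1 e
    obtain ⟨q, P', e, s', rfl⟩ := s.map_inv
    obtain rfl := hf.inj e
    exact ⟨P', s', .leaf⟩
  | nil => intro hf hg d p A A' m' e; simp at e
  | par h h' ih ih' =>
    intro hf hg d p A A' m' e s
    obtain ⟨k, rfl, rfl⟩ | ⟨k, rfl, rfl⟩ := add_eq_cons e
    · obtain ⟨P', s, hP⟩ := ih hf.left hg.left rfl s
      exact ⟨_, s.parL, by simpa using hP.par h'.weaken⟩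
    · obtain ⟨P', s, hP⟩ := ih' hf.right hg.right rfl s
      exact ⟨_, s.parR, by simpa using h.weaken.par hP⟩
  | resL h _ ih =>
    intro hf hg d p A A' m' e s
    obtain ⟨P', s, hP⟩ := ih hf.ext hg (p := some p) e s
    refine ⟨_, s.resL, ?_⟩
    rw [Multiset.map_cons]
    refine .resL _ (map_source ?_)
    rw [map_eq_ext, ext_comp_swap, ← map_ext_eq]
    exact hP
  | resV h _ ih =>
    intro hf hg d p A A' m' e s
    obtain ⟨P', s, hP⟩ := ih hf hg.ext e s
    refine ⟨_, s.resV, ?_⟩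
    rw [Multiset.map_cons (f := Option.some) h]
    refine .resV _ (map_source ?_)
    rw [map_eq_ext (f := _), map_eq_ext, ext_comp_swap, ← map_ext_eq, ← map_eq_ext]
    exact hP

theorem varStep_of {L V HL HV : Type} {f : L → HL} {g : V → HV}
    {P : Proc S L V} {m hL hV} (h : Flat f g P m hL hV) : Fresh f hL → Fresh g hV →
    ∀ {d p A A' m'}, m = A ::ₘ m' → VarStep D d (g p) A A' → ∃ P', VarStep D d p P P' ∧
      Flat (Option.map f) g P' (A' ::ₘ m'.map (Proc.map some id)) (hL.map some) hV := by
  induction h with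
  | leaf =>
    intro hf hg d p A A' m' e s
    obtain ⟨rfl, rfl⟩ := Multiset.singleton_eq_cons_iff _ |>.1 e
    obtain ⟨q, P', e, s', rfl⟩ := s.map_inv
    obtain rfl := hg.inj e
    exact ⟨P', s', .leaf⟩
  | nil => intro hf hg d p A A' m' e; simp at e
  | par h h' ih ih' =>
    intro hf hg d p A A' m' e s
    obtain ⟨k, rfl, rfl⟩ | ⟨k, rfl, rfl⟩ := add_eq_cons e
    · obtain ⟨P', s, hP⟩ := ih hf.left hg.left rfl s
      exact ⟨_, s.parL, by simpa using hP.par h'.weakenL⟩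
    · obtain ⟨P', s, hP⟩ := ih' hf.right hg.right rfl s
      exact ⟨_, s.parR, by simpa using h.weakenL.par hP⟩
  | resL h _ ih =>
    intro hf hg d p A A' m' e s
    obtain ⟨P', s, hP⟩ := ih hf.ext hg e s
    refine ⟨_, s.resL, ?_⟩
    rw [Multiset.map_cons]
    refine .resL _ (map_source ?_)
    rw [map_eq_ext, ext_comp_swap, ← map_ext_eq]
    exact hP
  | resV h _ ih =>
    intro hf hg d p A A' m' e s
    obtain ⟨P', s, hP⟩ := ih hf hg.ext (p := some p) e s
    exact ⟨_, s.resV, .resV _ hP⟩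

theorem tauStep_of {L V HL HV : Type} {f : L → HL} {g : V → HV}
    {P : Proc S L V} {m hL hV} (h : Flat f g P m hL hV) : Fresh f hL → Fresh g hV →
    ∀ {A A' m'}, m = A ::ₘ m' → TauStep D A A' → ∃ P', TauStep D P P' ∧
      Flat f g P' (A' ::ₘ m') hL hV := by
  induction h with
  | leaf =>
    intro hf hg A A' m' e s
    obtain ⟨rfl, rfl⟩ := Multiset.singleton_eq_cons_iff _ |>.1 e
    obtain ⟨P', s', rfl⟩ := s.map_inv hf.inj hg.inj
    exact ⟨P', s', .leaf⟩
  | nil => intro hf hg A A' m' e; simp at e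
  | par h h' ih ih' =>
    intro hf hg A A' m' e s
    obtain ⟨k, rfl, rfl⟩ | ⟨k, rfl, rfl⟩ := add_eq_cons e
    · obtain ⟨P', s, hP⟩ := ih hf.left hg.left rfl s
      exact ⟨_, s.parL, by simpa using hP.par h'⟩
    · obtain ⟨P', s, hP⟩ := ih' hf.right hg.right rfl s
      exact ⟨_, s.parR, by simpa using h.par hP⟩
  | resL h _ ih =>
    intro hf hg A A' m' e s
    obtain ⟨P', s, hP⟩ := ih hf.ext hg e s
    exact ⟨_, s.resL, .resL _ hP⟩
  | resV h _ ih =>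
    intro hf hg A A' m' e s
    obtain ⟨P', s, hP⟩ := ih hf hg.ext e s
    exact ⟨_, s.resV, .resV _ hP⟩

/-- The two partners part at some parallel composition of the syntax tree. Above that point the
communication is an internal step and passes freely; at that point both must be able to show their
common subject. -/
theorem comLoc_of {L V HL HV : Type} {f : L → HL} {g : V → HV}
    {P : Proc S L V} {m hL hV} (h : Flat f g P m hL hV) : Fresh f hL → Fresh g hV →
    ∀ {A A' B B' m' d p}, m = A ::ₘ B ::ₘ m' → LocStep D d p A A' → LocStep D d.dual p B B' →
    ∃ P', TauStep D P P' ∧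
      Flat (some ∘ f) (some ∘ g) P' (A' ::ₘ B' ::ₘ m'.map (Proc.map some some))
        (none ::ₘ hL.map some) (none ::ₘ hV.map some) := by
  induction h with
  | leaf =>
    intro hf hg A A' B B' m' d p e
    have := congrArg Multiset.card e
    simp at this
  | nil => intro hf hg A A' B B' m' d p e; simp at e
  | @par L V HL HV f g P Q m m₂ hL hL' hV hV' h h' ih ih' =>
    intro hf hg A A' B B' m' d p e s s'
    -- The partners lie on opposite sides. If their subject were not the value of a free name, it
    -- would be restricted on both sides, and the restricted names would not be pairwise distinct.
    have split {A B : Proc S HL HV} {A' B'} {d p k k'} (hA : m = A ::ₘ k) (hB : m₂ = B ::ₘ k')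
        (s : LocStep D d p A A') (s' : LocStep D d.dual p B B') :
        ∃ P', TauStep D (.par P Q) P' ∧ Flat (Option.some ∘ f) (Option.some ∘ g) P'
          (A' ::ₘ B' ::ₘ (k + k').map (Proc.map Option.some Option.some))
          (none ::ₘ (hL + hL').map Option.some) (none ::ₘ (hV + hV').map Option.some) := by
      have hp : p ∈ Set.range f := by
        obtain hp | hp := loc_mem h (hA ▸ Multiset.mem_cons_self _ _) s
        · exact hp
        obtain hp' | hp' := loc_mem h' (hB ▸ Multiset.mem_cons_self _ _) s'
        · exact hp'
        · exact (Multiset.disjoint_left.1 (Multiset.nodup_add.1 hf.nodup).2.2 hp hp').elim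
      obtain ⟨p, rfl⟩ := hp
      obtain ⟨P', t, hP⟩ := locStep_of h hf.left hg.left hA s
      obtain ⟨Q', t', hQ⟩ := locStep_of h' hf.right hg.right hB s'
      refine ⟨_, .comLoc t t', ?_⟩
      have := hP.par hQ
      rw [map_eq_ext, map_eq_ext] at this
      have := this.resL.resV
      simp only [Multiset.add_cons, Multiset.cons_add, Multiset.map_add] at this ⊢
      rw [Multiset.cons_swap A' B']
      exact this
    obtain ⟨k, hA, e⟩ | ⟨k, hA, e⟩ := add_eq_cons e
    · obtain ⟨k', rfl, rfl⟩ | ⟨k', hB, rfl⟩ := add_eq_cons e.symm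
      · obtain ⟨P', t, hP⟩ := ih hf.left hg.left hA s s'
        exact ⟨_, t.parL, by simpa using hP.par (h'.map_target Option.some Option.some)⟩
      · exact split hA hB s s'
    · obtain ⟨k', hB, rfl⟩ | ⟨k', rfl, rfl⟩ := add_eq_cons e.symm
      · obtain ⟨P', t, hP⟩ := split hB hA s' (by rwa [Pol.dual_dual])
        exact ⟨P', t, by rwa [Multiset.cons_swap]⟩
      · obtain ⟨P', t, hP⟩ := ih' hf.right hg.right hA s s'
        exact ⟨_, t.parR, by simpa using (h.map_target Option.some Option.some).par hP⟩
  | resL h _ ih =>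
    intro hf hg A A' B B' m' d p e s s'
    obtain ⟨P', t, hP⟩ := ih hf.ext hg e s s'
    refine ⟨_, t.resL, ?_⟩
    rw [comp_ext] at hP
    rw [Multiset.map_cons, Multiset.cons_swap none (Option.some h)]
    exact hP.resL
  | resV h _ ih =>
    intro hf hg A A' B B' m' d p e s s'
    obtain ⟨P', t, hP⟩ := ih hf hg.ext e s s'
    refine ⟨_, t.resV, ?_⟩
    rw [comp_ext] at hP
    rw [Multiset.map_cons (f := Option.some) h, Multiset.cons_swap none (Option.some h)]
    exact hP.resV

theorem comVar_of {L V HL HV : Type} {f : L → HL} {g : V → HV}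
    {P : Proc S L V} {m hL hV} (h : Flat f g P m hL hV) : Fresh f hL → Fresh g hV →
    ∀ {A A' B B' m' d p}, m = A ::ₘ B ::ₘ m' → VarStep D d p A A' → VarStep D d.dual p B B' →
    ∃ P', TauStep D P P' ∧
      Flat (some ∘ f) g P' (A' ::ₘ B' ::ₘ m'.map (Proc.map some id))
        (none ::ₘ hL.map some) hV := by
  induction h with
  | leaf =>
    intro hf hg A A' B B' m' d p e
    have := congrArg Multiset.card e
    simp at this
  | nil => intro hf hg A A' B B' m' d p e; simp at e
  | @par L V HL HV f g P Q m m₂ hL hL' hV hV' h h' ih ih' =>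
    intro hf hg A A' B B' m' d p e s s'
    have split {A B : Proc S HL HV} {A' B'} {d p k k'} (hA : m = A ::ₘ k) (hB : m₂ = B ::ₘ k')
        (s : VarStep D d p A A') (s' : VarStep D d.dual p B B') :
        ∃ P', TauStep D (.par P Q) P' ∧ Flat (Option.some ∘ f) g P'
          (A' ::ₘ B' ::ₘ (k + k').map (Proc.map Option.some id))
          (none ::ₘ (hL + hL').map Option.some) (hV + hV') := by
      have hp : p ∈ Set.range g := by
        obtain hp | hp := var_mem h (hA ▸ Multiset.mem_cons_self _ _) s
        · exact hp
        obtain hp' | hp' := var_mem h' (hB ▸ Multiset.mem_cons_self _ _) s'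
        · exact hp'
        · exact (Multiset.disjoint_left.1 (Multiset.nodup_add.1 hg.nodup).2.2 hp hp').elim
      obtain ⟨p, rfl⟩ := hp
      obtain ⟨P', t, hP⟩ := varStep_of h hf.left hg.left hA s
      obtain ⟨Q', t', hQ⟩ := varStep_of h' hf.right hg.right hB s'
      refine ⟨_, .comVar t t', ?_⟩
      have := hP.par hQ
      rw [map_eq_ext] at this
      have := this.resL
      simp only [Multiset.add_cons, Multiset.cons_add, Multiset.map_add] at this ⊢
      rw [Multiset.cons_swap A' B']
      exact this
    obtain ⟨k, hA, e⟩ | ⟨k, hA, e⟩ := add_eq_cons e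
    · obtain ⟨k', rfl, rfl⟩ | ⟨k', hB, rfl⟩ := add_eq_cons e.symm
      · obtain ⟨P', t, hP⟩ := ih hf.left hg.left hA s s'
        exact ⟨_, t.parL, by simpa using hP.par (h'.map_target Option.some id)⟩
      · exact split hA hB s s'
    · obtain ⟨k', hB, rfl⟩ | ⟨k', rfl, rfl⟩ := add_eq_cons e.symm
      · obtain ⟨P', t, hP⟩ := split hB hA s' (by rwa [Pol.dual_dual])
        exact ⟨P', t, by rwa [Multiset.cons_swap]⟩
      · obtain ⟨P', t, hP⟩ := ih' hf.right hg.right hA s s'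
        exact ⟨_, t.parR, by simpa using (h.map_target Option.some id).par hP⟩
  | resL h _ ih =>
    intro hf hg A A' B B' m' d p e s s'
    obtain ⟨P', t, hP⟩ := ih hf.ext hg e s s'
    refine ⟨_, t.resL, ?_⟩
    rw [comp_ext] at hP
    rw [Multiset.map_cons, Multiset.cons_swap none (Option.some h)]
    exact hP.resL
  | resV h _ ih =>
    intro hf hg A A' B B' m' d p e s s'
    obtain ⟨P', t, hP⟩ := ih hf hg.ext e s s'
    exact ⟨_, t.resV, hP.resV⟩

/-- Processes with a common flattening are strongly bisimilar. -/
theorem bisim {L V HL HV : Type} {f : L → HL} {g : V → HV} {P Q : Proc S L V} {m hL hV hL' hV'}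
    (hP : Flat f g P m hL hV) (hQ : Flat f g Q m hL' hV') (h₁ : Fresh f hL) (h₂ : Fresh g hV)
    (h₃ : Fresh f hL') (h₄ : Fresh g hV') : Bisim D P Q := by
  refine ⟨fun L V P Q => ∃ (HL HV : Type) (f : L → HL) (g : V → HV) (m : Multiset (Proc S HL HV))
    (hL hL' : Multiset HL) (hV hV' : Multiset HV), Flat f g P m hL hV ∧ Flat f g Q m hL' hV' ∧
      Fresh f hL ∧ Fresh g hV ∧ Fresh f hL' ∧ Fresh g hV', ?_, ?_,
    ⟨_, _, _, _, _, _, _, _, _, hP, hQ, h₁, h₂, h₃, h₄⟩⟩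
  · rintro L V P Q ⟨HL, HV, f, g, m, hL, hL', hV, hV', hP, hQ, h₁, h₂, h₃, h₄⟩
    refine ⟨fun P' s => ?_, fun d p P' s => ?_, fun d p P' s => ?_⟩
    · obtain ⟨A, A', m', rfl, sA, hf⟩ | ⟨A, B, m', d, p, A', B', rfl, sA, sB, hf⟩ |
        ⟨A, B, m', d, p, A', B', rfl, sA, sB, hf⟩ := hP.tauStep s
      · obtain ⟨Q', t, hQ⟩ := tauStep_of hQ h₃ h₄ rfl sA
        exact ⟨_, t, _, _, _, _, _, _, _, _, _, hf, hQ, h₁, h₂, h₃, h₄⟩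
      · obtain ⟨Q', t, hQ⟩ := comLoc_of hQ h₃ h₄ rfl sA sB
        exact ⟨_, t, _, _, _, _, _, _, _, _, _, hf, hQ, h₁.some, h₂.some, h₃.some, h₄.some⟩
      · obtain ⟨Q', t, hQ⟩ := comVar_of hQ h₃ h₄ rfl sA sB
        exact ⟨_, t, _, _, _, _, _, _, _, _, _, hf, hQ, h₁.some, h₂, h₃.some, h₄⟩
    · obtain ⟨A, A', m', rfl, sA, hf⟩ := hP.locStep s
      obtain ⟨Q', t, hQ⟩ := locStep_of hQ h₃ h₄ rfl sA
      exact ⟨_, t, _, _, _, _, _, _, _, _, _, hf, hQ, h₁.map, h₂.map, h₃.map, h₄.map⟩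
    · obtain ⟨A, A', m', rfl, sA, hf⟩ := hP.varStep s
      obtain ⟨Q', t, hQ⟩ := varStep_of hQ h₃ h₄ rfl sA
      exact ⟨_, t, _, _, _, _, _, _, _, _, _, hf, hQ, h₁.map, h₂, h₃.map, h₄⟩
  · rintro L V P Q ⟨HL, HV, f, g, m, hL, hL', hV, hV', hP, hQ, h₁, h₂, h₃, h₄⟩
    exact ⟨HL, HV, f, g, m, hL', hL, hV', hV, hQ, hP, h₃, h₄, h₁, h₂⟩

end Flat

theorem ext_comp_some_comp {A B C : Type} (f : A → B) (b : B) (g : C → A) :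
    ext f b ∘ some ∘ g = f ∘ g := rfl

attribute [simp] Proc.map Proc.map_map map_varWire map_permVar map_permLoc ext_none ext_some
  ext_comp_some
  ext_comp_map ext_comp_swap map_comp_some swap_swap swap_comp_map_some swap_comp_some
  ext_comp_some_comp swap_comp_some_some

theorem fresh_inl {A : Type} {h : Multiset (A ⊕ ℕ)} (h₁ : h.Nodup) (h₂ : ∀ a, Sum.inl a ∉ h) :
    Flat.Fresh Sum.inl h := ⟨Sum.inl_injective, h₁, h₂⟩

/-- Processes with equal flattenings are strongly bisimilar; restricted names are valued
by numbers. -/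
theorem Flat.bisim_of_eq {L V : Type} {P Q : Proc S L V}
    {m m' : Multiset (Proc S (L ⊕ ℕ) (V ⊕ ℕ))} {hL hL' hV hV'}
    (hP : Flat Sum.inl Sum.inl P m hL hV) (hQ : Flat Sum.inl Sum.inl Q m' hL' hV') (e : m = m')
    (h₁ : (hL.Nodup ∧ ∀ a, Sum.inl a ∉ hL) ∧ (hV.Nodup ∧ ∀ a, Sum.inl a ∉ hV))
    (h₂ : (hL'.Nodup ∧ ∀ a, Sum.inl a ∉ hL') ∧ (hV'.Nodup ∧ ∀ a, Sum.inl a ∉ hV')) :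
    Bisim D P Q := by
  subst e
  exact hP.bisim hQ (fresh_inl h₁.1.1 h₁.1.2) (fresh_inl h₁.2.1 h₁.2.2)
    (fresh_inl h₂.1.1 h₂.1.2) (fresh_inl h₂.2.1 h₂.2.2)

/-! ### Communications and prefixes at restricted names. -/

/-- A process whose only transition is internal expands the derivative. -/
theorem expands_of_tau {L V : Type} {Q Q' : Proc S L V} (h : TauStep D Q Q')
    (tau : ∀ R, TauStep D Q R → R = Q') (loc : ∀ d p R, ¬ LocStep D d p Q R)
    (var : ∀ d p R, ¬ VarStep D d p Q R) : Expands D Q Q' := by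
  refine expands_of_upTo (fun L V A B => TauStep D B A ∧ (∀ R, TauStep D B R → R = A) ∧
    (∀ d p R, ¬ LocStep D d p B R) ∧ ∀ d p R, ¬ VarStep D d p B R) ?_ (.base ⟨h, tau, loc, var⟩)
  rintro L V A B ⟨h, tau, loc, var⟩
  refine ⟨?_, ?_, ?_, ?_, ?_, ?_⟩
  -- Every move of `A` is answered by `B` with its internal step to `A`, followed by the same move.
  · exact fun _ s => ⟨_, .tail (.single h) s, .refl _⟩
  · exact fun _ _ _ s => ⟨_, ⟨_, _, .single h, s, .refl⟩, .refl _⟩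
  · exact fun _ _ _ s => ⟨_, ⟨_, _, .single h, s, .refl⟩, .refl _⟩
  · exact fun _ s => .inl (tau _ s ▸ .refl _)
  · exact fun _ _ _ s => (loc _ _ _ s).elim
  · exact fun _ _ _ s => (var _ _ _ s).elim

/-- A communication at a restricted location name which is not used elsewhere. -/
theorem expands_com {L V : Type} (d : Pol) (A B : Proc S (Option L) (Option V)) :
    Expands D (resL (par (locPre d none (A.map (Option.map some) id))
      (locPre d.dual none (B.map (Option.map some) id)))) (resV (resL (par A B))) := by
  refine (expands_of_tau (.resL (.comLoc .pre .pre)) ?_ ?_ ?_).trans (Bisim.expands ?_)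
  · intro R s
    obtain ⟨R, u, rfl⟩ := s.resL_inv
    obtain ⟨_, t, rfl⟩ | ⟨_, t, rfl⟩ | ⟨_, _, _, _, t, t', rfl⟩ | ⟨_, _, _, _, t, t', rfl⟩ :=
      u.par_inv
    · exact t.locPre_inv.elim
    · exact t.locPre_inv.elim
    · obtain ⟨_, _, rfl⟩ := t.pre_inv
      obtain ⟨_, _, rfl⟩ := t'.pre_inv
      rfl
    · exact t.locPre_inv.elim
  · intro e p R s
    obtain ⟨R, u, rfl⟩ := s.resL_inv
    obtain ⟨_, t, rfl⟩ | ⟨_, t, rfl⟩ := u.par_inv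
    · exact nomatch t.pre_inv.2.1
    · exact nomatch t.pre_inv.2.1
  · intro e p R s
    obtain ⟨R, u, rfl⟩ := s.resL_inv
    obtain ⟨_, t, rfl⟩ | ⟨_, t, rfl⟩ := u.par_inv
    · exact t.locPre_inv.elim
    · exact t.locPre_inv.elim
  · refine Flat.bisim_of_eq (.resL (.inr 0) (.resV (.inr 0) (.resL (.inr 1) (.par .leaf .leaf))))
      -- Equal numbers match the binders of the two sides. The outermost location binder on the
      -- left, valued by 0, occurs in neither component and has no partner: flattening discards it.
      (.resV (.inr 0) (.resL (.inr 1) (.par .leaf .leaf))) ?_ ?_ ?_ <;> simp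

/-- A prefix of a component is a prefix of the composition, if the other component is a prefix at
a restricted name. -/
theorem bisim_resL_pre {L V : Type} (d e : Pol) (a : L) (X Y : Proc S (Option (Option L))
    (Option V)) :
    Bisim D (resL (par (locPre d (some a) X) (locPre e none Y)))
      (locPre d a (resL (par (X.map swap id) (locPre e none
        (Y.map (Option.map (Option.map some)) (Option.map some)))))) := by
  refine bisim_of_steps (fun R => ⟨fun s => ?_, fun s => s.locPre_inv.elim⟩)
    (fun d' p R => ⟨fun s => ?_, fun s => ?_⟩) (fun d' p R =>
      ⟨fun s => ?_, fun s => s.locPre_inv.elim⟩)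
  · obtain ⟨R, u, rfl⟩ := s.resL_inv
    obtain ⟨_, t, rfl⟩ | ⟨_, t, rfl⟩ | ⟨_, _, _, _, t, t', rfl⟩ | ⟨_, _, _, _, t, t', rfl⟩ :=
      u.par_inv
    · exact t.locPre_inv.elim
    · exact t.locPre_inv.elim
    · obtain ⟨_, rfl, rfl⟩ := t.pre_inv
      exact nomatch t'.pre_inv.2.1
    · exact t.locPre_inv.elim
  · obtain ⟨R, u, rfl⟩ := s.resL_inv
    obtain ⟨_, t, rfl⟩ | ⟨_, t, rfl⟩ := u.par_inv
    · obtain ⟨rfl, h, rfl⟩ := t.pre_inv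
      obtain rfl := Option.some_injective _ h
      simp only [Proc.map, Proc.map_map, swap, Option.map_id, Function.id_comp, Option.map_comp_map,
        swap_comp_some]
      exact .pre
    · exact nomatch t.pre_inv.2.1
  · obtain ⟨rfl, rfl, rfl⟩ := s.pre_inv
    have := LocStep.resL (LocStep.parL (D := D) (Q := .locPre e none Y)
      (LocStep.pre (d := d') (p := some p) (P := X)))
    simpa only [Proc.map, Proc.map_map, swap, Option.map_id, Function.id_comp, Option.map_comp_map,
      swap_comp_some] using this
  · obtain ⟨R, u, rfl⟩ := s.resL_inv
    obtain ⟨_, t, rfl⟩ | ⟨_, t, rfl⟩ := u.par_inv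
    · exact t.locPre_inv.elim
    · exact t.locPre_inv.elim

theorem bisim_resV_varRep {L V : Type} (P : Proc S (Option L) (Option V)) :
    Bisim D (resV (varRep none P)) nil := by
  refine bisim_of_steps (fun R => ⟨fun s => ?_, fun s => s.nil_inv.elim⟩)
    (fun d' p R => ⟨fun s => ?_, fun s => s.nil_inv.elim⟩)
    (fun d' p R => ⟨fun s => ?_, fun s => s.nil_inv.elim⟩)
  · obtain ⟨R, u, rfl⟩ := s.resV_inv
    exact u.varRep_inv.elim
  · obtain ⟨R, u, rfl⟩ := s.resV_inv
    exact u.varRep_inv.elim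
  · obtain ⟨R, u, rfl⟩ := s.resV_inv
    exact nomatch u.rep_inv.2.1

theorem bisim_wire {L V : Type} (k : WireKind) (p q : L) :
    Bisim D (wire k p q : Proc S L V) (wireBody k p q) :=
  bisim_of_steps (fun _ => ⟨fun s => s.wire_inv, .wire⟩) (fun _ _ _ => ⟨fun s => s.wire_inv, .wire⟩)
    (fun _ _ _ => ⟨fun s => s.wire_inv, .wire⟩)

/-! ### Replicated resources -/

/-- The variable name `y` occurs in the process only as the subject of outputs. -/
inductive OutOnly : ∀ {L V : Type}, V → Proc S L V → Prop where
  | fresh {L V L' V' : Type} {f : L → L'} {g : V → V'} {y : V'} (P : Proc S L V) :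
      Function.Injective f → Function.Injective g → y ∉ Set.range g → OutOnly y (P.map f g)
  | pre {L V : Type} {y : V} {P : Proc S (Option L) V} : OutOnly y P → OutOnly y (varPre .out y P)
  | rep {L V : Type} {x y : V} {P : Proc S (Option L) V} : x ≠ y → OutOnly y P →
      OutOnly y (varRep x P)
  | par {L V : Type} {y : V} {P Q : Proc S L V} : OutOnly y P → OutOnly y Q → OutOnly y (par P Q)
  | resL {L V : Type} {y : V} {P : Proc S (Option L) V} : OutOnly y P → OutOnly y (resL P)
  | resV {L V : Type} {y : V} {P : Proc S L (Option V)} : OutOnly (some y) P → OutOnly y (resV P)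

namespace OutOnly
variable {L V : Type}

theorem map {y : V} {P : Proc S L V} (h : OutOnly y P) : ∀ {L' V' : Type} {f : L → L'} {g : V → V'},
    Function.Injective f → Function.Injective g → OutOnly (g y) (P.map f g) := by
  induction h with
  | fresh P hf hg hy =>
    intro L' V' f g hf' hg'
    rw [Proc.map_map]
    refine .fresh P (hf'.comp hf) (hg'.comp hg) ?_
    rintro ⟨x, hx⟩
    exact hy ⟨x, hg' hx⟩
  | pre _ ih => exact fun hf hg => .pre (ih (Option.map_injective hf) hg)
  | rep hxy _ ih => exact fun hf hg => .rep (hg.ne hxy) (ih (Option.map_injective hf) hg)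
  | par _ _ ih ih' => exact fun hf hg => .par (ih hf hg) (ih' hf hg)
  | resL _ ih => exact fun hf hg => .resL (ih (Option.map_injective hf) hg)
  | resV _ ih => exact fun hf hg => .resV (ih hf (Option.map_injective hg))

theorem map_swap {y : V} {P : Proc S (Option (Option L)) V} (h : OutOnly y P) :
    OutOnly y (P.map swap id) := h.map swap_injective Function.injective_id

theorem map_some_id {y : V} {P : Proc S L V} (h : OutOnly y P) : OutOnly y (P.map some id) :=
  h.map (Option.some_injective _) Function.injective_id

theorem map_some_some {y : V} {P : Proc S L V} (h : OutOnly y P) :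
    OutOnly (some y) (P.map some some) :=
  h.map (Option.some_injective _) (Option.some_injective _)

theorem locStep {y : V} {P : Proc S L V} (h : OutOnly y P) :
    ∀ {d p P'}, LocStep D d p P P' → OutOnly (some y) P' := by
  induction h with
  | fresh P hf hg hy =>
    intro d p P' s
    obtain ⟨_, P', rfl, s, rfl⟩ := s.map_inv
    refine .fresh P' (Option.map_injective hf) (Option.map_injective hg) ?_
    rintro ⟨_ | x, hx⟩
    · simp at hx
    · exact hy ⟨x, by simpa using hx⟩
  | pre => exact fun s => s.varPre_inv.elim
  | rep => exact fun s => s.varRep_inv.elim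
  | par h h' ih ih' =>
    intro d p P' s₀
    obtain ⟨_, s, rfl⟩ | ⟨_, s, rfl⟩ := s₀.par_inv
    · exact .par (ih s) h'.map_some_some
    · exact .par h.map_some_some (ih' s)
  | resL _ ih =>
    intro d p P' s₀
    obtain ⟨_, s, rfl⟩ := s₀.resL_inv
    exact .resL (ih s).map_swap
  | resV _ ih =>
    intro d p P' s₀
    obtain ⟨_, s, rfl⟩ := s₀.resV_inv
    exact .resV ((ih s).map Function.injective_id swap_injective)

theorem varStep {y : V} {P : Proc S L V} (h : OutOnly y P) :
    ∀ {d x P'}, VarStep D d x P P' → OutOnly y P' ∧ ¬ (d = .inp ∧ x = y) := by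
  induction h with
  | fresh P hf hg hy =>
    intro d p P' s
    obtain ⟨x, P', rfl, s, rfl⟩ := s.map_inv
    exact ⟨.fresh P' (Option.map_injective hf) hg hy, fun ⟨_, h⟩ => hy ⟨x, h⟩⟩
  | pre h ih =>
    intro d p P' s
    obtain ⟨rfl, rfl, rfl⟩ := s.pre_inv
    exact ⟨h, nofun⟩
  | rep hxy h ih =>
    intro d p P' s
    obtain ⟨rfl, rfl, rfl⟩ := s.rep_inv
    exact ⟨.par h (OutOnly.rep hxy h).map_some_id, fun h => hxy h.2⟩
  | par h h' ih ih' =>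
    intro d p P' s₀
    obtain ⟨_, s, rfl⟩ | ⟨_, s, rfl⟩ := s₀.par_inv
    · exact ⟨.par (ih s).1 h'.map_some_id, (ih s).2⟩
    · exact ⟨.par h.map_some_id (ih' s).1, (ih' s).2⟩
  | resL _ ih =>
    intro d p P' s₀
    obtain ⟨_, s, rfl⟩ := s₀.resL_inv
    exact ⟨.resL (ih s).1.map_swap, (ih s).2⟩
  | resV _ ih =>
    intro d p P' s₀
    obtain ⟨_, s, rfl⟩ := s₀.resV_inv
    exact ⟨.resV (ih s).1, fun h => (ih s).2 ⟨h.1, congrArg some h.2⟩⟩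

theorem tauStep {y : V} {P : Proc S L V} (h : OutOnly y P) :
    ∀ {P'}, TauStep D P P' → OutOnly y P' := by
  induction h with
  | fresh P hf hg hy =>
    intro P' s
    obtain ⟨P', s, rfl⟩ := s.map_inv hf hg
    exact .fresh P' hf hg hy
  | pre => exact fun s => s.varPre_inv.elim
  | rep => exact fun s => s.varRep_inv.elim
  | par h h' ih ih' =>
    intro P' s₀
    obtain ⟨_, s, rfl⟩ | ⟨_, s, rfl⟩ | ⟨_, _, _, _, s, s', rfl⟩ | ⟨_, _, _, _, s, s', rfl⟩ :=
      s₀.par_inv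
    · exact .par (ih s) h'
    · exact .par h (ih' s)
    · exact .resV (.resL (.par (h.locStep s) (h'.locStep s')))
    · exact .resL (.par (h.varStep s).1 (h'.varStep s').1)
  | resL _ ih =>
    intro P' s₀
    obtain ⟨_, s, rfl⟩ := s₀.resL_inv
    exact .resL (ih s)
  | resV _ ih =>
    intro P' s₀
    obtain ⟨_, s, rfl⟩ := s₀.resV_inv
    exact .resV (ih s)

end OutOnly

/-- An output at the name of a replicated resource can be performed at once, and the copy of the
resource which serves it can be moved out. -/
theorem expands_fire {L V : Type} (A Y : Proc S (Option L) V) {E : Proc S L (Option V)}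
    (hE : OutOnly none E) :
    Expands D
      (resV (par (par (varPre .out none (A.map id some)) E) (varRep none (Y.map id some))))
      (par (resL (par A Y)) (resV (par E (varRep none (Y.map id some))))) := by
  let R : Rel S := fun L V P Q => ∃ (A Y : Proc S (Option L) V) (E : Proc S L (Option V)),
    OutOnly none E ∧ P = par (resL (par A Y)) (resV (par E (varRep none (Y.map id some)))) ∧
    Q = resV (par (par (varPre .out none (A.map id some)) E) (varRep none (Y.map id some)))
  refine expands_of_upTo R ?_ (.base ⟨A, Y, E, hE, rfl, rfl⟩)
  rintro L V _ _ ⟨A, Y, E, hE, rfl, rfl⟩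
  have fire : TauStep D
      (resV (par (par (varPre .out none (A.map id some)) E) (varRep none (Y.map id some))))
      (resV (resL (par (par (A.map id some) (E.map some id))
        (par (Y.map id some) ((varRep none (Y.map id some)).map some id))))) :=
    .resV (.comVar (.parL .pre) .rep)
  -- The derivative of the call is the smaller process up to the scope of restrictions. Hence the
  -- larger process can imitate any move of the smaller one by performing the call first.
  have hb : Bisim D (par (resL (par A Y)) (resV (par E (varRep none (Y.map id some)))))
      (resV (resL (par (par (A.map id some) (E.map some id))
        (par (Y.map id some) ((varRep none (Y.map id some)).map some id))))) := by
    refine Flat.bisim_of_eq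
      (.par (.resL (.inr 0) (.par .leaf .leaf)) (.resV (.inr 0) (.par .leaf .leaf)))
      (.resV (.inr 0) (.resL (.inr 0) (.par (.par .leaf .leaf) (.par .leaf .leaf)))) ?_ ?_ ?_
    · simp [-Multiset.singleton_add]
      abel
    all_goals simp
  refine ⟨?_, ?_, ?_, ?_, ?_, ?_⟩
  · intro P' s
    obtain ⟨Q', t, b⟩ := hb.sim.tau _ s
    exact ⟨Q', .tail (.single fire) t, .bisim b (.refl _)⟩
  · intro _ _ P' s
    obtain ⟨Q', t, b⟩ := hb.sim.loc _ _ _ s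
    exact ⟨Q', ⟨_, _, .single fire, t, .refl⟩, .bisim b (.refl _)⟩
  · intro _ _ P' s
    obtain ⟨Q', t, b⟩ := hb.sim.var _ _ _ s
    exact ⟨Q', ⟨_, _, .single fire, t, .refl⟩, .bisim b (.refl _)⟩
  · intro Q' s
    obtain ⟨Q', s₁, rfl⟩ := s.resV_inv
    obtain ⟨_, s₂, rfl⟩ | ⟨_, s₂, rfl⟩ | ⟨_, _, _, _, s₂, s₃, rfl⟩ | ⟨_, _, _, _, s₂, s₃, rfl⟩ :=
      s₁.par_inv
    · obtain ⟨_, s₄, rfl⟩ | ⟨E', s₄, rfl⟩ | ⟨_, _, _, _, s₄, s₅, rfl⟩ |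
        ⟨_, _, _, _, s₄, s₅, rfl⟩ := s₂.par_inv
      · exact s₄.varPre_inv.elim
      · exact .inr ⟨_, .parR (.resV (.parL s₄)), .base ⟨A, Y, E', hE.tauStep s₄, rfl, rfl⟩⟩
      · exact s₄.varPre_inv.elim
      · obtain ⟨rfl, rfl, _⟩ := s₄.pre_inv
        -- The pending output can only meet the resource, since `E` never inputs at its name.
        exact ((hE.varStep s₅).2 ⟨rfl, rfl⟩).elim
    · exact s₂.varRep_inv.elim
    · exact s₃.varRep_inv.elim
    · obtain ⟨e, rfl, rfl⟩ := s₃.rep_inv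
      obtain ⟨_, s₄, rfl⟩ | ⟨E', s₄, rfl⟩ := s₂.par_inv
      · obtain ⟨rfl, _, rfl⟩ := s₄.pre_inv
        exact .inl (.expands (.refl _) hb.symm.expands)
      · refine .inr ⟨_, .parR (.resV (.comVar s₄ s₃)), ?_⟩
        -- When `E` itself calls the resource, the copy serving it joins the environment. The copy
        -- does not mention the resource name, so the new environment still uses that name only in
        -- output.
        have base : UpTo D R _ _ := .base ⟨A, Y, resL (par E' (Y.map id some)),
          .resL (.par (hE.varStep s₄).1 (.fresh _ Function.injective_id (Option.some_injective _)
            (by simp))), rfl, rfl⟩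
        refine .bisim ?_ (base.expands (Bisim.expands ?_))
        · refine Flat.bisim_of_eq
            (.par .leaf (.resV (.inr 0) (.resL (.inr 0) (.par .leaf (.par .leaf .leaf)))))
            (.par .leaf (.resV (.inr 0) (.par (.resL (.inr 0) (.par .leaf .leaf)) .leaf))) ?_ ?_ ?_
          · simp [-Multiset.singleton_add]
            abel
          all_goals simp
        · refine Flat.bisim_of_eq
            (.resV (.inr 0) (.resL (.inr 0) (.par (.par .leaf .leaf) (.par .leaf .leaf))))
            (.resV (.inr 0) (.par (.par .leaf (.resL (.inr 0) (.par .leaf .leaf))) .leaf)) ?_ ?_ ?_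
          · simp [-Multiset.singleton_add]
            abel
          all_goals simp
  · intro d p Q' s
    obtain ⟨Q', s₁, rfl⟩ := s.resV_inv
    obtain ⟨_, s₂, rfl⟩ | ⟨_, s₂, rfl⟩ := s₁.par_inv
    · obtain ⟨_, s₃, rfl⟩ | ⟨E', s₃, rfl⟩ := s₂.par_inv
      · exact s₃.varPre_inv.elim
      · refine ⟨_, .parR (.resV (.parL s₃)), .base ⟨A.map (Option.map some) some,
          Y.map (Option.map some) some, E'.map id swap,
          (hE.locStep s₃).map Function.injective_id swap_injective, ?_, ?_⟩⟩
        · simp [swap]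
        · simp [swap]
    · exact s₂.varRep_inv.elim
  · intro d x Q' s
    obtain ⟨Q', s₁, rfl⟩ := s.resV_inv
    obtain ⟨_, s₂, rfl⟩ | ⟨_, s₂, rfl⟩ := s₁.par_inv
    · obtain ⟨_, s₃, rfl⟩ | ⟨E', s₃, rfl⟩ := s₂.par_inv
      · exact nomatch s₃.pre_inv.2.1
      · refine ⟨_, .parR (.resV (.parL s₃)), .base ⟨A.map (Option.map some) id,
          Y.map (Option.map some) id, E', (hE.varStep s₃).1, ?_, ?_⟩⟩
        · simp
        · simp
    · exact nomatch s₂.rep_inv.2.1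

/-- The composition of a replicated forwarder with a replicated resource. -/
theorem expands_rep {L V : Type} (k : WireKind) (x : V) (X : Proc S (Option (Option L)) V)
    (Y : Proc S (Option L) V) :
    Expands D
      (resV (par
        (varRep (some x) (permVar (fun a b => wire k a b) .out none (X.map id some)))
        (varRep none (Y.map id some))))
      (varRep x (resL (par X (resL (par (wire k (some none) none)
        (Y.map (Option.map (some ∘ some)) id)))))) := by
  let R : Rel S := fun L V P Q => ∃ (x : V) (X : Proc S (Option (Option L)) V)
    (Y : Proc S (Option L) V), P = varRep x (resL (par X (resL (par (wire k (some none) none)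
        (Y.map (Option.map (some ∘ some)) id))))) ∧
      Q = resV (par
        (varRep (some x) (permVar (fun a b => wire k a b) .out none (X.map id some)))
        (varRep none (Y.map id some)))
  refine expands_of_upTo R ?_ (.base ⟨x, X, Y, rfl, rfl⟩)
  rintro L V _ _ ⟨x, X, Y, rfl, rfl⟩
  -- After the input, a copy of the forwarder calls the resource while the forwarder itself
  -- persists. `expands_fire` performs the call at once, with the persisting forwarder as
  -- environment, and what stays behind is the original pair.
  have key : UpTo D R
      (par (resL (par X (resL (par (wire k (some none) none)
        (Y.map (Option.map (some ∘ some)) id)))))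
        ((varRep x (resL (par X (resL (par (wire k (some none) none)
        (Y.map (Option.map (some ∘ some)) id)))))).map some id))
      (resV (par (par (permVar (fun a b => wire k a b) .out none (X.map id some))
        ((varRep (some x) (permVar (fun a b => wire k a b) .out none (X.map id some))).map some id))
        ((varRep none (Y.map id some)).map some id))) := by
    refine ((UpTo.refl _).par (.map (Option.some_injective _) Function.injective_id
      (.base ⟨x, X, Y, rfl, rfl⟩))).expands ?_
    have fire := expands_fire (D := D) (A := wire k (some none) none)
      (Y := Y.map (Option.map (some ∘ some)) id) (E := (varRep (some x)
        (permVar (fun a b => wire k a b) .out none (X.map id some))).map (some ∘ some) id)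
        (.rep (by simp) (.resL (.par (.pre ?_) ?_)))
    · refine (Bisim.expands ?_).trans ((((Expands.refl X).par fire).resL).trans (Bisim.expands ?_))
      · refine Flat.bisim_of_eq
          (.resV (.inr 0) (.par (.par (.resL (.inr 0) (.par .leaf .leaf)) .leaf) .leaf))
          (.resL (.inr 0) (.par .leaf (.resV (.inr 0) (.par (.par .leaf .leaf) .leaf)))) ?_ ?_ ?_
        · simp [-Multiset.singleton_add]
          abel
        all_goals simp
      · refine Flat.bisim_of_eq
          (.resL (.inr 0) (.par .leaf (.par (.resL (.inr 1) (.par .leaf .leaf))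
            (.resV (.inr 0) (.par .leaf .leaf)))))
          (.par (.resL (.inr 0) (.par .leaf (.resL (.inr 1) (.par .leaf .leaf))))
            (.resV (.inr 0) (.par .leaf .leaf))) ?_ ?_ ?_
        · simp [-Multiset.singleton_add]
          abel
        all_goals simp
    · have := OutOnly.fresh (f := id) (g := some) (y := (none : Option V))
        (wire k (some none) none : Proc S (Option (Option (Option (Option (Option L))))) V)
        Function.injective_id (Option.some_injective _) (by simp)
      simpa using this
    · have i : Function.Injective (Option.map (Option.map (some ∘ some : L → _))) :=
        Option.map_injective (Option.map_injective
          ((Option.some_injective _).comp (Option.some_injective _)))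
      have := OutOnly.fresh (y := (none : Option V)) X i (Option.some_injective _) (by simp)
      simpa using this
  refine ⟨?_, ?_, ?_, ?_, ?_, ?_⟩
  · exact fun _ s => s.varRep_inv.elim
  · exact fun _ _ _ s => s.varRep_inv.elim
  · intro d y P' s
    obtain ⟨rfl, rfl, rfl⟩ := s.rep_inv
    exact ⟨_, (VarStep.resV (.parL .rep)).weak, key⟩
  · intro Q' s
    obtain ⟨Q', s₁, rfl⟩ := s.resV_inv
    obtain ⟨_, s₂, rfl⟩ | ⟨_, s₂, rfl⟩ | ⟨_, _, _, _, s₂, s₃, rfl⟩ | ⟨_, _, _, _, s₂, s₃, rfl⟩ :=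
      s₁.par_inv
    · exact s₂.varRep_inv.elim
    · exact s₂.varRep_inv.elim
    · exact s₂.varRep_inv.elim
    · obtain ⟨rfl, -, -⟩ := s₂.rep_inv
      exact nomatch s₃.rep_inv.1
  · intro d p Q' s
    obtain ⟨Q', s₁, rfl⟩ := s.resV_inv
    obtain ⟨_, s₂, rfl⟩ | ⟨_, s₂, rfl⟩ := s₁.par_inv
    · exact s₂.varRep_inv.elim
    · exact s₂.varRep_inv.elim
  · intro d y Q' s
    obtain ⟨Q', s₁, rfl⟩ := s.resV_inv
    obtain ⟨_, s₂, rfl⟩ | ⟨_, s₂, rfl⟩ := s₁.par_inv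
    · obtain ⟨rfl, h, rfl⟩ := s₂.rep_inv
      obtain rfl := Option.some_injective _ h
      exact ⟨_, .rep, key⟩
    · exact nomatch s₂.rep_inv.2.1

/-! ### Trees of wires -/

/-- Binary trees, as shapes of compositions of wires. -/
inductive Tree where
  | leaf : Tree
  | node (s t : Tree) : Tree

/-- The composition of location wires with a given shape. -/
def locTree (S : Sig) (k : WireKind) : Tree → {L V : Type} → L → L → Proc S L V
  | .leaf, _, _, a, b => wire k a b
  | .node s t, _, _, a, b => resL (par (locTree S k s (some a) none) (locTree S k t none (some b)))

/-- The composition of variable wires with a given shape. -/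
def varTree (S : Sig) (k : WireKind) : Tree → {L V : Type} → V → V → Proc S L V
  | .leaf, _, _, a, b => varWire k a b
  | .node s t, _, _, a, b => resV (par (varTree S k s (some a) none) (varTree S k t none (some b)))

@[simp] theorem map_locTree (k : WireKind) (t : Tree) {L V L' V' : Type} (f : L → L') (g : V → V')
    (a b : L) : (locTree S k t a b).map f g = locTree S k t (f a) (f b) := by
  induction t generalizing L V L' V' with
  | leaf => rfl
  | node s t ih ih' => simp [locTree, ih, ih']

@[simp] theorem map_varTree (k : WireKind) (t : Tree) {L V L' V' : Type} (f : L → L') (g : V → V')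
    (a b : V) : (varTree S k t a b).map f g = varTree S k t (g a) (g b) := by
  induction t generalizing L V L' V' with
  | leaf => simp [varTree]
  | node s t ih ih' => simp [varTree, ih, ih']

/-- Permeable prefixes over the concrete wires. -/
abbrev perm (k : WireKind) {L V : Type} (d : Pol) (p : L) (P : Proc S (Option L) (Option V)) :
    Proc S L V :=
  permLoc (fun a b => wire k a b) (fun a b => varWire k a b) d p P

/-- The processes `A` and `B`, which have received the bound names `x₁, q₁` and `x, r`, with
connections from `x` to `x₁` and from `q₁` to `r`. -/
abbrev linked (k : WireKind) (s t : Tree) {L V : Type} (A B : Proc S (Option L) (Option V)) :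
    Proc S L V :=
  resV (resL (resV (resL (par
    (par (A.map some some) (B.map (Option.map some) (Option.map some)))
    (par (varTree S k t none (some none)) (locTree S k s (some none) none))))))

/-- Only the output is permeable, so one wire is left for each transmitted name. The body `A` is not
guarded; it is first moved out of the scope of the subject, which leaves the two plain prefixes to
communicate. -/
theorem expands_com_perm_pre (k : WireKind) {L V : Type} (A B : Proc S (Option L) (Option V)) :
    Expands D (resL (par (perm k .out none (A.map (Option.map some) id))
      (locPre .inp none (B.map (Option.map some) id)))) (linked k .leaf .leaf A B) := by
  have com := expands_com (D := D) .out
    (par (varWire k none (some none)) (wire k (some none) none))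
    (B.map (Option.map some) (Option.map some))
  refine (Bisim.expands ?_).trans ((((com.par (.refl A)).resL).resV).trans (Bisim.expands ?_))
  · refine Flat.bisim_of_eq
      (.resL (.inr 0) (.par (.resV (.inr 0) (.resL (.inr 1) (.par .leaf .leaf))) .leaf))
      (.resV (.inr 0) (.resL (.inr 1) (.par (.resL (.inr 0) (.par .leaf .leaf)) .leaf))) ?_ ?_ ?_
    · simp [-Multiset.singleton_add]
      abel
    all_goals simp
  · refine Flat.bisim_of_eq
      (.resV (.inr 0) (.resL (.inr 0) (.par (.resV (.inr 1) (.resL (.inr 1)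
        (.par (.par .leaf .leaf) .leaf))) .leaf)))
      (.resV (.inr 0) (.resL (.inr 0) (.resV (.inr 1) (.resL (.inr 1)
        (.par (.par .leaf .leaf) (.par .leaf .leaf)))))) ?_ ?_ ?_
    · simp [-Multiset.singleton_add, locTree, varTree]
      abel
    all_goals simp

theorem expands_com_pre_perm (k : WireKind) {L V : Type} (A B : Proc S (Option L) (Option V)) :
    Expands D (resL (par (locPre .out none (A.map (Option.map some) id))
      (perm k .inp none (B.map (Option.map some) id)))) (linked k .leaf .leaf A B) := by
  have com := expands_com (D := D) .out
    (A.map (Option.map some) (Option.map some))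
    (par (varWire k (some none) none) (wire k none (some none)))
  refine (Bisim.expands ?_).trans ((((com.par (.refl B)).resL).resV).trans (Bisim.expands ?_))
  · refine Flat.bisim_of_eq
      (.resL (.inr 0) (.par .leaf (.resV (.inr 0) (.resL (.inr 1) (.par .leaf .leaf)))))
      (.resV (.inr 0) (.resL (.inr 1) (.par (.resL (.inr 0) (.par .leaf .leaf)) .leaf))) ?_ ?_ ?_
    · simp [-Multiset.singleton_add, Pol.dual]
      abel
    all_goals simp
  · refine Flat.bisim_of_eq
      (.resV (.inr 0) (.resL (.inr 0) (.par (.resV (.inr 1) (.resL (.inr 1)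
        (.par .leaf (.par .leaf .leaf)))) .leaf)))
      (.resV (.inr 1) (.resL (.inr 1) (.resV (.inr 0) (.resL (.inr 0)
        (.par (.par .leaf .leaf) (.par .leaf .leaf)))))) ?_ ?_ ?_
    · simp [-Multiset.singleton_add, locTree, varTree]
      abel
    all_goals simp

/-- Each of the two permeable prefixes contributes one wire for every transmitted name, whence the
connections of length two. Both bodies stay outside the communication. -/
theorem expands_com_perm_perm (k : WireKind) {L V : Type} (A B : Proc S (Option L) (Option V)) :
    Expands D (resL (par (perm k .out none (A.map (Option.map some) id))
      (perm k .inp none (B.map (Option.map some) id))))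
      (linked k (.node .leaf .leaf) (.node .leaf .leaf) A B) := by
  have com := expands_com (D := D) .out
    (par (varWire k none (some (some none))) (wire k (some (some none)) none) :
      Proc S (Option (Option (Option L))) (Option (Option (Option V))))
    (par (varWire k (some none) none) (wire k none (some none)))
  refine (Bisim.expands ?_).trans (((((((com.par (.refl (par (A.map some some)
    (B.map (Option.map some)
      (Option.map some))))).resL).resV)).resL).resV).trans (Bisim.expands ?_))
  · refine Flat.bisim_of_eq
      (.resL (.inr 0) (.par (.resV (.inr 0) (.resL (.inr 1) (.par .leaf .leaf)))
        (.resV (.inr 1) (.resL (.inr 2) (.par .leaf .leaf)))))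
      (.resV (.inr 0) (.resL (.inr 1) (.resV (.inr 1) (.resL (.inr 2)
        (.par (.resL (.inr 0) (.par .leaf .leaf)) (.par .leaf .leaf)))))) ?_ ?_ ?_
    · simp [-Multiset.singleton_add, Pol.dual]
      abel
    all_goals simp
  · refine Flat.bisim_of_eq
      (.resV (.inr 0) (.resL (.inr 0) (.resV (.inr 1) (.resL (.inr 1) (.par
        (.resV (.inr 2) (.resL (.inr 2) (.par (.par .leaf .leaf) (.par .leaf .leaf))))
        (.par .leaf .leaf))))))
      (.resV (.inr 0) (.resL (.inr 0) (.resV (.inr 1) (.resL (.inr 1)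
        (.par (.par .leaf .leaf) (.par (.resV (.inr 2) (.par .leaf .leaf))
        (.resL (.inr 2) (.par .leaf .leaf)))))))) ?_ ?_ ?_
    · simp [-Multiset.singleton_add, locTree, varTree]
      abel
    all_goals simp

/-! ### Unguarded subjects -/

namespace Proc

/-- The location name `p` is the subject of an unguarded prefix with polarity `d`, as far as can be
told without unfolding constants of the signature. -/
def ActL {L V : Type} (d : Pol) (p : L) : Proc S L V → Prop
  | nil => False
  | locPre e q _ => d = e ∧ p = q
  | varPre _ _ _ => False
  | locRep q _ => d = .inp ∧ p = q
  | varRep _ _ => False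
  | par P Q => P.ActL d p ∨ Q.ActL d p
  | resL P => P.ActL d (some p)
  | resV P => P.ActL d p
  | wire _ a b => d = .inp ∧ p = a ∨ d = .out ∧ p = b
  | call _ _ _ => True

/-- The same for a variable name. -/
def ActV {L V : Type} (d : Pol) (x : V) : Proc S L V → Prop
  | nil => False
  | locPre _ _ _ => False
  | varPre e y _ => d = e ∧ x = y
  | locRep _ _ => False
  | varRep y _ => d = .inp ∧ x = y
  | par P Q => P.ActV d x ∨ Q.ActV d x
  | resL P => P.ActV d x
  | resV P => P.ActV d (some x)
  | wire _ _ _ => False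
  | call _ _ _ => True

/-- No two unguarded prefixes can communicate. -/
def Quiet {L V : Type} : Proc S L V → Prop
  | nil => True
  | locPre _ _ _ => True
  | varPre _ _ _ => True
  | locRep _ _ => True
  | varRep _ _ => True
  | par P Q => P.Quiet ∧ Q.Quiet ∧ (∀ d p, P.ActL d p → ¬ Q.ActL d.dual p) ∧
      ∀ d x, P.ActV d x → ¬ Q.ActV d.dual x
  | resL P => P.Quiet
  | resV P => P.Quiet
  | wire _ a b => a ≠ b
  | call _ _ _ => False

end Proc

theorem actL_wireBody {k : WireKind} {L V : Type} {d : Pol} {p a b : L}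
    (h : (wireBody k a b : Proc S L V).ActL d p) : d = .inp ∧ p = a ∨ d = .out ∧ p = b := by
  cases k <;> simp [wireBody, permLoc, ActL, varWire] at h <;> tauto

theorem actV_wireBody {k : WireKind} {L V : Type} {d : Pol} {x : V} {a b : L}
    (h : (wireBody k a b : Proc S L V).ActV d x) : False := by
  cases k <;> simp [wireBody, permLoc, ActV, varWire] at h

theorem LocStep.actL {L V : Type} {d : Pol} {p : L} {P : Proc S L V} {P'}
    (h : LocStep D d p P P') : P.ActL d p := by
  induction h with
  | pre => exact ⟨rfl, rfl⟩
  | rep => exact ⟨rfl, rfl⟩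
  | parL _ ih => exact .inl ih
  | parR _ ih => exact .inr ih
  | resL _ ih => exact ih
  | resV _ ih => exact ih
  | wire _ ih => exact actL_wireBody ih
  | call => trivial

theorem VarStep.actV {L V : Type} {d : Pol} {p : V} {P : Proc S L V} {P'}
    (h : VarStep D d p P P') : P.ActV d p := by
  induction h with
  | pre => exact ⟨rfl, rfl⟩
  | rep => exact ⟨rfl, rfl⟩
  | parL _ ih => exact .inl ih
  | parR _ ih => exact .inr ih
  | resL _ ih => exact ih
  | resV _ ih => exact ih
  | wire _ ih => exact actV_wireBody ih
  | call => trivial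

/-- For the guarded classes there is nothing to check. In the class P the input at `a` and the
output at `b` are both unguarded, and they could communicate only if the ends coincided. -/
theorem quiet_wireBody (k : WireKind) {L V : Type} {a b : L} (h : a ≠ b) :
    (wireBody k a b : Proc S L V).Quiet := by
  cases k
  · trivial
  · trivial
  · simp only [wireBody, permLoc, Quiet, varWire, ActL, ActV, true_and]
    refine ⟨⟨⟨nofun, ?_, ?_⟩, ?_, ?_⟩, ?_, ?_⟩
    · rintro (_ | _) p <;> simp
    · rintro (_ | _) p <;> simp
    · rintro (_ | _) p <;> simp [Pol.dual]
      rintro rfl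
      simp
    · rintro (_ | _) p <;> simp
    · rintro (_ | _) p <;> simp [Pol.dual]
      rintro rfl
      simpa using h
    · rintro (_ | _) p <;> simp

/-- The induction goes through the recursive constants because `Quiet` survives the unfolding of
wires and excludes all other constants. -/
theorem TauStep.not_quiet {L V : Type} {P P' : Proc S L V} (h : TauStep D P P') : ¬ P.Quiet := by
  induction h with
  | comLoc h h' => exact fun q => q.2.2.1 _ _ h.actL h'.actL
  | comVar h h' => exact fun q => q.2.2.2 _ _ h.actV h'.actV
  | parL _ ih => exact fun q => ih q.1
  | parR _ ih => exact fun q => ih q.2.1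
  | resL _ ih => exact ih
  | resV _ ih => exact ih
  | wire _ ih => exact fun q => ih (quiet_wireBody _ q)
  | call => exact id

theorem actL_locTree {k : WireKind} {t : Tree} {L V : Type} {d : Pol} {p a b : L}
    (h : (locTree S k t a b : Proc S L V).ActL d p) : d = .inp ∧ p = a ∨ d = .out ∧ p = b := by
  induction t generalizing L V with
  | leaf => exact h
  | node s t ih ih' =>
    obtain h | h := h
    · obtain h | h := ih h
      · exact .inl ⟨h.1, Option.some_injective _ h.2⟩
      · exact nomatch h.2
    · obtain h | h := ih' h
      · exact nomatch h.2
      · exact .inr ⟨h.1, Option.some_injective _ h.2⟩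

theorem actV_locTree {k : WireKind} {t : Tree} {L V : Type} {d : Pol} {x : V} {a b : L} :
    ¬ (locTree S k t a b : Proc S L V).ActV d x := by
  induction t generalizing L V with
  | leaf => exact id
  | node s t ih ih' => exact fun h => h.elim ih ih'

theorem actV_varTree {k : WireKind} {t : Tree} {L V : Type} {d : Pol} {x y z : V}
    (h : (varTree S k t x y : Proc S L V).ActV d z) : d = .inp ∧ z = x := by
  induction t generalizing L V with
  | leaf => exact h
  | node s t ih ih' =>
    obtain h | h := h
    · exact ⟨(ih h).1, Option.some_injective _ (ih h).2⟩
    · exact nomatch (ih' h).2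

theorem actL_varTree {k : WireKind} {t : Tree} {L V : Type} {d : Pol} {p : L} {x y : V} :
    ¬ (varTree S k t x y : Proc S L V).ActL d p := by
  induction t generalizing L V with
  | leaf => exact id
  | node s t ih ih' => exact fun h => h.elim ih ih'

/-- All components are replicated inputs, with outputs only below them, and nothing can communicate.
-/
theorem quiet_varTree (k : WireKind) (t : Tree) {L V : Type} (x y : V) :
    (varTree S k t x y : Proc S L V).Quiet := by
  induction t generalizing L V with
  | leaf => trivial
  | node s t ih ih' =>
    refine ⟨ih _ _, ih' _ _, fun d p h => (actL_varTree h).elim, fun d z h h' => ?_⟩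
    obtain ⟨-, rfl⟩ := actV_varTree h
    exact nomatch (actV_varTree h').2

/-! ### Unfolding of trees of wires -/

/-- The body of a location wire, with trees of wires for the two wires in the continuation. -/
def treeBody (S : Sig) (k : WireKind) (s t : Tree) {L V : Type} (p q : L) : Proc S L V :=
  match k with
  | .io => locPre .inp p (perm .io .out (some q)
      (par (locTree S .io s (some none) none) (varTree S .io t none (some none))))
  | .oi => locPre .out q (perm .oi .inp (some p)
      (par (locTree S .oi s none (some none)) (varTree S .oi t (some none) none)))
  | .par => perm .par .inp p (perm .par .out (some q)
      (par (locTree S .par s (some none) none) (varTree S .par t none (some none))))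

/-- The body of a variable wire, with a tree of wires for the wire in the continuation. -/
def varTreeBody (S : Sig) (k : WireKind) (s : Tree) {L V : Type} (x y : V) : Proc S L V :=
  varRep x (permVar (fun p q => wire k p q) .out y (locTree S k s (some none) none))

theorem treeBody_leaf (k : WireKind) {L V : Type} (p q : L) :
    (treeBody S k .leaf .leaf p q : Proc S L V) = wireBody k p q := by
  cases k <;> rfl

/-- Composing two bodies is an instance of `expands_rep`: the first forwards to the second. The
location links of both are joined by the wire of the permeable output between them, which gives the
new tree. -/
theorem varTree_expands (k : WireKind) (t : Tree) : ∃ s : Tree, ∀ {L V : Type} (x y : V),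
    Expands D (varTree S k t x y : Proc S L V) (varTreeBody S k s x y) := by
  induction t with
  | leaf => exact ⟨.leaf, fun x y => .refl _⟩
  | node t₁ t₂ ih₁ ih₂ =>
    obtain ⟨s₁, ih₁⟩ := ih₁
    obtain ⟨s₂, ih₂⟩ := ih₂
    refine ⟨.node (.node s₁ .leaf) s₂, fun {L V} x y =>
      ((ih₁ _ _).par (ih₂ _ _)).resV.trans (Expands.trans (Q := varRep x ?_) ?_
        (Expands.varRep (Bisim.expands ?_) x))⟩
    · exact resL (par (locTree S k s₁ (some none) none) (resL (par (wire k (some none) none)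
        (permVar (fun p q => wire k p q) .out y (locTree S k s₂ (some none) none)))))
    · simpa [varTreeBody] using expands_rep (D := D) k x
        (locTree S k s₁ (some none) none : Proc S (Option (Option L)) V)
        (permVar (fun p q => wire k p q) .out y (locTree S k s₂ (some none) none))
    · refine Flat.bisim_of_eq
        (.resL (.inr 0) (.par .leaf (.resL (.inr 1) (.par .leaf (.resL (.inr 2)
          (.par .leaf .leaf))))))
        (.resL (.inr 2) (.par .leaf (.resL (.inr 1) (.par (.resL (.inr 0) (.par .leaf .leaf))
          .leaf)))) ?_ ?_ ?_
      · simp [-Multiset.singleton_add, locTree]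
        abel
      all_goals simp

/-- The second wire waits at the restricted name, so the input at `a` comes to the front. Below it,
the permeable output of the first wire meets the input of the second, and the permeable output at
`c` floats out. Variable links run opposite to location links, hence the reversed order of `t₁` and
`t₂`. -/
theorem treeBody_comp_io (s₁ t₁ s₂ t₂ : Tree) {L V : Type} (a c : L) :
    Expands D (resL (par (treeBody S .io s₁ t₁ (some a) none)
      (treeBody S .io s₂ t₂ none (some c))) : Proc S L V)
      (treeBody S .io (.node (.node s₁ .leaf) s₂) (.node (.node t₂ .leaf) t₁) a c) := by
  refine (bisim_resL_pre ..).expands.trans (Expands.locPre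
    (Expands.trans (Q := ?_) ?_ (Bisim.expands ?_)) _ _)
  · exact linked .io .leaf .leaf
      (par (locTree S .io s₁ (some none) none) (varTree S .io t₁ none (some none)))
      (perm .io .out (some (some c))
        (par (locTree S .io s₂ (some none) none) (varTree S .io t₂ none (some none))))
  · simpa [swap] using expands_com_perm_pre (D := D) .io
      (par (locTree S .io s₁ (some none) none) (varTree S .io t₁ none (some none)) :
        Proc S (Option (Option L)) (Option (Option V)))
      (perm .io .out (some (some c))
        (par (locTree S .io s₂ (some none) none) (varTree S .io t₂ none (some none))))
  · refine Flat.bisim_of_eq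
      (.resV (.inr 0) (.resL (.inr 0) (.resV (.inr 1) (.resL (.inr 1) (.par
        (.par (.par .leaf .leaf) (.resV (.inr 2) (.resL (.inr 2) (.par .leaf (.par .leaf .leaf)))))
        (.par .leaf .leaf))))))
      (.resV (.inr 2) (.resL (.inr 2) (.par .leaf (.par
        (.resL (.inr 1) (.par (.resL (.inr 0) (.par .leaf .leaf)) .leaf))
        (.resV (.inr 0) (.par (.resV (.inr 1) (.par .leaf .leaf)) .leaf)))))) ?_ ?_ ?_
    · simp [-Multiset.singleton_add, locTree, varTree]
      abel
    all_goals simp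

theorem treeBody_comp_oi (s₁ t₁ s₂ t₂ : Tree) {L V : Type} (a c : L) :
    Expands D (resL (par (treeBody S .oi s₁ t₁ (some a) none)
      (treeBody S .oi s₂ t₂ none (some c))) : Proc S L V)
      (treeBody S .oi (.node (.node s₁ .leaf) s₂) (.node (.node t₂ .leaf) t₁) a c) := by
  -- Here the prefix that comes to the front is the output at `c`, in the second wire; the
  -- components are exchanged to fit `bisim_resL_pre`.
  have comm : Bisim D (resL (par (treeBody S .oi s₁ t₁ (some a) none)
      (treeBody S .oi s₂ t₂ none (some c))) : Proc S L V) (resL (par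
      (treeBody S .oi s₂ t₂ none (some c)) (treeBody S .oi s₁ t₁ (some a) none))) := by
    refine Flat.bisim_of_eq (.resL (.inr 0) (.par .leaf .leaf)) (.resL (.inr 0) (.par .leaf .leaf))
      (add_comm _ _) ?_ ?_ <;> simp
  refine comm.expands.trans ((bisim_resL_pre ..).expands.trans
    (Expands.locPre (Expands.trans (Q := ?_) ?_ (Bisim.expands ?_)) _ _))
  · exact linked .oi .leaf .leaf
      (perm .oi .inp (some (some a))
        (par (locTree S .oi s₁ none (some none)) (varTree S .oi t₁ (some none) none)))
      (par (locTree S .oi s₂ none (some none)) (varTree S .oi t₂ (some none) none))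
  · have comm : Bisim D (resL (par
      (perm .oi .inp none
        (par (locTree S .oi s₂ none (some (some none))) (varTree S .oi t₂ (some none) none)))
      (locPre .out none (perm .oi .inp (some (some (some a)))
        (par (locTree S .oi s₁ none (some none)) (varTree S .oi t₁ (some none) none)))))
       : Proc S (Option L) (Option V)) (resL (par
      (locPre .out none (perm .oi .inp (some (some (some a)))
        (par (locTree S .oi s₁ none (some none)) (varTree S .oi t₁ (some none) none))))
      (perm .oi .inp none
        (par (locTree S .oi s₂ none (some (some none))) (varTree S .oi t₂ (some none) none))))) := by
      refine Flat.bisim_of_eq (.resL (.inr 0) (.par .leaf .leaf))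
        (.resL (.inr 0) (.par .leaf .leaf)) (add_comm _ _) ?_ ?_ <;> simp
    have com := expands_com_pre_perm (D := D) .oi
      (perm .oi .inp (some (some a))
        (par (locTree S .oi s₁ none (some none)) (varTree S .oi t₁ (some none) none)))
      (par (locTree S .oi s₂ none (some none)) (varTree S .oi t₂ (some none) none) :
        Proc S (Option (Option L)) (Option (Option V)))
    simp at com
    simpa [swap] using comm.expands.trans com
  · refine Flat.bisim_of_eq
      (.resV (.inr 0) (.resL (.inr 0) (.resV (.inr 1) (.resL (.inr 1) (.par
        (.par (.resV (.inr 2) (.resL (.inr 2) (.par .leaf (.par .leaf .leaf)))) (.par .leaf .leaf))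
        (.par .leaf .leaf))))))
      (.resV (.inr 2) (.resL (.inr 2) (.par .leaf (.par
        (.resL (.inr 1) (.par (.resL (.inr 0) (.par .leaf .leaf)) .leaf))
        (.resV (.inr 0) (.par (.resV (.inr 1) (.par .leaf .leaf)) .leaf)))))) ?_ ?_ ?_
    · simp [-Multiset.singleton_add, locTree, varTree]
      abel
    all_goals simp

/-! ### Wires of the parallel class -/

/-- The shape of the body of a parallel location wire. -/
abbrev parForm {L V : Type} (G H : Proc S (Option L) (Option V))
    (X Y : Proc S (Option (Option L)) (Option (Option V))) : Proc S L V :=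
  resV (resL (par G (resV (resL (par (H.map (Option.map some) (Option.map some)) (par X Y))))))

/-- The input prefix at `a` of a parallel location wire. -/
abbrev inPre (S : Sig) {L V : Type} (a : L) : Proc S (Option L) (Option V) :=
  locPre .inp (some a) (par (varWire .par (some none) none) (wire .par none (some none)))

/-- The output prefix at `c` of a parallel location wire. -/
abbrev outPre (S : Sig) {L V : Type} (c : L) : Proc S (Option L) (Option V) :=
  locPre .out (some c) (par (varWire .par none (some none)) (wire .par (some none) none))

/-- What remains of the input prefix of a parallel location wire. -/
abbrev inPost (S : Sig) (L V : Type) : Proc S (Option (Option L)) (Option (Option V)) :=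
  par (varWire .par none (some none)) (wire .par (some none) none)

/-- What remains of the output prefix of a parallel location wire. -/
abbrev outPost (S : Sig) (L V : Type) : Proc S (Option (Option L)) (Option (Option V)) :=
  par (varWire .par (some none) none) (wire .par none (some none))

/-- The two trees in the body of a parallel location wire. -/
abbrev parTree (S : Sig) (L V : Type) (G H : Proc S (Option L) (Option V)) (s t : Tree) :
  Proc S L V :=
  parForm G H (locTree S .par s (some none) none) (varTree S .par t none (some none))

theorem treeBody_par (s t : Tree) {L V : Type} (a c : L) :
    (treeBody S .par s t a c : Proc S L V) = parTree S L V (inPre S a) (outPre S c) s t := by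
  simp [treeBody, permLoc]

/-- No prefix guards the communication at the middle name, so it can be performed at once. The outer
parts `G` and `H` take no part in it; they are arbitrary in order to cover wires whose outer prefix
has already fired. -/
theorem parTree_comp (s₁ t₁ s₂ t₂ : Tree) {L V : Type} (G H : Proc S (Option L) (Option V)) :
    Expands D (resL (par
      (parTree S (Option L) V (G.map (Option.map some) id) (outPre S none) s₁ t₁)
      (parTree S (Option L) V (inPre S none) (H.map (Option.map some) id) s₂ t₂)))
      (parTree S L V G H (.node (.node s₁ (.node .leaf .leaf)) s₂)
        (.node (.node t₂ (.node .leaf .leaf)) t₁)) := by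
  have com := expands_com_perm_perm (D := D) .par
      (par (locTree S .par s₁ (some (some none)) none) (varTree S .par t₁ none (some (some none))) :
        Proc S (Option (Option (Option L))) (Option (Option (Option V))))
      (par (locTree S .par s₂ none (some none)) (varTree S .par t₂ (some none) none))
  refine (Bisim.expands ?_).trans (((((((com.par (.refl (par (G.map some some)
    (H.map (Option.map some)
      (Option.map some))))).resL).resV)).resL).resV).trans (Bisim.expands ?_))
  · refine Flat.bisim_of_eq
      (.resL (.inr 0) (.par
        (.resV (.inr 0) (.resL (.inr 1) (.par .leaf
          (.resV (.inr 1) (.resL (.inr 2) (.par .leaf (.par .leaf .leaf)))))))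
        (.resV (.inr 2) (.resL (.inr 3) (.par .leaf
          (.resV (.inr 3) (.resL (.inr 4) (.par .leaf (.par .leaf .leaf)))))))))
      (.resV (.inr 0) (.resL (.inr 1) (.resV (.inr 3) (.resL (.inr 4) (.par
        (.resL (.inr 0) (.par
          (.resV (.inr 1) (.resL (.inr 2) (.par .leaf (.par .leaf .leaf))))
          (.resV (.inr 2) (.resL (.inr 3) (.par .leaf (.par .leaf .leaf))))))
        (.par .leaf .leaf)))))) ?_ ?_ ?_
    · simp [-Multiset.singleton_add]
      abel
    all_goals simp
  · refine Flat.bisim_of_eq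
      (.resV (.inr 0) (.resL (.inr 1) (.resV (.inr 3) (.resL (.inr 4) (.par
        (.resV (.inr 1) (.resL (.inr 2) (.resV (.inr 2) (.resL (.inr 3)
          (.par (.par (.par .leaf .leaf) (.par .leaf .leaf)) (.par .leaf .leaf))))))
        (.par .leaf .leaf))))))
      (.resV (.inr 0) (.resL (.inr 1) (.par .leaf (.resV (.inr 3) (.resL (.inr 4) (.par .leaf (.par
        (.resL (.inr 3) (.par (.resL (.inr 2) (.par .leaf .leaf)) .leaf))
        (.resV (.inr 1) (.par (.resV (.inr 2) (.par .leaf .leaf)) .leaf))))))))) ?_ ?_ ?_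
    · simp [-Multiset.singleton_add, locTree, varTree]
      abel
    all_goals simp

theorem treeBody_comp (k : WireKind) (s₁ t₁ s₂ t₂ : Tree) : ∃ s t : Tree, ∀ {L V : Type} (a c : L),
    Expands D (resL (par (treeBody S k s₁ t₁ (some a) none)
      (treeBody S k s₂ t₂ none (some c))) : Proc S L V) (treeBody S k s t a c) := by
  cases k
  · exact ⟨_, _, treeBody_comp_io s₁ t₁ s₂ t₂⟩
  · exact ⟨_, _, treeBody_comp_oi s₁ t₁ s₂ t₂⟩
  · refine ⟨.node (.node s₁ (.node .leaf .leaf)) s₂, .node (.node t₂ (.node .leaf .leaf)) t₁,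
      fun {L V} a c => ?_⟩
    have := parTree_comp (D := D) s₁ t₁ s₂ t₂ (inPre S a : Proc S (Option L) (Option V)) (outPre S
      c)
    rw [treeBody_par, treeBody_par, treeBody_par]
    simpa using this

/-- A leaf unfolds to its body, and a node is treated by unfolding both halves and composing the
bodies. The resulting trees do not depend on the names, so one choice serves in every context. -/
theorem locTree_expands (k : WireKind) (u : Tree) : ∃ s t : Tree, ∀ {L V : Type} (a c : L),
    Expands D (locTree S k u a c : Proc S L V) (treeBody S k s t a c) := by
  induction u with
  | leaf =>
    refine ⟨.leaf, .leaf, fun a c => ?_⟩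
    rw [treeBody_leaf]
    exact (bisim_wire k a c).expands
  | node u₁ u₂ ih₁ ih₂ =>
    obtain ⟨s₁, t₁, ih₁⟩ := ih₁
    obtain ⟨s₂, t₂, ih₂⟩ := ih₂
    obtain ⟨s, t, h⟩ := treeBody_comp (D := D) k s₁ t₁ s₂ t₂
    exact ⟨s, t, fun a c => ((ih₁ _ _).par (ih₂ _ _)).resL.trans (h a c)⟩

section Steps
variable {L V : Type} {s t : Tree} {a c : L}

theorem locStep_parTree_inp (s t : Tree) (a : L) (H : Proc S (Option L) (Option V)) :
    LocStep D .inp a (parTree S L V (inPre S a) H s t)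
      (parTree S (Option L) (Option V) (inPost S L V) (H.map (Option.map some) (Option.map some)) s
        t) := by
  have := LocStep.resV (LocStep.resL (LocStep.parL (D := D) (Q := resV (resL (par
    (H.map (Option.map some) (Option.map some)) (par (locTree S .par s (some none) none)
      (varTree S .par t none (some none)))))) (LocStep.pre (d := .inp) (p := some a)
      (P := par (varWire .par (some none) none) (wire .par none (some none))))))
  simpa [swap, parTree, parForm, inPre, outPre, inPost, outPost, Function.comp_def] using this

theorem locStep_parTree_out (s t : Tree) (c : L) (G : Proc S (Option L) (Option V)) :
    LocStep D .out c (parTree S L V G (outPre S c) s t)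
      (parTree S (Option L) (Option V) (G.map (Option.map some) (Option.map some)) (outPost S L V) s
        t) := by
  have := LocStep.resV (LocStep.resL (LocStep.parR (D := D) (P := G)
    (LocStep.resV (LocStep.resL (LocStep.parL (Q := par (locTree S .par s (some none) none)
      (varTree S .par t none (some none))) (LocStep.pre (d := .out) (p := some (some c))
      (P := par (varWire .par none (some none)) (wire .par (some none) none))))))))
  simpa [swap, parTree, parForm, inPre, outPre, inPost, outPost] using this

theorem locStep_parTree_inv {d : Pol} {p : L} {R}
    (h : LocStep D d p (parTree S L V (inPre S a) (outPre S c) s t) R) :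
    (d = .inp ∧ p = a ∧ R = parTree S (Option L) (Option V) (inPost S L V) (outPre S (some c)) s
      t) ∨
    (d = .out ∧ p = c ∧ R = parTree S (Option L) (Option V) (inPre S (some a)) (outPost S L V) s
      t) := by
  obtain ⟨_, h₁, rfl⟩ := h.resV_inv
  obtain ⟨_, h₂, rfl⟩ := h₁.resL_inv
  obtain ⟨_, h₃, rfl⟩ | ⟨_, h₃, rfl⟩ := h₂.par_inv
  · obtain ⟨rfl, e, rfl⟩ := h₃.pre_inv
    refine .inl ⟨rfl, by simpa using e, ?_⟩
    simp [swap]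
  · obtain ⟨_, h₄, rfl⟩ := h₃.resV_inv
    obtain ⟨_, h₅, rfl⟩ := h₄.resL_inv
    obtain ⟨_, h₆, rfl⟩ | ⟨_, h₆, rfl⟩ := h₅.par_inv
    · obtain ⟨rfl, e, rfl⟩ := h₆.pre_inv
      refine .inr ⟨rfl, by simpa using e, ?_⟩
      simp [swap]
    · obtain ⟨_, h₇, rfl⟩ | ⟨_, h₇, rfl⟩ := h₆.par_inv
      · obtain ⟨_, e⟩ | ⟨_, e⟩ := actL_locTree h₇.actL <;> simp at e
      · exact (actL_varTree h₇.actL).elim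

theorem varStep_parTree_inv {d : Pol} {x : V} {R}
    (h : VarStep D d x (parTree S L V (inPre S a) (outPre S c) s t) R) : False := by
  obtain ⟨_, h₁, rfl⟩ := h.resV_inv
  obtain ⟨_, h₂, rfl⟩ := h₁.resL_inv
  obtain ⟨_, h₃, rfl⟩ | ⟨_, h₃, rfl⟩ := h₂.par_inv
  · exact h₃.locPre_inv
  · obtain ⟨_, h₄, rfl⟩ := h₃.resV_inv
    obtain ⟨_, h₅, rfl⟩ := h₄.resL_inv
    obtain ⟨_, h₆, rfl⟩ | ⟨_, h₆, rfl⟩ := h₅.par_inv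
    · exact h₆.locPre_inv
    · obtain ⟨_, h₇, rfl⟩ | ⟨_, h₇, rfl⟩ := h₆.par_inv
      · exact actV_locTree h₇.actV
      · exact nomatch (actV_varTree h₇.actV).2

theorem tauStep_parTree_inv (hac : a ≠ c) {R}
    (h : TauStep D (parTree S L V (inPre S a) (outPre S c) s t) R) :
    ∃ X, TauStep D (locTree S .par s (some none) none) X ∧
      R = parForm (inPre S a) (outPre S c) X (varTree S .par t none (some none)) := by
  obtain ⟨_, h₁, rfl⟩ := h.resV_inv
  obtain ⟨_, h₂, rfl⟩ := h₁.resL_inv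
  obtain ⟨_, h₃, rfl⟩ | ⟨_, h₃, rfl⟩ | ⟨_, _, _, _, h₃, h₄, rfl⟩ | ⟨_, _, _, _, h₃, h₄, rfl⟩ :=
    h₂.par_inv
  · exact h₃.locPre_inv.elim
  · obtain ⟨_, h₄, rfl⟩ := h₃.resV_inv
    obtain ⟨_, h₅, rfl⟩ := h₄.resL_inv
    obtain ⟨_, h₆, rfl⟩ | ⟨_, h₆, rfl⟩ | ⟨_, _, _, _, h₆, h₇, rfl⟩ | ⟨_, _, _, _, h₆, h₇, rfl⟩ :=
      h₅.par_inv
    · exact h₆.locPre_inv.elim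
    · obtain ⟨X, h₇, rfl⟩ | ⟨_, h₇, rfl⟩ | ⟨_, _, _, _, h₇, h₈, rfl⟩ | ⟨_, _, _, _, h₇, h₈, rfl⟩ :=
        h₆.par_inv
      · exact ⟨X, h₇, rfl⟩
      · exact (h₇.not_quiet (quiet_varTree ..)).elim
      · exact (actL_varTree h₈.actL).elim
      · exact (actV_locTree h₇.actV).elim
    · obtain ⟨rfl, rfl, -⟩ := h₆.pre_inv
      have := h₇.actL
      obtain h | h := this
      · obtain ⟨_, e⟩ | ⟨_, e⟩ := actL_locTree h <;> simp at e
      · exact (actL_varTree h).elim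
    · exact h₆.locPre_inv.elim
  · obtain ⟨rfl, rfl, -⟩ := h₃.pre_inv
    obtain ⟨_, h₅, rfl⟩ := h₄.resV_inv
    obtain ⟨_, h₆, rfl⟩ := h₅.resL_inv
    obtain h | h | h := h₆.actL
    · exact (hac (by simpa using h.2)).elim
    · obtain ⟨_, e⟩ | ⟨_, e⟩ := actL_locTree h <;> simp at e
    · exact (actL_varTree h).elim
  · exact h₃.locPre_inv.elim

end Steps

/-- The wire at the acting end fires its outer prefix. The rest of the tree is replaced by its
unfolded body, and `parTree_comp` merges the two, with the fired prefix as outer part. -/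
theorem locStep_locTree_par (u : Tree) {L V : Type} {a c : L} {d : Pol} {p : L} {R}
    (h : LocStep D d p (locTree S .par u a c : Proc S L V) R) :
    (d = .inp ∧ p = a ∧ ∃ s t, Expands D R
      (parTree S (Option L) (Option V) (inPost S L V) (outPre S (some c)) s t)) ∨
    (d = .out ∧ p = c ∧ ∃ s t, Expands D R
      (parTree S (Option L) (Option V) (inPre S (some a)) (outPost S L V) s t)) := by
  induction u generalizing L V with
  | leaf =>
    have h := h.wire_inv
    rw [← treeBody_leaf, treeBody_par] at h
    obtain ⟨rfl, rfl, rfl⟩ | ⟨rfl, rfl, rfl⟩ := locStep_parTree_inv h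
    · exact .inl ⟨rfl, rfl, _, _, .refl _⟩
    · exact .inr ⟨rfl, rfl, _, _, .refl _⟩
  | node u₁ u₂ ih₁ ih₂ =>
    obtain ⟨_, h₁, rfl⟩ := h.resL_inv
    obtain ⟨_, h₂, rfl⟩ | ⟨_, h₂, rfl⟩ := h₁.par_inv
    · obtain ⟨rfl, e, s, t, hT⟩ | ⟨_, e, _⟩ := ih₁ h₂
      · obtain ⟨s₂, t₂, h₂⟩ := locTree_expands (S := S) (D := D) .par u₂
        refine .inl ⟨rfl, by simpa using e, .node (.node s (.node .leaf .leaf)) s₂, .node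
          (.node t₂ (.node .leaf .leaf)) t, ?_⟩
        have h₃ := (hT.map swap_injective Function.injective_id).par (h₂ (V := Option V) none
          (some (some c)))
        have h₄ := parTree_comp (D := D) s t s₂ t₂ (inPost S L V) (outPre S (some c))
        rw [treeBody_par] at h₃
        refine Expands.trans ?_ h₄
        simpa [swap, parTree, parForm, inPre, outPre, inPost, outPost] using h₃.resL
      · simp at e
    · obtain ⟨_, e, _⟩ | ⟨rfl, e, s, t, hT⟩ := ih₂ h₂
      · simp at e
      · obtain ⟨s₁, t₁, h₁⟩ := locTree_expands (S := S) (D := D) .par u₁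
        refine .inr ⟨rfl, by simpa using e, .node (.node s₁ (.node .leaf .leaf)) s, .node
          (.node t (.node .leaf .leaf)) t₁, ?_⟩
        have h₃ := (h₁ (V := Option V) (some (some a)) none).par (hT.map swap_injective
          Function.injective_id)
        have h₄ := parTree_comp (D := D) s₁ t₁ s t (inPre S (some a)) (outPost S L V)
        rw [treeBody_par] at h₃
        refine Expands.trans ?_ h₄
        simpa [swap, parTree, parForm, inPre, outPre, inPost, outPost] using h₃.resL

/-- Once the two inner prefixes have fired, their leftover wires link the two halves. What remains
is a rearrangement of restrictions, with the same trees as in `parTree_comp`. -/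
theorem parTree_com (s₁ t₁ s₂ t₂ : Tree) {L V : Type} (a c : L) :
    Bisim D (resL (resV (resL (par
      (parTree S (Option (Option L)) (Option V) (inPre S (some (some a))) (outPost S (Option L) V)
        s₁ t₁)
      (parTree S (Option (Option L)) (Option V) (inPost S (Option L) V) (outPre S (some (some c)))
        s₂ t₂)))))
      (parTree S L V (inPre S a) (outPre S c) (.node (.node s₁ (.node .leaf .leaf)) s₂)
        (.node (.node t₂ (.node .leaf .leaf)) t₁)) := by
  refine Flat.bisim_of_eq
    (.resL (.inr 0) (.resV (.inr 0) (.resL (.inr 1) (.par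
      (.resV (.inr 1) (.resL (.inr 2) (.par .leaf
        (.resV (.inr 2) (.resL (.inr 3) (.par (.par .leaf .leaf) (.par .leaf .leaf)))))))
      (.resV (.inr 3) (.resL (.inr 4) (.par (.par .leaf .leaf)
        (.resV (.inr 4) (.resL (.inr 5) (.par .leaf (.par .leaf .leaf)))))))))))
    (.resV (.inr 1) (.resL (.inr 2) (.par .leaf (.resV (.inr 4) (.resL (.inr 5) (.par .leaf (.par
      (.resL (.inr 4) (.par (.resL (.inr 3) (.par .leaf (.resL (.inr 1) (.par .leaf .leaf))))
        .leaf))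
      (.resV (.inr 2) (.par (.resV (.inr 3) (.par .leaf (.resV (.inr 0) (.par .leaf .leaf))))
        .leaf))))))))) ?_ ?_ ?_
  · simp [-Multiset.singleton_add, locTree, varTree]
    abel
  all_goals simp

/-- The induction is on the tree itself, not on its unfolding, whose inner tree need not be smaller.
A move inside one half is absorbed by recomposing, and a communication between the halves by
`parTree_com`. -/
theorem tauStep_locTree_par (u : Tree) {L V : Type} {a c : L} (hac : a ≠ c) {R}
    (h : TauStep D (locTree S .par u a c : Proc S L V) R) :
    ∃ s t, Expands D R (treeBody S .par s t a c) := by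
  induction u generalizing L V with
  | leaf => exact (h.not_quiet hac).elim
  | node u₁ u₂ ih₁ ih₂ =>
    obtain ⟨_, h₁, rfl⟩ := h.resL_inv
    obtain ⟨_, h₂, rfl⟩ | ⟨_, h₂, rfl⟩ | ⟨_, _, _, _, h₂, h₃, rfl⟩ | ⟨_, _, _, _, h₂, h₃, rfl⟩ :=
      h₁.par_inv
    · obtain ⟨s₁, t₁, hT⟩ := ih₁ (by simp) h₂
      obtain ⟨s₂, t₂, hU⟩ := locTree_expands (S := S) (D := D) .par u₂
      obtain ⟨s, t, hC⟩ := treeBody_comp (S := S) (D := D) .par s₁ t₁ s₂ t₂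
      exact ⟨s, t, (hT.par (hU _ _)).resL.trans (hC _ _)⟩
    · obtain ⟨s₂, t₂, hT⟩ := ih₂ (by simp) h₂
      obtain ⟨s₁, t₁, hU⟩ := locTree_expands (S := S) (D := D) .par u₁
      obtain ⟨s, t, hC⟩ := treeBody_comp (S := S) (D := D) .par s₁ t₁ s₂ t₂
      exact ⟨s, t, ((hU _ _).par hT).resL.trans (hC _ _)⟩
    · obtain ⟨_, e₁, s₂, t₂, hT⟩ | ⟨rfl, rfl, s₁, t₁, hT⟩ := locStep_locTree_par u₁ h₂
      · subst e₁
        obtain ⟨_, e, _⟩ | ⟨_, e, _⟩ := locStep_locTree_par u₂ h₃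
        · exact nomatch e
        -- An input by the left half and an output by the right half would have to meet at the two
        -- outer ends, which are distinct.
        · exact (hac (Option.some_injective _ e)).elim
      · obtain ⟨_, _, s₂, t₂, hU⟩ | ⟨e, _⟩ := locStep_locTree_par u₂ h₃
        · refine ⟨.node (.node s₁ (.node .leaf .leaf)) s₂, .node (.node t₂ (.node .leaf .leaf)) t₁,
            (hT.par hU).resL.resV.resL.trans ?_⟩
          rw [treeBody_par]
          exact (parTree_com ..).expands
        · exact nomatch e
    · exact (actV_locTree h₂.actV).elim

/-! ### Trees of wires expand wires -/

/-- The unfolding of a wire is related to the unfoldings of trees of wires with the same ends. -/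
inductive WireRel (S : Sig) (k : WireKind) : Rel S
  | loc {L V : Type} (s t : Tree) {a b : L} : a ≠ b →
      WireRel S k L V (treeBody S k .leaf .leaf a b) (treeBody S k s t a b)
  | var {L V : Type} (s : Tree) (x y : V) :
      WireRel S k L V (varTreeBody S k .leaf x y) (varTreeBody S k s x y)

theorem upTo_treeBody {k : WireKind} (s t : Tree) {L V : Type} {a b : L} (h : a ≠ b) :
    UpTo D (WireRel S k) (wire k a b : Proc S L V) (treeBody S k s t a b) := by
  refine .bisim ?_ (.base (.loc s t h))
  rw [treeBody_leaf]
  exact bisim_wire k a b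

/-- This is where the up-to technique is needed: a wire is bisimilar to its body, the body is
related to a generalised body, and the tree expands the latter. -/
theorem upTo_locTree {k : WireKind} (t : Tree) {L V : Type} {a b : L} (h : a ≠ b) :
    UpTo D (WireRel S k) (wire k a b : Proc S L V) (locTree S k t a b) := by
  obtain ⟨s, t, hs⟩ := locTree_expands (S := S) (D := D) k t
  exact (upTo_treeBody s t h).expands (hs a b)

theorem upTo_varTree {k : WireKind} (t : Tree) {L V : Type} (x y : V) :
    UpTo D (WireRel S k) (varWire k x y : Proc S L V) (varTree S k t x y) := by
  obtain ⟨s, hs⟩ := varTree_expands (S := S) (D := D) k t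
  exact (UpTo.base (.var s x y)).expands (hs x y)

theorem upTo_parForm {R : Rel S} {L V : Type} (G H : Proc S (Option L) (Option V))
    {X X' Y Y' : Proc S (Option (Option L)) (Option (Option V))} (hX : UpTo D R X X')
    (hY : UpTo D R Y Y') : UpTo D R (parForm G H X Y) (parForm G H X' Y') :=
  ((UpTo.refl _).par ((UpTo.refl _).par (hX.par hY)).resL.resV).resL.resV

theorem progress_locPre {T : Rel S} {L V : Type} (d : Pol) (p : L)
    {P Q : Proc S (Option L) (Option V)} (h : T _ _ P Q) :
    Progress D T (locPre d p P) (locPre d p Q) := by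
  refine ⟨?_, ?_, ?_, ?_, ?_, ?_⟩
  · exact fun _ s => s.locPre_inv.elim
  · intro _ _ _ s
    obtain ⟨rfl, rfl, rfl⟩ := s.pre_inv
    exact ⟨_, LocStep.pre.weak, h⟩
  · exact fun _ _ _ s => s.locPre_inv.elim
  · exact fun _ s => s.locPre_inv.elim
  · intro _ _ _ s
    obtain ⟨rfl, rfl, rfl⟩ := s.pre_inv
    exact ⟨_, LocStep.pre, h⟩
  · exact fun _ _ _ s => s.locPre_inv.elim

theorem progress_varRep {T : Rel S} {L V : Type} (x : V) {P Q : Proc S (Option L) V}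
    (h : T _ _ (par P ((varRep x P).map some id)) (par Q ((varRep x Q).map some id))) :
    Progress D T (varRep x P) (varRep x Q) := by
  refine ⟨?_, ?_, ?_, ?_, ?_, ?_⟩
  · exact fun _ s => s.varRep_inv.elim
  · exact fun _ _ _ s => s.varRep_inv.elim
  · intro _ _ _ s
    obtain ⟨rfl, rfl, rfl⟩ := s.rep_inv
    exact ⟨_, VarStep.rep.weak, h⟩
  · exact fun _ s => s.varRep_inv.elim
  · exact fun _ _ _ s => s.varRep_inv.elim
  · intro _ _ _ s
    obtain ⟨rfl, rfl, rfl⟩ := s.rep_inv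
    exact ⟨_, VarStep.rep, h⟩

/-- Visible moves fire an outer prefix on both sides and leave the inner links related in a common
context. Internal moves exist only inside the location tree on the right. -/
theorem progress_parTree (s t : Tree) {L V : Type} {a b : L} (hab : a ≠ b) :
    Progress D (fun _ _ => UpTo D (WireRel S .par))
      (parTree S L V (inPre S a) (outPre S b) .leaf .leaf)
      (parTree S L V (inPre S a) (outPre S b) s t) := by
  have up {L V : Type} (G H : Proc S (Option L) (Option V)) :
      UpTo D (WireRel S .par) (parTree S L V G H .leaf .leaf) (parTree S L V G H s t) :=
    upTo_parForm G H (upTo_locTree s (by simp)) (upTo_varTree t _ _)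
  refine ⟨?_, ?_, ?_, ?_, ?_, ?_⟩
  · intro _ h
    rw [← treeBody_par, treeBody_leaf] at h
    exact (h.not_quiet (quiet_wireBody _ hab)).elim
  · intro _ _ _ h
    obtain ⟨rfl, rfl, rfl⟩ | ⟨rfl, rfl, rfl⟩ := locStep_parTree_inv h
    · exact ⟨_, (locStep_parTree_inp s t _ (outPre S b)).weak, by simpa using up _ _⟩
    · exact ⟨_, (locStep_parTree_out s t _ (inPre S a)).weak, by simpa using up _ _⟩
  · exact fun _ _ _ h => (varStep_parTree_inv h).elim
  · intro _ h
    obtain ⟨X, hX, rfl⟩ := tauStep_parTree_inv hab h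
    obtain ⟨s', t', e⟩ := tauStep_locTree_par s (by simp) hX
    -- The single wire stays put: the tree after its move expands a generalised body, to which the
    -- inner wire is still related.
    exact .inl (upTo_parForm _ _ ((upTo_treeBody s' t' (by simp)).expands e) (upTo_varTree t _ _))
  · intro _ _ _ h
    obtain ⟨rfl, rfl, rfl⟩ | ⟨rfl, rfl, rfl⟩ := locStep_parTree_inv h
    · exact ⟨_, locStep_parTree_inp .leaf .leaf _ (outPre S b), by simpa using up _ _⟩
    · exact ⟨_, locStep_parTree_out .leaf .leaf _ (inPre S a), by simpa using up _ _⟩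
  · exact fun _ _ _ h => (varStep_parTree_inv h).elim

/-- In each guarded case both sides fire the same prefix and reach a common static context, filled
with wires on one side and with trees on the other. For variable wires the replications that persist
form the original pair again. -/
theorem WireRel.progress {k : WireKind} (L V : Type) (P Q : Proc S L V) (h : WireRel S k L V P Q) :
    Progress D (fun _ _ => UpTo D (WireRel S k)) P Q := by
  cases h with
  | loc s t hab =>
    cases k
    · exact progress_locPre _ _ ((UpTo.refl _).par
        ((upTo_locTree s (by simp)).par (upTo_varTree t _ _))).resL.resV
    · exact progress_locPre _ _ ((UpTo.refl _).par
        ((upTo_locTree s (by simp)).par (upTo_varTree t _ _))).resL.resV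
    · rw [treeBody_par, treeBody_par]
      exact progress_parTree s t hab
  | var s x y =>
    refine progress_varRep _ ?_
    have h := UpTo.map (Option.some_injective _) Function.injective_id
      (UpTo.base (WireRel.var s x y) : UpTo D (WireRel S k) (_ : Proc S L V) _)
    exact UpTo.par ((UpTo.refl _).par (upTo_locTree s (by simp))).resL h

theorem locTree_expands_wire (k : WireKind) (t : Tree) {L V : Type} {a b : L} (h : a ≠ b) :
    Expands D (locTree S k t a b : Proc S L V) (wire k a b) :=
  expands_of_upTo _ WireRel.progress (upTo_locTree t h)

theorem varTree_expands_varWire (k : WireKind) (t : Tree) {L V : Type} (x y : V) :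
    Expands D (varTree S k t x y : Proc S L V) (varWire k x y) :=
  expands_of_upTo _ WireRel.progress (upTo_varTree t x y)

/-! ### Chains of wires -/

/-- The shape of a chain of wires. -/
def chainTree : ℕ → Tree
  | 0 => .leaf
  | n + 1 => .node (chainTree n) .leaf

theorem locChain_eq (k : WireKind) (n : ℕ) {L V : Type} (a b : L) :
    (locChain (concreteWires S k) n a b : Proc S L V) = locTree S k (chainTree n) a b := by
  induction n generalizing L V with
  | zero => rfl
  | succ n ih => simp only [locChain, chainTree, locTree, ih]; rfl

theorem varChain_eq (k : WireKind) (n : ℕ) {L V : Type} (x y : V) :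
    (varChain (concreteWires S k) n x y : Proc S L V) = varTree S k (chainTree n) x y := by
  induction n generalizing L V with
  | zero => rfl
  | succ n ih => simp only [varChain, chainTree, varTree, ih]; rfl

/-! ### The use of names in wires -/

namespace Proc

/-- The extension of a predicate on polarised names which allows every use of a bound name. -/
def withBound {A : Type} (U : Pol → A → Prop) (d : Pol) : Option A → Prop
  | none => True
  | some a => U d a

/-- The free names of the process occur in subject position only with the polarities that are
allowed by `A` and `B`, and constants of the signature do not occur. -/
def UsesOnly {L V : Type} (A : Pol → L → Prop) (B : Pol → V → Prop) : Proc S L V → Prop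
  | nil => True
  | locPre d p P => A d p ∧ P.UsesOnly (withBound A) (withBound B)
  | varPre d x P => B d x ∧ P.UsesOnly (withBound A) B
  | locRep p P => A .inp p ∧ P.UsesOnly (withBound A) (withBound B)
  | varRep x P => B .inp x ∧ P.UsesOnly (withBound A) B
  | par P Q => P.UsesOnly A B ∧ Q.UsesOnly A B
  | resL P => P.UsesOnly (withBound A) B
  | resV P => P.UsesOnly A (withBound B)
  | wire _ p q => A .inp p ∧ A .out q
  | call _ _ _ => False

end Proc

/-- Unfolding a wire preserves polarities. This invariant controls uses after any number of
unfoldings, by induction on the derivation of the use. -/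
theorem usesOnly_wireBody (k : WireKind) {L V : Type} {A : Pol → L → Prop} {B : Pol → V → Prop}
    {p q : L} (h : A .inp p ∧ A .out q) : (wireBody k p q : Proc S L V).UsesOnly A B := by
  cases k <;> simp [wireBody, permLoc, permVar, varWire, UsesOnly, withBound, h]

theorem UsesLoc.of_usesOnly {L V : Type} {d : Pol} {a : L} {P : Proc S L V} (h : UsesLoc D d a P)
    {A : Pol → L → Prop} {B : Pol → V → Prop} (hP : P.UsesOnly A B) : A d a := by
  induction h with
  | pre => exact hP.1
  | rep => exact hP.1
  | locPre _ ih => exact ih hP.2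
  | varPre _ ih => exact ih hP.2
  | locRep _ ih => exact ih hP.2
  | varRep _ ih => exact ih hP.2
  | parL _ ih => exact ih hP.1
  | parR _ ih => exact ih hP.2
  | resL _ ih => exact ih hP
  | resV _ ih => exact ih hP
  | wire _ ih => exact ih (B := B) (usesOnly_wireBody _ hP)
  | call => exact hP.elim

theorem UsesVar.of_usesOnly {L V : Type} {d : Pol} {x : V} {P : Proc S L V} (h : UsesVar D d x P)
    {A : Pol → L → Prop} {B : Pol → V → Prop} (hP : P.UsesOnly A B) : B d x := by
  induction h with
  | pre => exact hP.1
  | rep => exact hP.1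
  | locPre _ ih => exact ih hP.2
  | varPre _ ih => exact ih hP.2
  | locRep _ ih => exact ih hP.2
  | varRep _ ih => exact ih hP.2
  | parL _ ih => exact ih hP.1
  | parR _ ih => exact ih hP.2
  | resL _ ih => exact ih hP
  | resV _ ih => exact ih hP
  | wire _ ih => exact ih (usesOnly_wireBody _ hP)
  | call => exact hP.elim

theorem wire_use (k : WireKind) {L V : Type} {a b : L} (h : a ≠ b) :
    ¬ UsesLoc D .out a (wire k a b : Proc S L V) ∧ ¬ UsesLoc D .inp b (wire k a b : Proc S L V) := by
  have hW : (wire k a b : Proc S L V).UsesOnly (fun d p => d = .inp ∧ p = a ∨ d = .out ∧ p = b)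
      (fun _ _ => True) := by simp [UsesOnly]
  exact ⟨fun u => by simpa [h] using u.of_usesOnly hW,
    fun u => by simpa [h.symm] using u.of_usesOnly hW⟩

theorem varWire_use (k : WireKind) {L V : Type} {x y : V} (h : x ≠ y) :
    ¬ UsesVar D .out x (varWire k x y : Proc S L V) ∧
      ¬ UsesVar D .inp y (varWire k x y : Proc S L V) := by
  have hW : (varWire k x y : Proc S L V).UsesOnly (fun _ _ => True)
      (fun d z => d = .inp ∧ z = x ∨ d = .out ∧ z = y) := by
    simp [varWire, permVar, UsesOnly, withBound]
  exact ⟨fun u => by simpa [h] using u.of_usesOnly hW,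
    fun u => by simpa [h.symm] using u.of_usesOnly hW⟩

theorem varWire_fn (k : WireKind) {L V : Type} (x y : V) :
    (varWire k x y : Proc S L V).varFn = {x, y} ∧ (varWire k x y : Proc S L V).locFn = ∅ := by
  constructor <;> ext z <;> simp [varWire, permVar, varFn, locFn, or_comm]

/-! ### Wires and variable prefixes -/

/-- After `expands_rep`, two location wires stand in front of the body: the one inside the variable
wire and the one of its permeable output. The hypothesis absorbs the inner one, then the outer one.
-/
theorem expands_rep_inp (k : WireKind) {L V : Type} (x : V) (P : Proc S (Option L) V)
    (h : Expands D (resL (par (wire k (some none) none) (P.map (Option.map some) id))) P) :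
    Expands D (resV (par (varWire k (some x) none) (varRep none (P.map id some))))
      (varRep x P) := by
  have rep := expands_rep (D := D) k x (wire k (some none) none) P
  have h' := h.map (Option.map_injective (Option.some_injective L)) (Function.injective_id (α := V))
  refine Expands.trans (by simpa [varWire] using rep) (Expands.varRep (Expands.trans ?_ h) x)
  exact (Expands.par (.refl _) (by simpa [Function.comp_def] using h')).resL

/-- A replicated input at a restricted name with no caller is dead; this discards a variable wire
whose only call has been served. -/
theorem expands_nil_varRep {L V : Type} (P : Proc S (Option L) (Option V)) :
    Expands D (resV (par nil (varRep none P))) nil := by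
  refine Expands.trans (Bisim.expands ?_) (bisim_resV_varRep P).expands
  refine Flat.bisim_of_eq (.resV (.inr 0) (.par .nil .leaf)) (.resV (.inr 0) .leaf) ?_ ?_ ?_
  all_goals simp

/-- The permeable output calls the variable wire exactly once, which `expands_fire` performs with an
empty environment. The two location wires then leading out of `P` collapse to one, which the
hypothesis absorbs. -/
theorem expands_perm_out_var (k : WireKind) {L V : Type} (y : V) (P : Proc S (Option L) V)
    (h : Expands D (resL (par (wire k none (some none)) (P.map (Option.map some) id))) P) :
    Expands D (resV (par (varWire k none (some y))
      (permVar (fun p q => wire k p q) .out none (P.map id some))))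
      (permVar (fun p q => wire k p q) .out y P) := by
  have fire := expands_fire (D := D) (wire k (some none) none : Proc S (Option (Option L)) V)
    (permVar (fun p q => wire k p q) .out y (wire k (some none) none))
    (E := nil) (.fresh (nil : Proc S (Option L) V) Function.injective_id (Option.some_injective _)
      (by simp))
  have tree := ((locTree_expands_wire (S := S) (D := D) (V := V) k (.node .leaf .leaf)
    (a := none) (b := some (none : Option L)) (by simp)).par (.refl (P.map (Option.map some)
      id))).resL.trans h
  refine Expands.trans (Bisim.expands ?_) (((fire.trans ((Expands.refl _).par
    (expands_nil_varRep _))).par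
    (.refl P)).resL.trans (Expands.trans (Bisim.expands ?_) ((Expands.refl _).par tree).resL))
  · refine Flat.bisim_of_eq
      (.resV (.inr 0) (.par .leaf (.resL (.inr 0) (.par .leaf .leaf))))
      (.resL (.inr 0) (.par (.resV (.inr 0) (.par (.par .leaf .nil) .leaf)) .leaf)) ?_ ?_ ?_
    · simp [-Multiset.singleton_add, varWire]
      abel
    all_goals simp
  · refine Flat.bisim_of_eq
      (.resL (.inr 0) (.par (.par (.resL (.inr 1) (.par .leaf (.resL (.inr 2) (.par .leaf .leaf))))
        .nil) .leaf))
      (.resL (.inr 2) (.par .leaf (.resL (.inr 0) (.par (.resL (.inr 1) (.par .leaf .leaf))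
        .leaf))))
      ?_ ?_ ?_
    · simp [-Multiset.singleton_add, locTree]
      abel
    all_goals simp

/-! ### Wires and location prefixes -/

theorem respectful_inp_tree (k : WireKind) (s t : Tree) {L V : Type}
    {P : Proc S (Option L) (Option V)}
    (h : Expands D (resV (resL (par (par (varWire k none (some none)) (wire k (some none) none))
      (P.map (Option.map some) (Option.map some))))) P) :
    Expands D (resV (resL (par (par (varTree S k t none (some none))
      (locTree S k s (some none) none))
      (P.map (Option.map some) (Option.map some))))) P :=
  (((varTree_expands_varWire k t _ _).par (locTree_expands_wire k s (by simp))).par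
    (.refl _)).resL.resV.trans h

theorem respectful_out_tree (k : WireKind) (s t : Tree) {L V : Type}
    {P : Proc S (Option L) (Option V)}
    (h : Expands D (resV (resL (par (par (varWire k (some none) none) (wire k none (some none)))
      (P.map (Option.map some) (Option.map some))))) P) :
    Expands D (resV (resL (par (par (varTree S k t (some none) none)
      (locTree S k s none (some none)))
      (P.map (Option.map some) (Option.map some))))) P :=
  (((varTree_expands_varWire k t _ _).par (locTree_expands_wire k s (by simp))).par
    (.refl _)).resL.resV.trans h

theorem Expands.perm {k : WireKind} {L V : Type} {P Q : Proc S (Option L) (Option V)}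
    (h : Expands D P Q) (d : Pol) (p : L) : Expands D (perm k d p P) (perm k d p Q) := by
  cases d <;> exact ((Expands.refl _).par h).resL.resV

/-- The output of the wire is in front and meets the permeable input. The permeable input at `p`
then floats out, leaving two wires for each name between it and `P`. -/
theorem expands_perm_inp_oi {L V : Type} (p : L) (P : Proc S (Option L) (Option V))
    (h : Expands D (resV (resL (par (par (varWire .oi none (some none)) (wire .oi (some none) none))
      (P.map (Option.map some) (Option.map some))))) P) :
    Expands D (resL (par (wire .oi (some p) none)
      (perm .oi .inp none (P.map (Option.map some) id)))) (perm .oi .inp p P) := by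
  have com := expands_com_pre_perm (D := D) .oi (perm .oi .inp (some p)
    (par (wire .oi none (some none)) (varWire .oi (some none) none))) P
  refine ((bisim_wire _ _ _).expands.par (.refl _)).resL.trans (Expands.trans (by
    simpa [wireBody, permLoc] using com) (Expands.trans (Bisim.expands ?_)
      ((respectful_inp_tree .oi (.node .leaf .leaf) (.node .leaf .leaf) h).perm .inp p)))
  refine Flat.bisim_of_eq
    (.resV (.inr 0) (.resL (.inr 0) (.resV (.inr 1) (.resL (.inr 1) (.par
      (.par (.resV (.inr 2) (.resL (.inr 2) (.par .leaf (.par .leaf .leaf)))) .leaf)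
      (.par .leaf .leaf))))))
    (.resV (.inr 2) (.resL (.inr 2) (.par .leaf (.resV (.inr 1) (.resL (.inr 1) (.par
      (.par (.resV (.inr 0) (.par .leaf .leaf)) (.resL (.inr 0) (.par .leaf .leaf))) .leaf))))))
    ?_ ?_ ?_
  · simp [-Multiset.singleton_add, locTree, varTree]
    abel
  all_goals simp

/-- The input at `p` does not guard, so the communication takes place beside it. Both communicating
prefixes are permeable, hence three wires for each name before the hypothesis is applied. -/
theorem expands_perm_inp_par {L V : Type} (p : L) (P : Proc S (Option L) (Option V))
    (h : Expands D (resV (resL (par (par (varWire .par none (some none))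
      (wire .par (some none) none))
      (P.map (Option.map some) (Option.map some))))) P) :
    Expands D (resL (par (wire .par (some p) none)
      (perm .par .inp none (P.map (Option.map some) id)))) (perm .par .inp p P) := by
  have com := expands_com_perm_perm (D := D) .par
    (par (wire .par (some none) none) (varWire .par none (some none)) :
      Proc S (Option (Option L)) (Option (Option V))) (P.map (Option.map some) (Option.map some))
  refine ((bisim_wire _ _ _).expands.par (.refl _)).resL.trans (Expands.trans (Bisim.expands ?_)
    ((com.perm (k := .par) .inp p).trans (Expands.trans (Bisim.expands ?_)
      ((respectful_inp_tree .par (.node .leaf (.node .leaf .leaf)) (.node (.node .leaf .leaf) .leaf)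
        h).perm .inp p))))
  · refine Flat.bisim_of_eq
      (.resL (.inr 0) (.par
        (.resV (.inr 1) (.resL (.inr 1) (.par .leaf
          (.resV (.inr 2) (.resL (.inr 2) (.par .leaf (.par .leaf .leaf)))))))
        (.resV (.inr 3) (.resL (.inr 3) (.par .leaf .leaf)))))
      (.resV (.inr 1) (.resL (.inr 1) (.par .leaf (.resL (.inr 0) (.par
        (.resV (.inr 2) (.resL (.inr 2) (.par .leaf (.par .leaf .leaf))))
        (.resV (.inr 3) (.resL (.inr 3) (.par .leaf .leaf)))))))) ?_ ?_ ?_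
    · simp [-Multiset.singleton_add]
      abel
    all_goals simp
  · refine Flat.bisim_of_eq
      (.resV (.inr 1) (.resL (.inr 1) (.par .leaf (.resV (.inr 2) (.resL (.inr 2) (.resV (.inr 3)
        (.resL (.inr 3) (.par (.par (.par .leaf .leaf) .leaf)
          (.par (.resV (.inr 4) (.par .leaf .leaf))
          (.resL (.inr 4) (.par .leaf .leaf)))))))))))
      (.resV (.inr 1) (.resL (.inr 1) (.par .leaf (.resV (.inr 3) (.resL (.inr 3) (.par
        (.par (.resV (.inr 2) (.par (.resV (.inr 4) (.par .leaf .leaf)) .leaf))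
          (.resL (.inr 2) (.par .leaf (.resL (.inr 4) (.par .leaf .leaf))))) .leaf))))))
      ?_ ?_ ?_
    · simp [-Multiset.singleton_add, locTree, varTree]
      abel
    all_goals simp

/-- The input at `p` guards the wire, so the chain of three wires arises below this input rather
than next to `P`. Collapsed to a single wire for each name, it is the continuation prescribed by a
permeable input at `p`. -/
theorem expands_perm_inp_io {L V : Type} (p : L) (P : Proc S (Option L) (Option V)) :
    Expands D (resL (par (wire .io (some p) none)
      (perm .io .inp none (P.map (Option.map some) id)))) (perm .io .inp p P) := by
  have com := expands_com_perm_pre (D := D) .io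
    (par (wire .io (some none) none) (varWire .io none (some none)) :
      Proc S (Option (Option (Option L))) (Option (Option (Option V))))
    (par (varWire .io (some (some none)) none) (wire .io none (some (some none))))
  have pull := bisim_resL_pre (D := D) .inp .inp (some p)
    (perm .io .out (some none) (par (wire .io (some none) none) (varWire .io none (some none))))
    (par (varWire .io (some none) none) (wire .io none (some (some none))) :
      Proc S (Option (Option (Option L))) (Option (Option V)))
  have tree : Expands D
      (par (varTree S .io (.node .leaf (.node .leaf .leaf)) (some none) none)
        (locTree S .io (.node (.node .leaf .leaf) .leaf) none (some none)) :
        Proc S (Option (Option L)) (Option (Option V)))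
      (par (varWire .io (some none) none) (wire .io none (some none))) :=
    (varTree_expands_varWire ..).par (locTree_expands_wire _ _ (by simp))
  refine ((bisim_wire _ _ _).expands.par (.refl _)).resL.trans (Expands.trans (Bisim.expands ?_)
    (((pull.expands.trans (Expands.locPre (Expands.trans (by simpa [swap] using com)
      (Expands.trans (Bisim.expands ?_) tree)) _ _)).par (.refl P)).resL.resV))
  · refine Flat.bisim_of_eq
      (.resL (.inr 0) (.par .leaf (.resV (.inr 1) (.resL (.inr 1) (.par .leaf .leaf)))))
      (.resV (.inr 1) (.resL (.inr 1) (.par (.resL (.inr 0) (.par .leaf .leaf)) .leaf))) ?_ ?_ ?_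
    · simp [-Multiset.singleton_add, wireBody, permLoc]
      abel
    all_goals simp
  · refine Flat.bisim_of_eq
      (.resV (.inr 0) (.resL (.inr 0) (.resV (.inr 1) (.resL (.inr 1) (.par
        (.par (.par .leaf .leaf) (.par .leaf .leaf)) (.par .leaf .leaf))))))
      (.par (.resV (.inr 1) (.par .leaf (.resV (.inr 0) (.par .leaf .leaf))))
        (.resL (.inr 1) (.par (.resL (.inr 0) (.par .leaf .leaf)) .leaf))) ?_ ?_ ?_
    · simp [-Multiset.singleton_add, locTree, varTree]
      abel
    all_goals simp

/-- The mirror image of the input law for the class I-O: now the output at `q` guards the wire, and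
the collapsed chain is the continuation of the permeable output. -/
theorem expands_perm_out_oi {L V : Type} (q : L) (P : Proc S (Option L) (Option V)) :
    Expands D (resL (par (wire .oi none (some q))
      (perm .oi .out none (P.map (Option.map some) id)))) (perm .oi .out q P) := by
  have com := expands_com_pre_perm (D := D) .oi
    (par (varWire .oi none (some (some none))) (wire .oi (some (some none)) none))
    (par (wire .oi none (some none)) (varWire .oi (some none) none) :
      Proc S (Option (Option (Option L))) (Option (Option (Option V))))
  have pull := bisim_resL_pre (D := D) .out .out (some q)
    (perm .oi .inp (some none) (par (wire .oi none (some none)) (varWire .oi (some none) none)))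
    (par (varWire .oi none (some none)) (wire .oi (some (some none)) none) :
      Proc S (Option (Option (Option L))) (Option (Option V)))
  have comm {L V : Type} (A B : Proc S (Option L) V) :
      Bisim D (resL (par A B)) (resL (par B A)) := by
    refine Flat.bisim_of_eq (.resL (.inr 0) (.par .leaf .leaf)) (.resL (.inr 0) (.par .leaf .leaf))
      (add_comm _ _) ?_ ?_ <;> simp
  have tree : Expands D
      (par (varTree S .oi (.node .leaf (.node .leaf .leaf)) none (some none))
        (locTree S .oi (.node (.node .leaf .leaf) .leaf) (some none) none) :
        Proc S (Option (Option L)) (Option (Option V)))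
      (par (varWire .oi none (some none)) (wire .oi (some none) none)) :=
    (varTree_expands_varWire ..).par (locTree_expands_wire _ _ (by simp))
  refine ((bisim_wire _ _ _).expands.par (.refl _)).resL.trans (Expands.trans (Bisim.expands ?_)
    (((pull.expands.trans (Expands.locPre ((comm _ _).expands.trans
      (Expands.trans (by simpa [swap] using com)
      (Expands.trans (Bisim.expands ?_) tree))) _ _)).par (.refl P)).resL.resV))
  · refine Flat.bisim_of_eq
      (.resL (.inr 0) (.par .leaf (.resV (.inr 1) (.resL (.inr 1) (.par .leaf .leaf)))))
      (.resV (.inr 1) (.resL (.inr 1) (.par (.resL (.inr 0) (.par .leaf .leaf)) .leaf))) ?_ ?_ ?_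
    · simp [-Multiset.singleton_add, wireBody, permLoc]
      abel
    all_goals simp
  · refine Flat.bisim_of_eq
      (.resV (.inr 0) (.resL (.inr 0) (.resV (.inr 1) (.resL (.inr 1) (.par
        (.par (.par .leaf .leaf) (.par .leaf .leaf)) (.par .leaf .leaf))))))
      (.par (.resV (.inr 1) (.par .leaf (.resV (.inr 0) (.par .leaf .leaf))))
        (.resL (.inr 1) (.par (.resL (.inr 0) (.par .leaf .leaf)) .leaf))) ?_ ?_ ?_
    · simp [-Multiset.singleton_add, locTree, varTree]
      abel
    all_goals simp

/-- The input of the wire is in front and meets the permeable output. The output at `q` floats out,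
and two wires for each name remain next to `P`. -/
theorem expands_perm_out_io {L V : Type} (q : L) (P : Proc S (Option L) (Option V))
    (h : Expands D (resV (resL (par (par (varWire .io (some none) none) (wire .io none (some none)))
      (P.map (Option.map some) (Option.map some))))) P) :
    Expands D (resL (par (wire .io none (some q))
      (perm .io .out none (P.map (Option.map some) id)))) (perm .io .out q P) := by
  have com := expands_com_perm_pre (D := D) .io P (perm .io .out (some q)
    (par (wire .io (some none) none) (varWire .io none (some none))))
  refine ((bisim_wire _ _ _).expands.par (.refl _)).resL.trans (Expands.trans (Bisim.expands ?_)
    (com.trans (Expands.trans (Bisim.expands ?_)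
      ((respectful_out_tree .io (.node .leaf .leaf) (.node .leaf .leaf) h).perm .out q))))
  · refine Flat.bisim_of_eq
      (.resL (.inr 0) (.par .leaf (.resV (.inr 1) (.resL (.inr 1) (.par .leaf .leaf)))))
      (.resL (.inr 0) (.par (.resV (.inr 1) (.resL (.inr 1) (.par .leaf .leaf))) .leaf)) ?_ ?_ ?_
    · simp [-Multiset.singleton_add, wireBody, permLoc]
      abel
    all_goals simp
  · refine Flat.bisim_of_eq
      (.resV (.inr 0) (.resL (.inr 0) (.resV (.inr 1) (.resL (.inr 1) (.par
        (.par .leaf (.resV (.inr 2) (.resL (.inr 2) (.par .leaf (.par .leaf .leaf)))))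
        (.par .leaf .leaf))))))
      (.resV (.inr 2) (.resL (.inr 2) (.par .leaf (.resV (.inr 0) (.resL (.inr 0) (.par
        (.par (.resV (.inr 1) (.par .leaf .leaf)) (.resL (.inr 1) (.par .leaf .leaf))) .leaf))))))
      ?_ ?_ ?_
    · simp [-Multiset.singleton_add, locTree, varTree]
      abel
    all_goals simp

theorem expands_perm_out_par {L V : Type} (q : L) (P : Proc S (Option L) (Option V))
    (h : Expands D (resV (resL (par (par (varWire .par (some none) none)
      (wire .par none (some none)))
      (P.map (Option.map some) (Option.map some))))) P) :
    Expands D (resL (par (wire .par none (some q))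
      (perm .par .out none (P.map (Option.map some) id)))) (perm .par .out q P) := by
  have com := expands_com_perm_perm (D := D) .par P (perm .par .out (some q)
    (par (wire .par (some none) none) (varWire .par none (some none))))
  refine ((bisim_wire _ _ _).expands.par (.refl _)).resL.trans (Expands.trans (Bisim.expands ?_)
    (com.trans (Expands.trans (Bisim.expands ?_)
      ((respectful_out_tree .par (.node (.node .leaf .leaf) .leaf) (.node .leaf (.node .leaf .leaf))
        h).perm .out q))))
  · refine Flat.bisim_of_eq
      (.resL (.inr 0) (.par (.resV (.inr 1) (.resL (.inr 1) (.par .leaf (.resV (.inr 2)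
        (.resL (.inr 2) (.par .leaf (.par .leaf .leaf)))))))
        (.resV (.inr 3) (.resL (.inr 3) (.par .leaf .leaf)))))
      (.resL (.inr 0) (.par (.resV (.inr 3) (.resL (.inr 3) (.par .leaf .leaf)))
        (.resV (.inr 1) (.resL (.inr 1) (.par .leaf (.resV (.inr 2)
          (.resL (.inr 2) (.par .leaf (.par .leaf .leaf))))))))) ?_ ?_ ?_
    · simp [-Multiset.singleton_add]
      abel
    all_goals simp
  · refine Flat.bisim_of_eq
      (.resV (.inr 0) (.resL (.inr 0) (.resV (.inr 1) (.resL (.inr 1) (.par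
        (.par .leaf (.resV (.inr 2) (.resL (.inr 2) (.par .leaf (.par .leaf .leaf)))))
        (.par (.resV (.inr 3) (.par .leaf .leaf)) (.resL (.inr 3) (.par .leaf .leaf))))))))
      (.resV (.inr 2) (.resL (.inr 2) (.par .leaf (.resV (.inr 0) (.resL (.inr 0) (.par
        (.par (.resV (.inr 1) (.par .leaf (.resV (.inr 3) (.par .leaf .leaf))))
          (.resL (.inr 1) (.par (.resL (.inr 3) (.par .leaf .leaf)) .leaf))) .leaf))))))
      ?_ ?_ ?_
    · simp [-Multiset.singleton_add, locTree, varTree]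
      abel
    all_goals simp

end PiI

/-! ### Assembly of the laws; transitivity and chains are instances of the collapse of trees. -/

theorem mainTheorem2 (S : PiI.Sig) (D : PiI.Defs S) (k : PiI.WireKind) :
    PiI.SatisfiesWireLaws D (PiI.concreteWires S k) ∧
    (∀ (n : ℕ) {L V : Type} (a b : L), a ≠ b →
      PiI.Expands D (PiI.locChain (PiI.concreteWires S k) n a b : PiI.Proc S L V)
        ((PiI.concreteWires S k).loc a b)) ∧
    (∀ (n : ℕ) {L V : Type} (x y : V), x ≠ y →
      PiI.Expands D (PiI.varChain (PiI.concreteWires S k) n x y : PiI.Proc S L V)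
        ((PiI.concreteWires S k).var x y)) := by
  refine ⟨?_, fun n L V a b h => ?_, fun n L V x y _ => ?_⟩
  · exact
      { loc_fn := fun a b _ => ⟨rfl, rfl⟩
        var_fn := fun x y _ => PiI.varWire_fn k x y
        loc_use := fun a b h => PiI.wire_use k h
        var_use := fun x y h => PiI.varWire_use k h
        loc_no_tau := fun a b P h s => s.not_quiet h
        var_no_tau := fun x y P _ s => s.not_quiet trivial
        loc_trans := fun a c h => PiI.locTree_expands_wire k (.node .leaf .leaf) h
        var_trans := fun x z _ => PiI.varTree_expands_varWire k (.node .leaf .leaf) x z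
        perm_inp := fun p P h => by
          cases k
          · exact PiI.expands_perm_inp_io p P
          · exact PiI.expands_perm_inp_oi p P h
          · exact PiI.expands_perm_inp_par p P h
        perm_out := fun q P h => by
          cases k
          · exact PiI.expands_perm_out_io q P h
          · exact PiI.expands_perm_out_oi q P
          · exact PiI.expands_perm_out_par q P h
        rep_inp := fun x P h => PiI.expands_rep_inp k x P h
        perm_out_var := fun y P h => PiI.expands_perm_out_var k y P h
        var_rep := fun x y _ => ⟨_, rfl⟩ }
  · rw [PiI.locChain_eq]
    exact PiI.locTree_expands_wire k _ h
  · rw [PiI.varChain_eq]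
    exact PiI.varTree_expands_varWire k _ x y
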